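/- Let $N\ge 1$, let $\gamma$ be the standard Gaussian measure on $\mathbb R^N$, write $L^2_\gamma=L^2(\mathbb R^N,\gamma)$ and $\mathbb R^{N+1}_+=\{(x,z):x\in\mathbb R^N,\ z>0\}$; all functions are real valued. Let $\Delta_\gamma u=\Delta u-x\cdot\nabla u$ be the Ornstein–Uhlenbeck operator, with semigroup $e^{t\Delta_\gamma}u(x)=\int u(e^{-t}x+\sqrt{1-e^{-2t}}\,y)\,d\gamma(y)$. For $\sigma\in(0,1)$: - $\mathrm{Dom}((-\Delta_\gamma)^\sigma)$ is the set of $u\in L^2_\gamma$ for which $(-\Delta_\gamma)^\sigma u:=\frac1{\Gamma(-\sigma)}\int_0^\infty\frac{e^{t\Delta_\gamma}u-u}{t^{\sigma+1}}\,dt$ exists as the limit in $L^2_\gamma$, as $\varepsilon\to0^+$, of the integrals over $(\varepsilon,\infty)$. - $[u]^2_{H^\sigma_\gamma}:=\inf\iint_{\mathbb R^{N+1}_+}\left(|\nabla_xv|^2+|\partial_zv|^2\right)z^{1-2\sigma}\,d\gamma(x)\,dz\in[0,\infty]$, the infimum being over all $v\in H^1_{\rm loc}(\mathbb R^{N+1}_+)$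 with $v(\cdot,0)=u$, i.e. $v(\cdot,z)-u\to0$ in $L^2_\gamma$ as $z\to0^+$. - The Stinga–Torrea extension of order $\sigma$ of $\varphi\in L^2_\gamma$ is the weak solution $U\in H^1_{\rm loc}(\mathbb R^{N+1}_+)$ with finite energy $\iint(|\nabla_xU|^2+|\partial_zU|^2)z^{1-2\sigma}\,d\gamma\,dz<\infty$ of $$\Delta_{\gamma,x}U+\frac{1-2\sigma}{z}\,\partial_zU+\partial_z^2U=0\ \text{ in }\mathbb R^{N+1}_+,\qquad U(\cdot,0)=\varphi,$$ where $U(\cdot,z)$, $z>0$, denotes the slices of the representative for which $z\mapsto U(\cdot,z)\in L^2_\gamma$ is continuous on $(0,\infty)$. For measurable $E\subset\mathbb R^N$ and $s\in(0,1)$ put $P^\gamma_s(E):=\frac12[\chi_E]^2_{H^{s/2}_\gamma}\in[0,\infty]$. For $r\in(0,2)$ let $$K_r:=\frac{r\,|\Gamma(-\frac r2)|}{4^{r/2}\,\Gamma(\frac r2)},\qquad \beta_r:=\frac1{4^{r/2}K_r}\,\frac{\Gamma(1-\frac r2)}{\Gamma(1+\frac r2)} .$$ Let $s\in(0,1)$.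 Then: 1. If $\varphi\in\mathrm{Dom}((-\Delta_\gamma)^s)$ and $U_\varphi$ is its extension of order $s$, then for every $z>0$ the function $\varphi\,(\varphi-U_\varphi(\cdot,z))$ is $\gamma$-integrable and $$\int_{\mathbb R^N}\varphi\,(\varphi-U_\varphi(\cdot,z))\,d\gamma\le\beta_{2s}\,z^{2s}\,[\varphi]^2_{H^s_\gamma}.$$ 2. If $E\subset\mathbb R^N$ is measurable and $U_E$ is the extension of order $s/2$ of $\chi_E$, then for every $z>0$ the function $1-U_E(\cdot,z)$ is $\gamma$-integrable on $E$ and $$\int_E(1-U_E(\cdot,z))\,d\gamma\le 2\,\beta_s\,z^s\,P^\gamma_s(E).$$ -/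

import Mathlib

open MeasureTheory Filter Topology Set
open scoped ENNReal ContDiff

namespace GaussFrac

noncomputable section

/-- `ℝ^N` with the Euclidean norm. -/
abbrev Sp (N : ℕ) : Type := EuclideanSpace ℝ (Fin N)

/-- The standard Gaussian measure `γ` on `ℝ^N`. -/
abbrev gauss (N : ℕ) : Measure (Sp N) := ProbabilityTheory.stdGaussian (Sp N)

/-! ### The Ornstein-Uhlenbeck semigroup and the fractional powers of `-Δ_γ` -/

/-- The Ornstein-Uhlenbeck semigroup `e^{tΔ_γ}`, by the Mehler formula. -/
def ouSemigroup (N : ℕ) (t : ℝ) (u : Sp N → ℝ) (x : Sp N) : ℝ :=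
  ∫ y, u (Real.exp (-t) • x + Real.sqrt (1 - Real.exp (-2 * t)) • y) ∂(gauss N)

/-- The Bochner subordination integral of `(-Δ_γ)^s u`, truncated at `ε`:
`Γ(-s)⁻¹ ∫_ε^∞ (e^{tΔ_γ} u - u) t^{-s-1} dt`. -/
def fracOUTrunc (N : ℕ) (s ε : ℝ) (u : Sp N → ℝ) (x : Sp N) : ℝ :=
  (Real.Gamma (-s))⁻¹ * ∫ t in Ioi ε, (ouSemigroup N t u x - u x) / t ^ (s + 1)

/-- `u` lies in the domain of `(-Δ_γ)^s` and `f = (-Δ_γ)^s u`: the (improper at `0`) Bochner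
subordination integral converges to `f` in `L²_γ`. -/
structure IsFracOU (N : ℕ) (s : ℝ) (u f : Sp N → ℝ) : Prop where
  memLp : MemLp u 2 (gauss N)
  memLp_image : MemLp f 2 (gauss N)
  tendsto : Tendsto (fun ε : ℝ => eLpNorm (fun x => fracOUTrunc N s ε u x - f x) 2 (gauss N))
    (𝓝[>] 0) (𝓝 0)

/-- `Dom((-Δ_γ)^s)`. -/
def fracOUDomain (N : ℕ) (s : ℝ) : Set (Sp N → ℝ) := {u | ∃ f, IsFracOU N s u f}

/-! ### Sobolev functions on the upper half-space `ℝ^{N+1}_+` -/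

/-- The open upper half-space `ℝ^{N+1}_+ = {(x, z) : z > 0}`. -/
def upperHalf (N : ℕ) : Set (Sp N × ℝ) := {p | 0 < p.2}

/-- `η ∈ C_c^∞(ℝ^{N+1}_+)`. -/
structure IsTestFunction (N : ℕ) (η : Sp N × ℝ → ℝ) : Prop where
  smooth : ContDiff ℝ ∞ η
  compact : HasCompactSupport η
  support : tsupport η ⊆ upperHalf N

/-- `v ∈ H^1_loc(ℝ^{N+1}_+)` with weak gradient `G = (∇_x v, ∂_z v)`. -/
structure HasWeakGradient (N : ℕ) (v : Sp N × ℝ → ℝ) (G : Sp N × ℝ → Sp N × ℝ) : Prop where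
  memLp_loc : ∀ K : Set (Sp N × ℝ), IsCompact K → K ⊆ upperHalf N →
    MemLp v 2 (volume.restrict K)
  memLp_grad_loc : ∀ K : Set (Sp N × ℝ), IsCompact K → K ⊆ upperHalf N →
    MemLp G 2 (volume.restrict K)
  weak : ∀ η : Sp N × ℝ → ℝ, IsTestFunction N η → ∀ (w : Sp N) (τ : ℝ),
    ∫ p in upperHalf N, v p * fderiv ℝ η p (w, τ) =
      - ∫ p in upperHalf N, (inner ℝ (G p).1 w + (G p).2 * τ) * η p

/-- The measure `dγ(x) dz` on the upper half-space. -/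
def gaussHalf (N : ℕ) : Measure (Sp N × ℝ) := (gauss N).prod (volume.restrict (Ioi 0))

/-- The weighted energy `∬ (|∇_x v|² + |∂_z v|²) z^{1-2s} dγ(x) dz` of a function with
gradient `G`. -/
def energy (N : ℕ) (s : ℝ) (G : Sp N × ℝ → Sp N × ℝ) : ℝ≥0∞ :=
  ∫⁻ p, ENNReal.ofReal ((‖(G p).1‖ ^ 2 + (G p).2 ^ 2) * p.2 ^ (1 - 2 * s)) ∂(gaussHalf N)

/-- `v(·, 0) = u`: the slices `v(·, z)` (defined for almost every `z`) converge to `u` in `L²_γ`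
as `z → 0⁺`. For `u ∈ L²_γ` and `v` of finite weighted energy this is the usual trace. -/
def HasTrace (N : ℕ) (v : Sp N × ℝ → ℝ) (u : Sp N → ℝ) : Prop :=
  Tendsto (fun z : ℝ => eLpNorm (fun x => v (x, z) - u x) 2 (gauss N))
    (𝓝[>] 0 ⊓ ae volume) (𝓝 0)

/-- The squared seminorm `[u]²_{H^s_γ} ∈ [0, ∞]`: the infimum of the weighted energy over all
`v ∈ H^1_loc(ℝ^{N+1}_+)` with `v(·, 0) = u`. -/
def seminormSq (N : ℕ) (s : ℝ) (u : Sp N → ℝ) : ℝ≥0∞ :=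
  ⨅ (v : Sp N × ℝ → ℝ) (G : Sp N × ℝ → Sp N × ℝ) (_ : HasWeakGradient N v G)
    (_ : HasTrace N v u), energy N s G

/-- The characteristic function of `E`. -/
def chi (N : ℕ) (E : Set (Sp N)) : Sp N → ℝ := E.indicator (fun _ => 1)

/-- The fractional Gaussian perimeter `P_s^γ(E) = ½ [χ_E]²_{H^{s/2}_γ} ∈ [0, ∞]`. -/
def fracPerimeter (N : ℕ) (s : ℝ) (E : Set (Sp N)) : ℝ≥0∞ :=
  seminormSq N (s / 2) (chi N E) / 2

/-! ### The extension problem -/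

/-- `U` is the Stinga-Torrea extension of `φ`, that is, the finite-energy weak solution of
`Δ_{γ,x} V + ((1-2s)/z) ∂_z V + ∂_z² V = 0` in `ℝ^{N+1}_+`, `V(·, 0) = φ`.
The equation is `div (z^{1-2s} e^{-|x|²/2} ∇V) = 0`, in weak form. Slices `U(·, z)` for individual
`z > 0` are those of the representative for which `z ↦ U(·, z) ∈ L²_γ` is continuous.
Without finiteness of the energy the solution would not be unique (`z^{2s}` solves the problem
with datum `0`). -/
structure IsExtension (N : ℕ) (s : ℝ) (φ : Sp N → ℝ) (U : Sp N × ℝ → ℝ) : Prop where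
  weak_solution : ∃ G : Sp N × ℝ → Sp N × ℝ, HasWeakGradient N U G ∧ energy N s G < ⊤ ∧
    ∀ η : Sp N × ℝ → ℝ, IsTestFunction N η →
      ∫ p, p.2 ^ (1 - 2 * s) * fderiv ℝ η p (G p) ∂(gaussHalf N) = 0
  slice_memLp : ∀ z : ℝ, 0 < z → MemLp (fun x => U (x, z)) 2 (gauss N)
  slice_continuous : ∀ z₀ : ℝ, 0 < z₀ →
    Tendsto (fun z : ℝ => eLpNorm (fun x => U (x, z) - U (x, z₀)) 2 (gauss N)) (𝓝 z₀) (𝓝 0)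
  boundary : HasTrace N U φ

/-! ### The constants -/

/-- `K_r`, indexed so that `K_{2s} = 2s |Γ(-s)| / (4^s Γ(s))`. -/
def constK (r : ℝ) : ℝ :=
  r * |Real.Gamma (-(r / 2))| / (4 ^ (r / 2) * Real.Gamma (r / 2))

/-- `β_r`, indexed so that `β_{2s} = Γ(1-s) / (4^s K_{2s} Γ(1+s))`. -/
def constBeta (r : ℝ) : ℝ :=
  1 / (4 ^ (r / 2) * constK r) * (Real.Gamma (1 - r / 2) / Real.Gamma (1 + r / 2))

end

end GaussFrac

/-! Everything is diagonal in the normalized Hermite products `hermiteOn k`, eigenfunctions of -Δ_γ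
with eigenvalue λ = `eig k`. In such a mode the coefficient c of the extension solves (t^{1-2σ} c')'
= λ t^{1-2σ} c with finite energy, and c(0) = c0 is the coefficient of the datum. Let p = t^{1-2σ}
c' be the flux. Multiplying the equation by c and integrating shows that -p(z) c(z) is the mode
energy beyond height z. Hence p c ≤ 0, so p² is nonincreasing, and the whole mode energy is -p(0) c0
= |p(0) c0|. Therefore c0 (c0 - c(z)) = -c0 ∫_0^z t^{2σ-1} p dt ≤ |c0 p(0)| ∫_0^z t^{2σ-1} dt =
z^{2σ}/(2σ) · (mode energy), and 1/(2σ) is exactly β_{2σ} (`constBeta_eq`). A solution minimizes the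
mode energy for its boundary value, so the energy on the right may be replaced by that of any
competitor (`IsModeSolution.bound`).

Summing over modes, Parseval turns the left side into ∫ φ (φ - U) dγ, and Bessel bounds the mode
energies of a competitor by its full energy (`HasWeakGradient.sum_mode_energy_le`). The infimum over
competitors is taken last, so neither a minimizer nor a spectral formula for the seminorm is needed.
The statement on sets is the case φ = χ_E.

The technical work is to extract modes from a weak gradient. A competitor is only locally square
integrable, so its coefficient `coef` is defined as the coefficient of the trace plus a primitive of
`coefDeriv`, and is tied to the function through cut-off Hermite polynomials
(`HasWeakGradient.tendsto_pairing`). The mode of eigenvalue 0 is treated apart: there the energy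
does not control the size of c, but the flux is constant and finite energy forces c to be constant.
-/

namespace GaussFrac

/-! ### Weak derivatives on the half-line. -/

section OneDim

/-- Integration by parts for primitives of integrable functions. -/
theorem integral_mul_primitive {F G f g : ℝ → ℝ} {a b : ℝ} (hab : a ≤ b)
    (hf : IntervalIntegrable f volume a b) (hg : IntervalIntegrable g volume a b)
    (hF : ∀ x ∈ Icc a b, F x = F a + ∫ t in a..x, f t)
    (hG : ∀ x ∈ Icc a b, G x = G a + ∫ t in a..x, g t) :
    ∫ x in a..b, (f x * G x + F x * g x) = F b * G b - F a * G a := by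
  have ha : a ∈ uIcc a b := left_mem_uIcc
  have hFac : AbsolutelyContinuousOnInterval (fun x => F a + ∫ t in a..x, f t) a b :=
    (LipschitzOnWith.absolutelyContinuousOnInterval
      ((LipschitzWith.const (F a)).lipschitzOnWith)).fun_add
      (hf.absolutelyContinuousOnInterval_intervalIntegral ha)
  have hGac : AbsolutelyContinuousOnInterval (fun x => G a + ∫ t in a..x, g t) a b :=
    (LipschitzOnWith.absolutelyContinuousOnInterval
      ((LipschitzWith.const (G a)).lipschitzOnWith)).fun_add
      (hg.absolutelyContinuousOnInterval_intervalIntegral ha)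
  have h := hFac.integral_deriv_mul_eq_sub hGac
  rw [hF b ⟨hab, le_rfl⟩, hG b ⟨hab, le_rfl⟩]
  simp only [intervalIntegral.integral_same, add_zero] at h
  rw [← h]
  apply intervalIntegral.integral_congr_ae
  filter_upwards [hf.ae_hasDerivAt_integral, hg.ae_hasDerivAt_integral] with x hx1 hx2 hx
  have hx' : x ∈ uIcc a b := uIoc_subset_uIcc hx
  rw [((hx1 hx' a ha).const_add _).deriv, ((hx2 hx' a ha).const_add _).deriv]
  rw [uIcc_of_le hab] at hx'
  rw [← hF x hx', ← hG x hx']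

/-- The normalization a < 1 < b covers the empty set and yields a ≤ b without a case distinction. -/
theorem _root_.IsCompact.exists_subset_Icc_of_subset_Ioi {K : Set ℝ} (hK : IsCompact K)
    (h : K ⊆ Ioi 0) : ∃ a b : ℝ, 0 < a ∧ a < 1 ∧ 1 < b ∧ K ⊆ Icc a b := by
  rcases K.eq_empty_or_nonempty with rfl | hne
  · exact ⟨1 / 2, 2, by norm_num, by norm_num, by norm_num, empty_subset _⟩
  · obtain ⟨m, hm, hm'⟩ := hK.exists_isLeast hne
    obtain ⟨M, hM, hM'⟩ := hK.exists_isGreatest hne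
    have := h hm
    refine ⟨min m (1 / 2), max M 2, by simp_all, by simp; right; norm_num,
      by simp, fun x hx => ⟨?_, ?_⟩⟩
    · exact (min_le_left _ _).trans (hm' hx)
    · exact (hM' hx).trans (le_max_left _ _)

theorem setIntegral_Ioi_eq_of_support {f : ℝ → ℝ} {a b : ℝ} (ha : 0 < a) (hab : a ≤ b)
    (h : ∀ x, x ∉ Icc a b → f x = 0) : ∫ x in Ioi 0, f x = ∫ x in a..b, f x := by
  rw [intervalIntegral.integral_of_le hab, ← integral_Icc_eq_integral_Ioc]
  refine setIntegral_eq_of_subset_of_forall_sdiff_eq_zero measurableSet_Ioi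
    (fun x hx => lt_of_lt_of_le ha hx.1) (fun x hx => h x hx.2)

theorem _root_.MeasureTheory.LocallyIntegrableOn.intervalIntegrable_Ioi {f : ℝ → ℝ}
    (hf : LocallyIntegrableOn f (Ioi 0)) {a b : ℝ} (ha : 0 < a) (hb : 0 < b) :
    IntervalIntegrable f volume a b := by
  rw [intervalIntegrable_iff]
  have : uIcc a b ⊆ Ioi 0 := fun x hx => lt_of_lt_of_le (lt_min ha hb) hx.1
  exact (hf.integrableOn_compact_subset this isCompact_uIcc).mono_set uIoc_subset_uIcc

theorem continuousOn_primitive_Ioi {g : ℝ → ℝ} (hg : LocallyIntegrableOn g (Ioi 0)) :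
    ContinuousOn (fun z => ∫ t in (1:ℝ)..z, g t) (Ioi 0) := by
  intro x hx
  have hx : 0 < x := hx
  have hi : IntervalIntegrable g volume (min (x / 2) (1 / 2)) (max (2 * x) 2) :=
    hg.intervalIntegrable_Ioi (by positivity) (by positivity)
  have h1 : (1:ℝ) ∈ uIcc (min (x / 2) (1 / 2)) (max (2 * x) 2) := by
    rw [uIcc_of_le (by simp; left; left; linarith)]
    constructor <;> norm_num
  have := intervalIntegral.continuousOn_primitive_interval' hi h1
  refine (this.continuousAt ?_).continuousWithinAt
  rw [uIcc_of_le (by simp; left; left; linarith)]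
  apply Icc_mem_nhds
  · exact lt_of_le_of_lt (min_le_left _ _) (by linarith)
  · exact lt_of_lt_of_le (by linarith) (le_max_left _ _)

/-- A locally integrable function with vanishing weak derivative is constant. -/
theorem ae_const_of_integral_mul_deriv_eq_zero {F : ℝ → ℝ} (hF : LocallyIntegrableOn F (Ioi 0))
    (h : ∀ θ : ℝ → ℝ, ContDiff ℝ ∞ θ → HasCompactSupport θ → tsupport θ ⊆ Ioi 0 →
      ∫ z in Ioi 0, F z * deriv θ z = 0) :
    ∃ c : ℝ, ∀ᵐ z, z ∈ Ioi (0:ℝ) → F z = c := by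
  let B : ContDiffBump (1:ℝ) := ⟨1 / 4, 1 / 2, by norm_num, by norm_num⟩
  let ζ₀ : ℝ → ℝ := B.normed volume
  have hζ₀ : ContDiff ℝ ∞ ζ₀ := B.contDiff_normed
  have hζ₀c : HasCompactSupport ζ₀ := B.hasCompactSupport_normed
  have hζ₀s : tsupport ζ₀ ⊆ Ioi 0 := by
    rw [B.tsupport_normed_eq, Real.closedBall_eq_Icc]
    intro x hx
    have : (1:ℝ) - 1 / 2 ≤ x := hx.1
    exact lt_of_lt_of_le (by norm_num) this
  have hint : ∀ ζ : ℝ → ℝ, Continuous ζ → HasCompactSupport ζ → tsupport ζ ⊆ Ioi 0 →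
      Integrable (fun z => ζ z * F z) (volume.restrict (Ioi 0)) := by
    intro ζ hζ hζc hζs
    have h1 : IntegrableOn (fun z => ζ z * F z) (tsupport ζ) :=
      (hF.integrableOn_compact_subset hζs hζc).continuousOn_mul hζ.continuousOn hζc
    have h2 : Integrable (fun z => ζ z * F z) := by
      rw [← integrableOn_iff_integrable_of_support_subset (s := tsupport ζ)]
      · exact h1
      · exact (Function.support_mul_subset_left _ _).trans (subset_tsupport ζ)
    exact h2.integrableOn
  -- Since ζ₀ has integral 1, the constant can only be this average.
  refine ⟨∫ z in Ioi 0, ζ₀ z * F z, ?_⟩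
  set c := ∫ z in Ioi 0, ζ₀ z * F z with hc
  have key := IsOpen.ae_eq_zero_of_integral_contDiff_smul_eq_zero (μ := volume)
    (f := fun z => F z - c) (U := Ioi (0:ℝ)) isOpen_Ioi
    (hF.sub ((locallyIntegrable_const c).locallyIntegrableOn _)) ?_
  · filter_upwards [key] with z hz hz'
    linarith [hz hz']
  intro ζ hζ hζc hζs
  set m := ∫ z, ζ z with hm
  -- Subtracting m ζ₀ makes the mean zero, so κ is the derivative of a compactly supported θ;
  -- testing with θ gives ∫ F ζ = m c.
  let κ : ℝ → ℝ := fun z => ζ z - m * ζ₀ z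
  have hκ : ContDiff ℝ ∞ κ := hζ.sub (contDiff_const.mul hζ₀)
  have hκ0 : ∫ z, κ z = 0 := by
    have e : ∫ z, κ z = (∫ z, ζ z) - ∫ z, m * ζ₀ z :=
      integral_sub (hζ.continuous.integrable_of_hasCompactSupport hζc)
        ((hζ₀.continuous.integrable_of_hasCompactSupport hζ₀c).const_mul m)
    rw [e, integral_const_mul, B.integral_normed]; simp [hm]
  obtain ⟨a, b, ha, ha1, hb1, hKab⟩ :=
    (hζc.isCompact.union hζ₀c.isCompact).exists_subset_Icc_of_subset_Ioi
      (union_subset hζs hζ₀s)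
  have hκs : ∀ x, x ∉ Icc a b → κ x = 0 := by
    intro x hx
    have h1 : ζ x = 0 := image_eq_zero_of_notMem_tsupport fun h => hx (hKab (Or.inl h))
    have h2 : ζ₀ x = 0 := image_eq_zero_of_notMem_tsupport fun h => hx (hKab (Or.inr h))
    simp [κ, h1, h2]
  have hab : a ≤ b := by linarith
  have hκi : Integrable κ := (hζ.continuous.integrable_of_hasCompactSupport hζc).sub
        ((hζ₀.continuous.integrable_of_hasCompactSupport hζ₀c).const_mul m)
  have hκi0 : ∫ x in a..b, κ x = 0 := by
    rw [intervalIntegral.integral_of_le hab, ← integral_Icc_eq_integral_Ioc,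
      setIntegral_eq_integral_of_forall_compl_eq_zero hκs, hκ0]
  let θ : ℝ → ℝ := fun z => ∫ t in a..z, κ t
  have hθd : ∀ z, HasDerivAt θ (κ z) z := fun z =>
    intervalIntegral.integral_hasDerivAt_right (hκ.continuous.intervalIntegrable _ _)
      (hκ.continuous.stronglyMeasurableAtFilter _ _) hκ.continuous.continuousAt
  have hθ' : deriv θ = κ := funext fun z => (hθd z).deriv
  have hθ : ContDiff ℝ ∞ θ := by
    rw [contDiff_infty_iff_deriv]
    exact ⟨fun z => (hθd z).differentiableAt, hθ' ▸ hκ⟩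
  have hθs : ∀ x, x ∉ Icc a b → θ x = 0 := by
    intro x hx
    rcases lt_or_ge x a with hxa | hxa
    · refine intervalIntegral.integral_zero_ae (ae_of_all _ fun t ht => ?_)
      rw [uIoc_of_ge hxa.le] at ht
      rcases ht.2.lt_or_eq with h' | h'
      · exact hκs t fun h => absurd h.1 (not_le.2 h')
      -- The half-open interval contains its right endpoint, where κ vanishes by continuity from the
      -- left.
      · subst h'
        have : Tendsto κ (𝓝[<] t) (𝓝 (κ t)) := (hκ.continuous.tendsto t).mono_left nhdsWithin_le_nhds
        refine tendsto_nhds_unique this (Tendsto.congr' ?_ tendsto_const_nhds)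
        filter_upwards [self_mem_nhdsWithin] with y hy
        exact (hκs y fun h => absurd h.1 (not_le.2 hy)).symm
    · have hxb : b < x := by
        by_contra h'
        exact hx ⟨hxa, not_lt.1 h'⟩
      have e : θ x = (∫ t in a..b, κ t) + ∫ t in b..x, κ t :=
        (intervalIntegral.integral_add_adjacent_intervals
          (hκ.continuous.intervalIntegrable _ _) (hκ.continuous.intervalIntegrable _ _)).symm
      rw [e, hκi0, zero_add]
      refine intervalIntegral.integral_zero_ae (ae_of_all _ fun t ht => ?_)
      rw [uIoc_of_le hxb.le] at ht
      exact hκs t fun h => absurd h.2 (not_le.2 ht.1)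
  have hts : tsupport θ ⊆ Icc a b :=
    closure_minimal (fun x hx => by_contra fun h => hx (hθs x h)) isClosed_Icc
  have H := h θ hθ (HasCompactSupport.intro isCompact_Icc hθs)
    (hts.trans fun x hx => lt_of_lt_of_le ha hx.1)
  rw [hθ'] at H
  have e1 : ∫ z in Ioi 0, F z * κ z = (∫ z in Ioi 0, ζ z * F z) - m * c := by
    rw [hc, ← integral_const_mul, ← integral_sub (hint ζ hζ.continuous hζc hζs)
      ((hint ζ₀ hζ₀.continuous hζ₀c hζ₀s).const_mul m)]
    congr 1; ext z; simp only [κ]; ring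
  have e2 : ∫ x, ζ x • (F x - c) = (∫ z in Ioi 0, ζ z * F z) - m * c := by
    have hsupp : ∀ x, x ∉ Ioi (0:ℝ) → ζ x = 0 := fun x hx =>
      image_eq_zero_of_notMem_tsupport fun h' => hx (hζs h')
    have e3 : m = ∫ z in Ioi 0, ζ z :=
      (setIntegral_eq_integral_of_forall_compl_eq_zero hsupp).symm
    have hi := hζ.continuous.integrable_of_hasCompactSupport hζc (μ := volume)
    rw [e3, ← integral_mul_const, ← integral_sub (hint ζ hζ.continuous hζc hζs)
      (hi.integrableOn.mul_const c), ← setIntegral_eq_integral_of_forall_compl_eq_zero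
        (s := Ioi 0) (fun x hx => by simp [hsupp x hx])]
    congr 1; ext z; simp [mul_sub]
  rw [e2, ← e1, H]

/-- A locally integrable function with locally integrable weak derivative agrees almost everywhere
with a primitive of its weak derivative. -/
theorem ae_eq_primitive_of_weak_deriv {f g : ℝ → ℝ} (hf : LocallyIntegrableOn f (Ioi 0))
    (hg : LocallyIntegrableOn g (Ioi 0))
    (h : ∀ θ : ℝ → ℝ, ContDiff ℝ ∞ θ → HasCompactSupport θ → tsupport θ ⊆ Ioi 0 →
      ∫ z in Ioi 0, f z * deriv θ z = - ∫ z in Ioi 0, g z * θ z) :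
    ∃ c : ℝ, ∀ᵐ z, z ∈ Ioi (0:ℝ) → f z = c + ∫ t in (1:ℝ)..z, g t := by
  have hcont := continuousOn_primitive_Ioi hg
  have hpl : LocallyIntegrableOn (fun z => ∫ t in (1:ℝ)..z, g t) (Ioi 0) :=
    hcont.locallyIntegrableOn measurableSet_Ioi
  -- The difference of f and the primitive of g has weak derivative zero.
  suffices H : ∀ θ : ℝ → ℝ, ContDiff ℝ ∞ θ → HasCompactSupport θ → tsupport θ ⊆ Ioi 0 →
      ∫ z in Ioi 0, (f z - ∫ t in (1:ℝ)..z, g t) * deriv θ z = 0 by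
    obtain ⟨c, hc⟩ := ae_const_of_integral_mul_deriv_eq_zero (hf.sub hpl) H
    refine ⟨c, ?_⟩
    filter_upwards [hc] with z hz hz'
    have := hz hz'
    simp only [Pi.sub_apply] at this
    linarith
  intro θ hθ hθc hθs
  obtain ⟨a, b, ha, ha1, hb1, hab'⟩ := hθc.isCompact.exists_subset_Icc_of_subset_Ioi hθs
  have hab : a ≤ b := by linarith
  have h0 : ∀ x, x ∉ Icc a b → θ x = 0 := fun x hx =>
    image_eq_zero_of_notMem_tsupport fun h' => hx (hab' h')
  have h0' : ∀ x, x ∉ Icc a b → deriv θ x = 0 := fun x hx =>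
    image_eq_zero_of_notMem_tsupport fun h' => hx (hab' (tsupport_deriv_subset (𝕜 := ℝ) h'))
  have hH := h θ hθ hθc hθs
  -- The interval is enlarged strictly so that θ vanishes at both ends and the boundary terms drop.
  set a' := a / 2 with ha'
  have ha'0 : 0 < a' := by positivity
  have ha'a : a' < a := by simp only [ha']; linarith
  set b' := b + 1
  have ha'b : a' ≤ b' := by simp only [b']; linarith
  have hz : ∀ x, x ∉ Icc a' b' → θ x = 0 ∧ deriv θ x = 0 := fun x hx =>
    ⟨h0 x fun h => hx ⟨ha'a.le.trans h.1, by simp only [b']; linarith [h.2]⟩,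
     h0' x fun h => hx ⟨ha'a.le.trans h.1, by simp only [b']; linarith [h.2]⟩⟩
  have hb'0 : 0 < b' := by linarith
  rw [setIntegral_Ioi_eq_of_support ha'0 ha'b (fun x hx => by simp [(hz x hx).2]),
    setIntegral_Ioi_eq_of_support ha'0 ha'b (fun x hx => by simp [(hz x hx).1])] at hH
  rw [setIntegral_Ioi_eq_of_support ha'0 ha'b (fun x hx => by simp [(hz x hx).2])]
  have hdc : Continuous (deriv θ) := hθ.continuous_deriv (by simp)
  have hgi := hg.intervalIntegrable_Ioi ha'0 hb'0
  have IBP := integral_mul_primitive (F := fun z => ∫ t in (1:ℝ)..z, g t) (G := θ) (f := g)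
    (g := deriv θ) ha'b hgi (hdc.intervalIntegrable _ _)
    (fun x hx => (intervalIntegral.integral_add_adjacent_intervals
      (hg.intervalIntegrable_Ioi one_pos ha'0)
      (hg.intervalIntegrable_Ioi ha'0 (lt_of_lt_of_le ha'0 hx.1))).symm)
    (fun x hx => by
      rw [intervalIntegral.integral_deriv_eq_sub
        (fun y _ => (hθ.differentiable (by simp)).differentiableAt)
        (hdc.intervalIntegrable _ _)]; ring)
  have za : θ a' = 0 := h0 _ fun h => absurd h.1 (not_le.2 ha'a)
  have zb : θ b' = 0 := h0 _ fun h => absurd h.2 (not_le.2 (by simp [b']))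
  rw [za, zb, mul_zero, mul_zero, sub_zero, intervalIntegral.integral_add
    (hgi.mul_continuousOn hθ.continuous.continuousOn)
    ((hpl.intervalIntegrable_Ioi ha'0 hb'0).mul_continuousOn hdc.continuousOn)] at IBP
  simp only [sub_mul]
  rw [intervalIntegral.integral_sub
    ((hf.intervalIntegrable_Ioi ha'0 hb'0).mul_continuousOn hdc.continuousOn)
    ((hpl.intervalIntegrable_Ioi ha'0 hb'0).mul_continuousOn hdc.continuousOn)]
  linarith

end OneDim

/-! ### The mode equation: finite-energy solutions, minimality and flux monotonicity. -/

section WeightedODE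

/-- By the arithmetic-geometric mean inequality |g| ≤ t^{1-2σ} g² + t^{2σ-1}, and the last power is
integrable at 0 because σ > 0. This is what lets primitives of finite-energy derivatives start at
the boundary z = 0. -/
theorem intervalIntegrable_zero_of_weighted {σ : ℝ} (hσ0 : 0 < σ) {g : ℝ → ℝ}
    (hgm : AEStronglyMeasurable g (volume.restrict (Ioi 0)))
    (hg2 : IntegrableOn (fun t => t ^ (1 - 2 * σ) * g t ^ 2) (Ioi 0)) {z : ℝ} (hz : 0 ≤ z) :
    IntervalIntegrable g volume 0 z := by
  rw [intervalIntegrable_iff, uIoc_of_le hz]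
  have hsub : Ioc 0 z ⊆ Ioi 0 := fun x hx => hx.1
  have h1 : IntegrableOn (fun t : ℝ => t ^ (2 * σ - 1)) (Ioc 0 z) := by
    have := intervalIntegral.intervalIntegrable_rpow' (a := 0) (b := z) (r := 2 * σ - 1)
      (by linarith)
    rwa [intervalIntegrable_iff, uIoc_of_le hz] at this
  refine Integrable.mono' ((hg2.mono_set hsub).add h1)
    (hgm.mono_measure (Measure.restrict_mono hsub le_rfl)) ?_
  filter_upwards [ae_restrict_mem measurableSet_Ioc] with t ht
  have ht0 : 0 < t := ht.1
  set a := t ^ (1 - 2 * σ) with ha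
  have hapos : 0 < a := Real.rpow_pos_of_pos ht0 _
  have hb : t ^ (2 * σ - 1) = a⁻¹ := by
    rw [ha, ← Real.rpow_neg ht0.le]; congr 1; ring
  simp only [Pi.add_apply]
  rw [← ha, hb, Real.norm_eq_abs]
  have h2 : |g t| = (a * |g t| ) * a⁻¹ := by field_simp
  have h3 : a * g t ^ 2 + a⁻¹ = ((a * |g t|) ^ 2 + 1) * a⁻¹ := by
    rw [mul_pow, sq_abs]; field_simp
  rw [h2, h3]
  gcongr
  nlinarith [sq_nonneg (a * |g t| - 1)]

theorem continuousOn_Ici_of_primitive {g c : ℝ → ℝ} {c0 : ℝ}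
    (hg : ∀ z, 0 ≤ z → IntervalIntegrable g volume 0 z)
    (hc : ∀ z, 0 ≤ z → c z = c0 + ∫ t in 0..z, g t) (b : ℝ) (hb : 0 ≤ b) :
    ContinuousOn c (Icc 0 b) := by
  have h := intervalIntegral.continuousOn_primitive_interval' (hg b hb) (left_mem_uIcc)
  rw [uIcc_of_le hb] at h
  exact (continuousOn_const.add h).congr fun x hx => hc x hx.1

theorem continuousOn_Ioi_of_primitive {g c : ℝ → ℝ} {c0 : ℝ}
    (hg : ∀ z, 0 ≤ z → IntervalIntegrable g volume 0 z)
    (hc : ∀ z, 0 ≤ z → c z = c0 + ∫ t in 0..z, g t) :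
    ContinuousOn c (Ioi 0) := by
  intro x hx
  have hx : 0 < x := hx
  exact ((continuousOn_Ici_of_primitive hg hc (x + 1) (by linarith)).continuousAt
    (Icc_mem_nhds hx (by linarith))).continuousWithinAt

theorem intervalIntegrable_weight_mul {σ : ℝ} (hσ1 : σ < 1) {c : ℝ → ℝ} {z : ℝ} (hz : 0 ≤ z)
    (hc : ContinuousOn c (Icc 0 z)) (l : ℝ) :
    IntervalIntegrable (fun t => l * (t ^ (1 - 2 * σ) * c t)) volume 0 z := by
  have := intervalIntegral.intervalIntegrable_rpow' (a := 0) (b := z) (r := 1 - 2 * σ)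
    (by linarith)
  exact (this.mul_continuousOn (by rwa [uIcc_of_le hz])).const_mul l

theorem integrableOn_weighted_mul {σ : ℝ} {f g : ℝ → ℝ} {s : Set ℝ} (hs : s ⊆ Ioi 0)
    (hsm : MeasurableSet s)
    (hfm : AEStronglyMeasurable f (volume.restrict s))
    (hgm : AEStronglyMeasurable g (volume.restrict s))
    (hf : IntegrableOn (fun t => t ^ (1 - 2 * σ) * f t ^ 2) s)
    (hg : IntegrableOn (fun t => t ^ (1 - 2 * σ) * g t ^ 2) s) :
    IntegrableOn (fun t => t ^ (1 - 2 * σ) * (f t * g t)) s := by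
  have hw : AEStronglyMeasurable (fun t : ℝ => t ^ (1 - 2 * σ)) (volume.restrict s) :=
    (by fun_prop : Measurable fun t : ℝ => t ^ (1 - 2 * σ)).aestronglyMeasurable
  refine Integrable.mono' (hf.add hg) (hw.mul (hfm.mul hgm)) ?_
  filter_upwards [ae_restrict_mem hsm] with t ht
  have hapos : 0 < t ^ (1 - 2 * σ) := Real.rpow_pos_of_pos (hs ht) _
  simp only [Pi.add_apply]
  rw [Real.norm_eq_abs, abs_mul, abs_of_pos hapos, ← mul_add, abs_mul]
  gcongr
  rw [← sq_abs (f t), ← sq_abs (g t)]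
  nlinarith [sq_nonneg (|f t| - |g t|), sq_nonneg (|f t| + |g t|)]

/-- `c` solves `(t^{1-2σ} c')' = l t^{1-2σ} c` on the half-line with finite energy; `g = c'` and
`p = t^{1-2σ} c'`. -/
structure IsModeSolution (σ l c0 p0 : ℝ) (c g p : ℝ → ℝ) : Prop where
  meas : AEStronglyMeasurable g (volume.restrict (Ioi 0))
  deriv_sq : IntegrableOn (fun t => t ^ (1 - 2 * σ) * g t ^ 2) (Ioi 0)
  sq : IntegrableOn (fun t => t ^ (1 - 2 * σ) * c t ^ 2) (Ioi 0)
  eq_primitive : ∀ z, 0 ≤ z → c z = c0 + ∫ t in 0..z, g t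
  flux_eq : ∀ z, 0 ≤ z → p z = p0 + ∫ t in 0..z, l * (t ^ (1 - 2 * σ) * c t)
  flux_ae : ∀ᵐ t, t ∈ Ioi (0:ℝ) → t ^ (1 - 2 * σ) * g t = p t

namespace IsModeSolution

variable {σ l c0 p0 f0 : ℝ} {c g p f h : ℝ → ℝ}

/-- The integrand is the derivative of p f, the mixed energy density of c and f. The boundary term
at infinity vanishes, so the mixed energy depends on f only through its boundary value f0. -/
theorem integral_pairing (H : IsModeSolution σ l c0 p0 c g p) (hσ0 : 0 < σ) (hσ1 : σ < 1)
    (hhm : AEStronglyMeasurable h (volume.restrict (Ioi 0)))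
    (hh2 : IntegrableOn (fun t => t ^ (1 - 2 * σ) * h t ^ 2) (Ioi 0))
    (hf2 : IntegrableOn (fun t => t ^ (1 - 2 * σ) * f t ^ 2) (Ioi 0))
    (hf : ∀ z, 0 ≤ z → f z = f0 + ∫ t in 0..z, h t) :
    IntegrableOn (fun t => t ^ (1 - 2 * σ) * (g t * h t) + l * (t ^ (1 - 2 * σ) * (c t * f t)))
      (Ioi 0) ∧
    (∀ z, 0 ≤ z → p z * f z = p0 * f0 +
      ∫ t in 0..z, (t ^ (1 - 2 * σ) * (g t * h t) + l * (t ^ (1 - 2 * σ) * (c t * f t)))) ∧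
    p0 * f0 = -
      ∫ t in Ioi 0, (t ^ (1 - 2 * σ) * (g t * h t) + l * (t ^ (1 - 2 * σ) * (c t * f t))) := by
  have hgi : ∀ z, 0 ≤ z → IntervalIntegrable g volume 0 z := fun z hz =>
    intervalIntegrable_zero_of_weighted hσ0 H.meas H.deriv_sq hz
  have hhi : ∀ z, 0 ≤ z → IntervalIntegrable h volume 0 z := fun z hz =>
    intervalIntegrable_zero_of_weighted hσ0 hhm hh2 hz
  have hcc := continuousOn_Ioi_of_primitive hgi H.eq_primitive
  have hfc := continuousOn_Ioi_of_primitive hhi hf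
  have hpi : ∀ z, 0 ≤ z →
      IntervalIntegrable (fun t => l * (t ^ (1 - 2 * σ) * c t)) volume 0 z := fun z hz =>
    intervalIntegrable_weight_mul hσ1 hz (continuousOn_Ici_of_primitive hgi H.eq_primitive z hz) l
  have hpc := continuousOn_Ioi_of_primitive hpi H.flux_eq
  have hcm := hcc.aestronglyMeasurable (μ := volume) measurableSet_Ioi
  have hfm := hfc.aestronglyMeasurable (μ := volume) measurableSet_Ioi
  have hpm := hpc.aestronglyMeasurable (μ := volume) measurableSet_Ioi
  have hc0 : c 0 = c0 := by simpa using H.eq_primitive 0 le_rfl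
  have hf0 : f 0 = f0 := by simpa using hf 0 le_rfl
  have hp0 : p 0 = p0 := by simpa using H.flux_eq 0 le_rfl
  have hint : IntegrableOn
      (fun t => t ^ (1 - 2 * σ) * (g t * h t) + l * (t ^ (1 - 2 * σ) * (c t * f t))) (Ioi 0) :=
    (integrableOn_weighted_mul Subset.rfl measurableSet_Ioi H.meas hhm H.deriv_sq hh2).add
      ((integrableOn_weighted_mul Subset.rfl measurableSet_Ioi hcm hfm H.sq hf2).const_mul l)
  have hid : ∀ z, 0 ≤ z → p z * f z = p0 * f0 +
      ∫ t in 0..z, (t ^ (1 - 2 * σ) * (g t * h t) + l * (t ^ (1 - 2 * σ) * (c t * f t))) := by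
    intro z hz
    have := integral_mul_primitive (F := p) (G := f) hz (hpi z hz) (hhi z hz)
      (fun x hx => by rw [hp0]; exact H.flux_eq x hx.1) (fun x hx => by rw [hf0]; exact hf x hx.1)
    rw [hp0, hf0] at this
    rw [← sub_eq_iff_eq_add', ← this]
    apply intervalIntegral.integral_congr_ae
    filter_upwards [H.flux_ae] with t ht ht'
    rw [uIoc_of_le hz] at ht'
    rw [← ht ht'.1]
    ring
  refine ⟨hint, hid, ?_⟩
  have hlim := intervalIntegral_tendsto_integral_Ioi 0 hint tendsto_id
  have hlim2 : Tendsto (fun z => p z * f z) atTop (𝓝 (p0 * f0 +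
      ∫ t in Ioi 0, (t ^ (1 - 2 * σ) * (g t * h t) + l * (t ^ (1 - 2 * σ) * (c t * f t))))) := by
    refine (hlim.const_add (p0 * f0)).congr' ?_
    filter_upwards [eventually_ge_atTop 0] with z hz using (hid z hz).symm
  -- Here p f = t^{1-2σ} g f is a product of two weighted square-integrable functions. A function
  -- that is integrable and has a limit at infinity has limit 0.
  have hpf : IntegrableOn (fun t => p t * f t) (Ioi 0) := by
    have h1 := integrableOn_weighted_mul Subset.rfl measurableSet_Ioi H.meas hfm H.deriv_sq hf2
    refine h1.congr ?_
    filter_upwards [ae_restrict_mem measurableSet_Ioi, ae_restrict_of_ae H.flux_ae] with t ht ht'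
    rw [← ht' ht]; ring
  have hzero := IntegrableAtFilter.eq_zero_of_tendsto
    ⟨Ioi 0, Ioi_mem_atTop 0, hpf⟩ (fun s hs => by
      obtain ⟨b, hb⟩ := mem_atTop_sets.1 hs
      refine top_le_iff.1 ((Real.volume_Ici (a := b)).symm.le.trans (measure_mono ?_))
      exact fun x hx => hb x hx) hlim2
  linarith

/-- The energy of a solution is minimal, and it controls the deviation from the boundary value. -/
theorem bound (H : IsModeSolution σ l c0 p0 c g p) (hσ0 : 0 < σ) (hσ1 : σ < 1) (hl : 0 ≤ l)
    (hhm : AEStronglyMeasurable h (volume.restrict (Ioi 0)))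
    (hh2 : IntegrableOn (fun t => t ^ (1 - 2 * σ) * h t ^ 2) (Ioi 0))
    (hf2 : IntegrableOn (fun t => t ^ (1 - 2 * σ) * f t ^ 2) (Ioi 0))
    (hf : ∀ z, 0 ≤ z → f z = c0 + ∫ t in 0..z, h t) {z : ℝ} (hz : 0 ≤ z) :
    c0 * (c0 - c z) ≤ z ^ (2 * σ) / (2 * σ) *
      ∫ t in Ioi 0, t ^ (1 - 2 * σ) * (h t ^ 2 + l * f t ^ 2) := by
  obtain ⟨hi1, hz1, he1⟩ := H.integral_pairing hσ0 hσ1 H.meas H.deriv_sq H.sq H.eq_primitive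
  obtain ⟨hi2, -, he2⟩ := H.integral_pairing hσ0 hσ1 hhm hh2 hf2 hf
  have hgi := intervalIntegrable_zero_of_weighted hσ0 H.meas H.deriv_sq hz
  have hcI : ∀ z, 0 ≤ z → ContinuousOn c (Icc 0 z) := continuousOn_Ici_of_primitive
    (fun z hz => intervalIntegrable_zero_of_weighted hσ0 H.meas H.deriv_sq hz) H.eq_primitive
  have hpi : ∀ z, 0 ≤ z →
      IntervalIntegrable (fun t => l * (t ^ (1 - 2 * σ) * c t)) volume 0 z := fun z hz =>
    intervalIntegrable_weight_mul hσ1 hz (hcI z hz) l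
  have hp0 : p 0 = p0 := by simpa using H.flux_eq 0 le_rfl
  have hnn : ∀ t ∈ Ioi (0:ℝ),
      0 ≤ t ^ (1 - 2 * σ) * (g t * g t) + l * (t ^ (1 - 2 * σ) * (c t * c t)) := by
    intro t ht
    have : 0 < t ^ (1 - 2 * σ) := Real.rpow_pos_of_pos ht _
    have := mul_self_nonneg (g t)
    have := mul_self_nonneg (c t)
    positivity
  -- p(z) c(z) is minus the energy carried by (z, ∞).
  have hpc : ∀ z, 0 ≤ z → p z * c z ≤ 0 := by
    intro z hz
    rw [hz1 z hz, he1, intervalIntegral.integral_of_le hz, neg_add_nonpos_iff]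
    exact setIntegral_mono_set hi1 ((ae_restrict_iff' measurableSet_Ioi).2 (ae_of_all _ hnn))
      (ae_of_all _ fun x hx => hx.1)
  -- The derivative of p² is 2 l t^{1-2σ} c p, which is nonpositive by the sign of p c.
  have hpabs : ∀ z, 0 ≤ z → |p z| ≤ |p0| := by
    intro z hz
    have := integral_mul_primitive (F := p) (G := p) hz (hpi z hz) (hpi z hz)
      (fun x hx => by rw [hp0]; exact H.flux_eq x hx.1)
      (fun x hx => by rw [hp0]; exact H.flux_eq x hx.1)
    have h2 : ∫ t in 0..z, (l * (t ^ (1 - 2 * σ) * c t) * p t +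
        p t * (l * (t ^ (1 - 2 * σ) * c t))) ≤ 0 := by
      rw [intervalIntegral.integral_of_le hz]
      refine setIntegral_nonpos measurableSet_Ioc fun t ht => ?_
      have h3 : 0 ≤ l * t ^ (1 - 2 * σ) := mul_nonneg hl (Real.rpow_nonneg ht.1.le _)
      have h4 := hpc t ht.1.le
      nlinarith
    rw [this, hp0] at h2
    exact sq_le_sq.1 (by nlinarith)
  -- By the pairing identity, e is the energy of c and also the mixed energy of c with f, as both
  -- start from c0.
  set e := -(p0 * c0) with he
  have hc00 : c 0 = c0 := by simpa using H.eq_primitive 0 le_rfl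
  have he0 : 0 ≤ e := by
    have := hpc 0 le_rfl
    rw [hp0, hc00] at this
    linarith
  have hemin : e ≤ ∫ t in Ioi 0, t ^ (1 - 2 * σ) * (h t ^ 2 + l * f t ^ 2) := by
    have hi3 : IntegrableOn (fun t => t ^ (1 - 2 * σ) * (h t ^ 2 + l * f t ^ 2)) (Ioi 0) := by
      refine (hh2.add (hf2.const_mul l)).congr (ae_of_all _ fun t => ?_)
      simp only [Pi.add_apply]; ring
    have h1 : e = ∫ t in Ioi 0,
        (t ^ (1 - 2 * σ) * (g t * h t) + l * (t ^ (1 - 2 * σ) * (c t * f t))) := by linarith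
    have h2 : e = ∫ t in Ioi 0,
        (t ^ (1 - 2 * σ) * (g t * g t) + l * (t ^ (1 - 2 * σ) * (c t * c t))) := by linarith
    -- Pointwise, 2 g h ≤ g² + h² and 2 c f ≤ c² + f², so the mixed energy is at most the mean of
    -- the two energies.
    have h3 : e ≤ (1 / 2) * e +
        (1 / 2) * ∫ t in Ioi 0, t ^ (1 - 2 * σ) * (h t ^ 2 + l * f t ^ 2) := by
      conv_lhs => rw [h1]
      conv_rhs => rw [h2]
      rw [← integral_const_mul, ← integral_const_mul, ← integral_add (hi1.const_mul _)
        (hi3.const_mul _)]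
      refine setIntegral_mono_on hi2 ((hi1.const_mul _).add (hi3.const_mul _)) measurableSet_Ioi
        fun t ht => ?_
      have hw : 0 ≤ t ^ (1 - 2 * σ) := Real.rpow_nonneg (le_of_lt ht) _
      have hlw : 0 ≤ l * t ^ (1 - 2 * σ) := mul_nonneg hl hw
      nlinarith [mul_nonneg hw (sq_nonneg (g t - h t)), mul_nonneg hlw (sq_nonneg (c t - f t))]
    linarith
  -- Since c' = t^{2σ-1} p and |p| ≤ |p0|, the integrand -c0 c' is at most e t^{2σ-1}.
  have hmain : c0 * (c0 - c z) ≤ z ^ (2 * σ) / (2 * σ) * e := by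
    have h1 : c0 * (c0 - c z) = ∫ t in 0..z, -c0 * g t := by
      rw [H.eq_primitive z hz, intervalIntegral.integral_const_mul]; ring
    have h2 : z ^ (2 * σ) / (2 * σ) * e = ∫ t in 0..z, e * t ^ (2 * σ - 1) := by
      rw [intervalIntegral.integral_const_mul, integral_rpow (by left; linarith)]
      rw [sub_add_cancel, Real.zero_rpow (by positivity)]
      ring
    rw [h1, h2, intervalIntegral.integral_of_le hz, intervalIntegral.integral_of_le hz]
    have hr := intervalIntegral.intervalIntegrable_rpow' (a := 0) (b := z) (r := 2 * σ - 1)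
      (by linarith)
    rw [intervalIntegrable_iff, uIoc_of_le hz] at hr hgi
    refine setIntegral_mono_on_ae (hgi.const_mul _) (hr.const_mul _) measurableSet_Ioc ?_
    filter_upwards [H.flux_ae] with t ht ht'
    have ht0 : 0 < t := ht'.1
    set a := t ^ (1 - 2 * σ) with ha
    have hapos : 0 < a := Real.rpow_pos_of_pos ht0 _
    have hb : t ^ (2 * σ - 1) = a⁻¹ := by
      rw [ha, ← Real.rpow_neg ht0.le]; congr 1; ring
    have hg' : g t = p t * a⁻¹ := by rw [← ht ht0]; field_simp
    rw [hb, hg', ← mul_assoc]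
    gcongr
    calc -c0 * p t ≤ |c0| * |p t| := by
          rw [← abs_mul, neg_mul]; exact neg_le_abs _
      _ ≤ |c0| * |p0| := mul_le_mul_of_nonneg_left (hpabs t ht0.le) (abs_nonneg _)
      _ = e := by rw [← abs_mul, he, mul_comm, abs_of_nonpos (by linarith)]
  refine hmain.trans ?_
  gcongr

end IsModeSolution

/-- A finite energy solution of `(t^{1-2σ} c')' = 0` is constant. -/
theorem primitive_eq_const_of_flux_const {σ c0 p0 : ℝ} (hσ0 : 0 < σ) {c g : ℝ → ℝ}
    (hg2 : IntegrableOn (fun t => t ^ (1 - 2 * σ) * g t ^ 2) (Ioi 0))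
    (hc : ∀ z, 0 ≤ z → c z = c0 + ∫ t in 0..z, g t)
    (hp : ∀ᵐ t, t ∈ Ioi (0:ℝ) → t ^ (1 - 2 * σ) * g t = p0) {z : ℝ} (hz : 0 ≤ z) :
    c z = c0 := by
  have key : ∀ t : ℝ, 0 < t → t ^ (1 - 2 * σ) * g t = p0 → g t = p0 * t ^ (2 * σ - 1) := by
    intro t ht h
    have hapos : 0 < t ^ (1 - 2 * σ) := Real.rpow_pos_of_pos ht _
    have hb : t ^ (2 * σ - 1) = (t ^ (1 - 2 * σ))⁻¹ := by
      rw [← Real.rpow_neg ht.le]; congr 1; ring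
    rw [hb, ← h]; field_simp
  -- With nonzero flux the energy density is p0² t^{2σ-1}, which is not integrable at infinity
  -- because 2σ - 1 > -1.
  have hp0 : p0 = 0 := by
    by_contra hne
    have h1 : IntegrableOn (fun t : ℝ => p0 ^ 2 * t ^ (2 * σ - 1)) (Ioi 1) := by
      refine (hg2.mono_set (Ioi_subset_Ioi zero_le_one)).congr ?_
      filter_upwards [ae_restrict_mem measurableSet_Ioi, ae_restrict_of_ae hp] with t ht ht'
      have ht0 : 0 < t := lt_trans one_pos ht
      have h2 := ht' ht0
      rw [sq (g t), ← mul_assoc, h2, key t ht0 h2]; ring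
    have h2 : IntegrableOn (fun t : ℝ => t ^ (2 * σ - 1)) (Ioi 1) := by
      have := h1.const_mul (p0 ^ 2)⁻¹
      refine this.congr (ae_of_all _ fun t => ?_)
      simp only; field_simp
    rw [integrableOn_Ioi_rpow_iff one_pos] at h2
    linarith
  rw [hc z hz, intervalIntegral.integral_zero_ae, add_zero]
  filter_upwards [hp] with t ht ht'
  rw [uIoc_of_le hz] at ht'
  rw [key t ht'.1 (ht ht'.1), hp0, zero_mul]

end WeightedODE

/-! ### The Gaussian density and integration by parts. -/

section GaussianDensity

variable {N : ℕ}

/-- The unnormalized Gaussian density is integrable. -/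
theorem integrable_exp_neg_half_sq (N : ℕ) :
    Integrable (fun x : Sp N => Real.exp (-‖x‖ ^ 2 / 2)) := by
  have h := GaussianFourier.integrable_cexp_neg_mul_sq_norm_add (V := Sp N) (b := (1 / 2 : ℂ))
    (by norm_num) 0 0
  have := h.re
  refine this.congr (ae_of_all _ fun x => ?_)
  have e : (-(1 / 2 : ℂ) * (‖x‖ : ℂ) ^ 2 + 0 * ((inner ℝ (0 : Sp N) x : ℝ) : ℂ)) =
      ((-‖x‖ ^ 2 / 2 : ℝ) : ℂ) := by push_cast; ring
  simp only [e, ← Complex.ofReal_exp]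
  exact Complex.ofReal_re _

/-- The standard Gaussian density. -/
noncomputable def rho (N : ℕ) (x : Sp N) : ℝ :=
  (∫ y : Sp N, Real.exp (-‖y‖ ^ 2 / 2))⁻¹ * Real.exp (-‖x‖ ^ 2 / 2)

theorem integral_exp_neg_half_sq_pos (N : ℕ) :
    0 < ∫ y : Sp N, Real.exp (-‖y‖ ^ 2 / 2) := by
  rw [integral_pos_iff_support_of_nonneg (fun x => (Real.exp_pos _).le)
    (integrable_exp_neg_half_sq N)]
  have : Function.support (fun y : Sp N => Real.exp (-‖y‖ ^ 2 / 2)) = univ := by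
    ext x; simp [Real.exp_ne_zero]
  rw [this]
  exact isOpen_univ.measure_pos volume univ_nonempty

theorem rho_pos (x : Sp N) : 0 < rho N x :=
  mul_pos (inv_pos.2 (integral_exp_neg_half_sq_pos N)) (Real.exp_pos _)

theorem contDiff_rho : ContDiff ℝ ∞ (rho N) := by
  unfold rho
  exact contDiff_const.mul (((contDiff_norm_sq ℝ).neg.div_const 2).exp)

theorem fderiv_rho (x w : Sp N) : fderiv ℝ (rho N) x w = -(inner ℝ x w * rho N x) := by
  have h : HasFDerivAt (fun x : Sp N => -‖x‖ ^ 2 / 2) ((-1 / 2 : ℝ) • (2 • (innerSL ℝ x : Sp N →L[ℝ] ℝ))) x := by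
    have := ((hasStrictFDerivAt_norm_sq x).hasFDerivAt.const_mul (-1 / 2 : ℝ))
    refine this.congr_of_eventuallyEq (Eventually.of_forall fun y => ?_)
    ring
  have h2 := (h.exp.const_mul (∫ y : Sp N, Real.exp (-‖y‖ ^ 2 / 2))⁻¹)
  have h3 : HasFDerivAt (rho N) _ x := h2
  rw [h3.fderiv]
  simp [rho]
  ring

theorem measurable_rho : Measurable (rho N) := contDiff_rho.continuous.measurable

theorem integrable_rho : Integrable (rho N) := (integrable_exp_neg_half_sq N).const_mul _

/-- Both measures are finite, so it suffices to compare characteristic functions. The normalizing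
constant stays an integral: it is the same complex Gaussian integral at t = 0 and cancels. -/
theorem gauss_eq_withDensity (N : ℕ) :
    gauss N = volume.withDensity (fun x => ENNReal.ofReal (rho N x)) := by
  have : IsFiniteMeasure (volume.withDensity (fun x => ENNReal.ofReal (rho N x))) :=
    isFiniteMeasure_withDensity_ofReal (integrable_rho (N := N)).2
  apply Measure.ext_of_charFun
  ext t
  rw [ProbabilityTheory.charFun_stdGaussian, charFun_apply,
    integral_withDensity_eq_integral_toReal_smul (by have := measurable_rho (N := N); fun_prop)
      (ae_of_all _ fun x => ENNReal.ofReal_lt_top)]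
  set Z := ∫ y : Sp N, Real.exp (-‖y‖ ^ 2 / 2) with hZ
  have hZ0 : 0 < Z := integral_exp_neg_half_sq_pos N
  have e1 : ∀ x : Sp N, (ENNReal.ofReal (rho N x)).toReal •
      Complex.exp (↑(inner ℝ x t) * Complex.I) = (Z : ℂ)⁻¹ *
      Complex.exp (-(1 / 2 : ℂ) * (‖x‖ : ℂ) ^ 2 + Complex.I * ((inner ℝ t x : ℝ) : ℂ)) := by
    intro x
    rw [ENNReal.toReal_ofReal (rho_pos x).le, rho, ← hZ, Complex.exp_add, real_inner_comm,
      Complex.real_smul]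
    push_cast
    rw [mul_comm Complex.I, ← mul_assoc]
    congr 3; ring
  simp_rw [e1]
  rw [integral_const_mul, GaussianFourier.integral_cexp_neg_mul_sq_norm_add (by norm_num)]
  have e2 : (Z : ℂ) = ((Real.pi : ℂ) / (1 / 2)) ^ ((Module.finrank ℝ (Sp N) : ℂ) / 2) := by
    have := GaussianFourier.integral_cexp_neg_mul_sq_norm_add (V := Sp N) (b := (1 / 2 : ℂ))
      (by norm_num) 0 0
    rw [show ∀ a : ℂ, (0:ℂ) ^ 2 * a = 0 by simp, zero_div, Complex.exp_zero, mul_one] at this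
    rw [← this, hZ, ← integral_complex_ofReal]
    congr 1; ext x; push_cast; congr 1; ring
  rw [← e2, ← mul_assoc, inv_mul_cancel₀ (by exact_mod_cast hZ0.ne'), one_mul, Complex.I_sq]
  congr 1; ring

theorem integral_gauss_eq (f : Sp N → ℝ) : ∫ x, f x ∂(gauss N) = ∫ x, f x * rho N x := by
  rw [gauss_eq_withDensity, integral_withDensity_eq_integral_toReal_smul
    (by have := measurable_rho (N := N); fun_prop) (ae_of_all _ fun x => ENNReal.ofReal_lt_top)]
  congr 1; ext x
  rw [ENNReal.toReal_ofReal (rho_pos x).le, smul_eq_mul, mul_comm]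

theorem integrable_gauss_iff (f : Sp N → ℝ) :
    Integrable f (gauss N) ↔ Integrable (fun x => f x * rho N x) := by
  rw [gauss_eq_withDensity, integrable_withDensity_iff_integrable_smul'
    (by have := measurable_rho (N := N); fun_prop) (ae_of_all _ fun x => ENNReal.ofReal_lt_top)]
  apply integrable_congr (ae_of_all _ fun x => ?_)
  rw [ENNReal.toReal_ofReal (rho_pos x).le, smul_eq_mul, mul_comm]

/-- Gaussian integration by parts. -/
theorem integral_fderiv_gauss {f : Sp N → ℝ} (w : Sp N) (hf : Differentiable ℝ f)
    (hfi : Integrable f (gauss N)) (hfd : Integrable (fun x => fderiv ℝ f x w) (gauss N))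
    (hfx : Integrable (fun x => inner ℝ x w * f x) (gauss N)) :
    ∫ x, fderiv ℝ f x w ∂(gauss N) = ∫ x, inner ℝ x w * f x ∂(gauss N) := by
  rw [integral_gauss_eq, integral_gauss_eq]
  rw [integrable_gauss_iff] at hfi hfd hfx
  have h := integral_mul_fderiv_eq_neg_fderiv_mul_of_integrable (μ := volume) (f := f)
    (g := rho N) (v := w) hfd
    (by
      refine hfx.neg.congr (ae_of_all _ fun x => ?_)
      simp only [fderiv_rho, Pi.neg_apply]; ring) hfi
    (fun x _ => hf x) (fun x _ => (contDiff_rho.differentiable (by simp)) x)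
  rw [eq_neg_iff_add_eq_zero, add_comm, ← eq_neg_iff_add_eq_zero] at h
  rw [h, ← integral_neg]
  congr 1; ext x
  rw [fderiv_rho]; ring

end GaussianDensity

/-! ### Polynomials: stable under differentiation and always Gaussian-integrable. -/

section PolynomialFunctions

variable {N : ℕ}

/-- Polynomial functions on `ℝ^N`. -/
def polyFn (N : ℕ) : Subalgebra ℝ (Sp N → ℝ) :=
  Algebra.adjoin ℝ (range fun (i : Fin N) (x : Sp N) => x i)

theorem coord_mem_polyFn (i : Fin N) : (fun x : Sp N => x i) ∈ polyFn N :=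
  Algebra.subset_adjoin ⟨i, rfl⟩

/-- The `i`-th partial derivative. -/
noncomputable def pd (i : Fin N) (f : Sp N → ℝ) (x : Sp N) : ℝ :=
  fderiv ℝ f x (EuclideanSpace.single i 1)

theorem contDiff_of_mem_polyFn {f : Sp N → ℝ} (hf : f ∈ polyFn N) : ContDiff ℝ ∞ f := by
  induction hf using Algebra.adjoin_induction with
  | mem f hf => obtain ⟨i, rfl⟩ := hf; exact (EuclideanSpace.proj (𝕜 := ℝ) i).contDiff
  | algebraMap r => exact contDiff_const
  | add f g _ _ hf hg => exact hf.add hg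
  | mul f g _ _ hf hg => exact hf.mul hg

theorem differentiable_of_mem_polyFn {f : Sp N → ℝ} (hf : f ∈ polyFn N) : Differentiable ℝ f :=
  (contDiff_of_mem_polyFn hf).differentiable (by simp)

theorem pd_mem_polyFn {f : Sp N → ℝ} (i : Fin N) (hf : f ∈ polyFn N) : pd i f ∈ polyFn N := by
  induction hf using Algebra.adjoin_induction with
  | mem f hf =>
    obtain ⟨j, rfl⟩ := hf
    have : pd i (fun x : Sp N => x j) =
        algebraMap ℝ (Sp N → ℝ) ((EuclideanSpace.single i (1:ℝ) : Sp N) j) := by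
      ext x
      exact congrArg (fun L : Sp N →L[ℝ] ℝ => L (EuclideanSpace.single i 1))
        (EuclideanSpace.proj (𝕜 := ℝ) j).fderiv
    rw [this]
    exact Subalgebra.algebraMap_mem _ _
  | algebraMap r =>
    have : pd i (algebraMap ℝ (Sp N → ℝ) r) = 0 := by
      ext x
      have : (algebraMap ℝ (Sp N → ℝ) r) = fun _ => r := rfl
      simp [pd, this]
    rw [this]; exact zero_mem _
  | add f g hf' hg' hf hg =>
    have : pd i (f + g) = pd i f + pd i g := by
      ext x
      simp [pd, fderiv_add (differentiable_of_mem_polyFn hf' x)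
        (differentiable_of_mem_polyFn hg' x)]
    rw [this]; exact add_mem hf hg
  | mul f g hf' hg' hf hg =>
    have : pd i (f * g) = f * pd i g + g * pd i f := by
      ext x
      simp [pd, fderiv_mul (differentiable_of_mem_polyFn hf' x)
        (differentiable_of_mem_polyFn hg' x)]
    rw [this]; exact add_mem (mul_mem hf' hg) (mul_mem hg' hf)

theorem pd_mul {f g : Sp N → ℝ} (i : Fin N) (hf : Differentiable ℝ f) (hg : Differentiable ℝ g)
    (x : Sp N) : pd i (fun x => f x * g x) x = f x * pd i g x + g x * pd i f x := by
  simp [pd, fderiv_fun_mul (hf x) (hg x)]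

theorem exists_growth_of_mem_polyFn {f : Sp N → ℝ} (hf : f ∈ polyFn N) :
    ∃ (C : ℝ) (n : ℕ), 0 ≤ C ∧ ∀ x, |f x| ≤ C * (1 + ‖x‖) ^ n := by
  induction hf using Algebra.adjoin_induction with
  | mem f hf =>
    obtain ⟨j, rfl⟩ := hf
    refine ⟨1, 1, zero_le_one, fun x => ?_⟩
    have := PiLp.norm_apply_le x j
    rw [Real.norm_eq_abs] at this
    simp only [one_mul, pow_one]
    linarith
  | algebraMap r => exact ⟨|r|, 0, abs_nonneg _, fun x => by simp⟩
  | add f g _ _ hf hg =>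
    obtain ⟨C, n, hC, hf⟩ := hf
    obtain ⟨D, m, hD, hg⟩ := hg
    refine ⟨C + D, n + m, by positivity, fun x => ?_⟩
    have h1 : 1 ≤ 1 + ‖x‖ := by linarith [norm_nonneg x]
    calc |f x + g x| ≤ |f x| + |g x| := abs_add_le _ _
      _ ≤ C * (1 + ‖x‖) ^ n + D * (1 + ‖x‖) ^ m := add_le_add (hf x) (hg x)
      _ ≤ C * (1 + ‖x‖) ^ (n + m) + D * (1 + ‖x‖) ^ (n + m) := by
        gcongr <;> first | exact h1 | omega
      _ = _ := by ring
  | mul f g _ _ hf hg =>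
    obtain ⟨C, n, hC, hf⟩ := hf
    obtain ⟨D, m, hD, hg⟩ := hg
    refine ⟨C * D, n + m, by positivity, fun x => ?_⟩
    calc |f x * g x| = |f x| * |g x| := abs_mul _ _
      _ ≤ (C * (1 + ‖x‖) ^ n) * (D * (1 + ‖x‖) ^ m) := by
        gcongr; exacts [hf x, hg x]
      _ = _ := by ring

theorem integrable_of_mem_polyFn {f : Sp N → ℝ} (hf : f ∈ polyFn N) :
    Integrable f (gauss N) := by
  obtain ⟨C, n, hC, h⟩ := exists_growth_of_mem_polyFn hf
  have h1 : Integrable (fun x : Sp N => (1 + ‖x‖) ^ n) (gauss N) := by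
    have hm : ∀ p : ℝ≥0∞, p ≠ ⊤ →
        MemLp ((fun _ : Sp N => (1:ℝ)) + fun x : Sp N => ‖id x‖) p (gauss N) := fun p hp =>
      (memLp_const (1:ℝ)).add (ProbabilityTheory.IsGaussian.memLp_id (gauss N) p hp).norm
    refine (hm n (ENNReal.natCast_ne_top _)).integrable_norm_pow'.congr (ae_of_all _ fun x => ?_)
    change ‖1 + ‖x‖‖ ^ n = _
    rw [Real.norm_of_nonneg (by positivity)]
  refine (h1.const_mul C).mono' (contDiff_of_mem_polyFn hf).continuous.aestronglyMeasurable
    (ae_of_all _ h)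

theorem memLp_two_of_mem_polyFn {f : Sp N → ℝ} (hf : f ∈ polyFn N) : MemLp f 2 (gauss N) := by
  rw [memLp_two_iff_integrable_sq (contDiff_of_mem_polyFn hf).continuous.aestronglyMeasurable]
  exact integrable_of_mem_polyFn (pow_mem hf 2)

/-- Symmetry of the `i`-th Ornstein-Uhlenbeck operator on polynomials. -/
theorem integral_pd_mul_pd {f g : Sp N → ℝ} (i : Fin N) (hf : f ∈ polyFn N) (hg : g ∈ polyFn N) :
    ∫ x, pd i f x * pd i g x ∂(gauss N) =
      ∫ x, f x * (x i * pd i g x - pd i (pd i g) x) ∂(gauss N) := by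
  have hgi := pd_mem_polyFn i hg
  have hm := mul_mem hf hgi
  have hin : ∀ x : Sp N, inner ℝ x (EuclideanSpace.single i (1:ℝ)) = x i := fun x => by
    simp [EuclideanSpace.inner_single_right]
  -- Gaussian integration by parts is applied to f ∂_i g.
  have h := integral_fderiv_gauss (EuclideanSpace.single i 1) (differentiable_of_mem_polyFn hm)
    (integrable_of_mem_polyFn hm) (integrable_of_mem_polyFn (pd_mem_polyFn i hm))
    (by simp only [hin]; exact integrable_of_mem_polyFn (mul_mem (coord_mem_polyFn i) hm))
  simp only [hin] at h
  have e : ∀ x, fderiv ℝ (f * pd i g) x (EuclideanSpace.single i 1) =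
      f x * pd i (pd i g) x + pd i g x * pd i f x :=
    pd_mul i (differentiable_of_mem_polyFn hf) (differentiable_of_mem_polyFn hgi)
  simp only [e] at h
  rw [integral_add (f := fun x => f x * pd i (pd i g) x) (g := fun x => pd i g x * pd i f x)
    (integrable_of_mem_polyFn (mul_mem hf (pd_mem_polyFn i hgi)))
    (integrable_of_mem_polyFn (mul_mem hgi (pd_mem_polyFn i hf)))] at h
  simp only [Pi.mul_apply] at h
  have e2 : ∫ x, f x * (x i * pd i g x - pd i (pd i g) x) ∂(gauss N) =
      (∫ x, x i * (f x * pd i g x) ∂(gauss N)) - ∫ x, f x * pd i (pd i g) x ∂(gauss N) := by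
    rw [← integral_sub (f := fun x => x i * (f x * pd i g x)) (g := fun x => f x * pd i (pd i g) x)
      (integrable_of_mem_polyFn (mul_mem (coord_mem_polyFn i) hm))
      (integrable_of_mem_polyFn (mul_mem hf (pd_mem_polyFn i hgi)))]
    congr 1; ext x; ring
  rw [e2, ← h, add_sub_cancel_left]
  congr 1; ext x; ring

end PolynomialFunctions

/-! ### Hermite products as orthogonal eigenfunctions. -/

section Hermite

variable {N : ℕ}

/-- Differentiate the recursion H_{n+1} = X H_n - H_n' and use the induction hypothesis twice.
Together with the recursion this yields the three-term relation `mul_he`. -/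
theorem _root_.Polynomial.derivative_hermite_succ (n : ℕ) :
    Polynomial.derivative (Polynomial.hermite (n + 1)) =
      ((n + 1 : ℕ) : Polynomial ℤ) * Polynomial.hermite n := by
  induction n with
  | zero => simp
  | succ n ih =>
    rw [Polynomial.hermite_succ (n + 1), Polynomial.derivative_sub, Polynomial.derivative_mul, ih,
      Polynomial.derivative_mul, Polynomial.derivative_X, Polynomial.derivative_natCast]
    rw [Polynomial.hermite_succ n]
    push_cast
    ring

/-- The one-dimensional Hermite polynomials as functions. -/
noncomputable def he (n : ℕ) (x : ℝ) : ℝ := Polynomial.aeval x (Polynomial.hermite n)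

theorem he_zero (x : ℝ) : he 0 x = 1 := by simp [he]

/-- At n = 0 the truncated n - 1 is harmless, since the factor n vanishes; the same convention is
used below for multi-indices. -/
theorem hasDerivAt_he (n : ℕ) (x : ℝ) : HasDerivAt (he n) (n * he (n - 1) x) x := by
  have h := (Polynomial.hermite n).hasDerivAt_aeval x
  change HasDerivAt (he n) _ x at h
  convert h using 1
  cases n with
  | zero => simp
  | succ n =>
    rw [Polynomial.derivative_hermite_succ]
    simp [he]

theorem mul_he (n : ℕ) (x : ℝ) : x * he n x = he (n + 1) x + n * he (n - 1) x := by
  cases n with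
  | zero => simp [he]
  | succ n =>
    have h := Polynomial.hermite_succ (n + 1)
    rw [Polynomial.derivative_hermite_succ] at h
    rw [he, he, h]
    simp [he]

/-- Products of Hermite polynomials. -/
noncomputable def hermiteProd (k : Fin N → ℕ) (x : Sp N) : ℝ := ∏ i, he (k i) (x i)

theorem hermiteProd_eq_mul (k : Fin N → ℕ) (i : Fin N) (m : ℕ) (x : Sp N) :
    hermiteProd (Function.update k i m) x =
      he m (x i) * ∏ j ∈ Finset.univ.erase i, he (k j) (x j) := by
  rw [hermiteProd, ← Finset.mul_prod_erase _ _ (Finset.mem_univ i), Function.update_self]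
  congr 1
  exact Finset.prod_congr rfl fun j hj => by rw [Function.update_of_ne (Finset.ne_of_mem_erase hj)]

theorem hermiteProd_mul_coord (k : Fin N → ℕ) (i : Fin N) (x : Sp N) :
    x i * hermiteProd k x = hermiteProd (Function.update k i (k i + 1)) x +
      k i * hermiteProd (Function.update k i (k i - 1)) x := by
  have h := hermiteProd_eq_mul k i (k i) x
  rw [Function.update_eq_self] at h
  rw [h, hermiteProd_eq_mul, hermiteProd_eq_mul, ← mul_assoc, mul_he]
  ring

theorem pd_hermiteProd (k : Fin N → ℕ) (i : Fin N) (x : Sp N) :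
    pd i (hermiteProd k) x = k i * hermiteProd (Function.update k i (k i - 1)) x := by
  have hd : ∀ j ∈ (Finset.univ : Finset (Fin N)), HasFDerivAt (fun x : Sp N => he (k j) (x j))
      ((k j * he (k j - 1) (x j)) • (EuclideanSpace.proj (𝕜 := ℝ) j : Sp N →L[ℝ] ℝ)) x :=
    fun j _ => HasDerivAt.comp_hasFDerivAt (h₂ := he (k j)) (f := fun x : Sp N => x j) x
      (hasDerivAt_he (k j) (x j)) (EuclideanSpace.proj (𝕜 := ℝ) j : Sp N →L[ℝ] ℝ).hasFDerivAt
  have h : HasFDerivAt (hermiteProd k) _ x := HasFDerivAt.finsetProd hd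
  rw [pd, h.fderiv, hermiteProd_eq_mul, _root_.sum_apply, Finset.sum_eq_single i]
  · simp; ring
  · intro j _ hj
    simp [hj]
  · simp

theorem hermiteProd_mem_polyFn (k : Fin N → ℕ) : hermiteProd k ∈ polyFn N := by
  have : hermiteProd k = ∏ i, fun x : Sp N => he (k i) (x i) := by
    ext x; simp [hermiteProd]
  rw [this]
  refine prod_mem fun i _ => ?_
  have : (fun x : Sp N => he (k i) (x i)) =
      Polynomial.aeval (fun x : Sp N => x i) (Polynomial.hermite (k i)) := by
    ext x
    change _ = Pi.evalRingHom (fun _ : Sp N => ℝ) x _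
    rw [he, Polynomial.aeval_def, Polynomial.hom_eval₂]
    congr 1
  rw [this, Polynomial.aeval_def, Polynomial.eval₂_eq_sum_range]
  refine sum_mem fun j _ => mul_mem ?_ (pow_mem (coord_mem_polyFn i) j)
  simp

theorem hermiteProd_zero : hermiteProd (0 : Fin N → ℕ) = 1 := by
  ext x; simp [hermiteProd, he_zero]

/-- `hermiteProd k` is an eigenfunction of each one-dimensional Ornstein-Uhlenbeck operator. -/
theorem coord_mul_pd_sub_pd_pd_hermiteProd (k : Fin N → ℕ) (i : Fin N) (x : Sp N) :
    x i * pd i (hermiteProd k) x - pd i (pd i (hermiteProd k)) x = k i * hermiteProd k x := by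
  set k' := Function.update k i (k i - 1) with hk'
  have h1 : pd i (hermiteProd k) = fun x => (k i : ℝ) * hermiteProd k' x :=
    funext fun x => pd_hermiteProd k i x
  have h2 : pd i (pd i (hermiteProd k)) x = k i * pd i (hermiteProd k') x := by
    rw [h1, pd, fderiv_const_mul (differentiable_of_mem_polyFn (hermiteProd_mem_polyFn k') x)]
    rfl
  rw [h2, pd_hermiteProd k i x, pd_hermiteProd k' i x, ← hk', ← mul_assoc, mul_comm (x i),
    mul_assoc, hermiteProd_mul_coord]
  -- Lowering and then raising index i gives back k only if k i > 0; otherwise the prefactor k i is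
  -- zero.
  rcases Nat.eq_zero_or_pos (k i) with h0 | h0
  · simp [h0]
  · have e1 : k' i + 1 = k i := by simp [k']; omega
    have e2 : Function.update k' i (k' i + 1) = k := by
      rw [e1, hk', Function.update_idem, Function.update_eq_self]
    rw [e2]
    ring

theorem integral_pd_hermiteProd {f : Sp N → ℝ} (hf : f ∈ polyFn N) (k : Fin N → ℕ) (i : Fin N) :
    ∫ x, pd i f x * pd i (hermiteProd k) x ∂(gauss N) =
      k i * ∫ x, f x * hermiteProd k x ∂(gauss N) := by
  rw [integral_pd_mul_pd i hf (hermiteProd_mem_polyFn k), ← integral_const_mul]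
  congr 1; ext x
  rw [coord_mul_pd_sub_pd_pd_hermiteProd]; ring

/-- In a coordinate where the indices differ, the two products are eigenfunctions of one symmetric
operator with distinct eigenvalues. -/
theorem integral_hermiteProd_mul_of_ne {k l : Fin N → ℕ} (h : k ≠ l) :
    ∫ x, hermiteProd k x * hermiteProd l x ∂(gauss N) = 0 := by
  obtain ⟨i, hi⟩ := Function.ne_iff.1 h
  have h1 := integral_pd_hermiteProd (hermiteProd_mem_polyFn k) l i
  have h2 := integral_pd_hermiteProd (hermiteProd_mem_polyFn l) k i
  simp only [mul_comm (hermiteProd l _), mul_comm (pd i (hermiteProd l) _)] at h2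
  rw [h2] at h1
  have : ((k i : ℝ) - l i) * ∫ x, hermiteProd k x * hermiteProd l x ∂(gauss N) = 0 := by linarith
  rcases mul_eq_zero.1 this with h | h
  · exact absurd (by exact_mod_cast sub_eq_zero.1 h) hi
  · exact h

/-- Induction on the total degree through the ladder relation ‖H_k‖² = k_i ‖H_{k - e_i}‖²; the
explicit factorials are not needed. -/
theorem integral_hermiteProd_sq_pos (k : Fin N → ℕ) :
    0 < ∫ x, hermiteProd k x * hermiteProd k x ∂(gauss N) := by
  induction hn : ∑ i, k i generalizing k with
  | zero =>
    have : k = 0 := by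
      ext i
      exact (Finset.sum_eq_zero_iff.1 hn) i (Finset.mem_univ i)
    simp [this, hermiteProd_zero]
  | succ n ih =>
    obtain ⟨i, hi⟩ : ∃ i, k i ≠ 0 := by
      by_contra! h
      simp [h] at hn
    have h1 := integral_pd_hermiteProd (hermiteProd_mem_polyFn k) k i
    set k' := Function.update k i (k i - 1) with hk'
    have h2 := ih k' (by
      have a1 := Finset.add_sum_erase Finset.univ k (Finset.mem_univ i)
      have a2 := Finset.add_sum_erase Finset.univ k' (Finset.mem_univ i)
      have a3 : ∑ j ∈ Finset.univ.erase i, k' j = ∑ j ∈ Finset.univ.erase i, k j :=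
        Finset.sum_congr rfl fun j hj => by
          rw [hk', Function.update_of_ne (Finset.ne_of_mem_erase hj)]
      have a4 : k' i = k i - 1 := by simp [k']
      omega)
    have h3 : ∀ x, pd i (hermiteProd k) x * pd i (hermiteProd k) x =
        (k i : ℝ) ^ 2 * (hermiteProd k' x * hermiteProd k' x) := fun x => by
      rw [pd_hermiteProd]; ring
    simp_rw [h3, integral_const_mul] at h1
    have hk : (0:ℝ) < k i := by exact_mod_cast Nat.pos_of_ne_zero hi
    have : (∫ x, hermiteProd k x * hermiteProd k x ∂(gauss N)) =
        k i * ∫ x, hermiteProd k' x * hermiteProd k' x ∂(gauss N) := by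
      apply mul_left_cancel₀ hk.ne'
      rw [← h1]; ring
    rw [this]; positivity

/-- The normalized Hermite products, an orthonormal basis of `L²_γ`. -/
noncomputable def hermiteOn (k : Fin N → ℕ) (x : Sp N) : ℝ :=
  (Real.sqrt (∫ x, hermiteProd k x * hermiteProd k x ∂(gauss N)))⁻¹ * hermiteProd k x

theorem hermiteOn_mem_polyFn (k : Fin N → ℕ) : hermiteOn k ∈ polyFn N :=
  (polyFn N).smul_mem (hermiteProd_mem_polyFn k) _

theorem pd_hermiteOn (k : Fin N → ℕ) (i : Fin N) (x : Sp N) :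
    pd i (hermiteOn k) x = (Real.sqrt (∫ x, hermiteProd k x * hermiteProd k x ∂(gauss N)))⁻¹ *
      pd i (hermiteProd k) x := by
  unfold hermiteOn
  rw [pd, fderiv_const_mul (differentiable_of_mem_polyFn (hermiteProd_mem_polyFn k) x)]
  rfl

/-- The eigenvalue of `-Δ_γ` at the Hermite product of index `k`. -/
noncomputable def eig (k : Fin N → ℕ) : ℝ := ∑ i, (k i : ℝ)

theorem eig_nonneg (k : Fin N → ℕ) : 0 ≤ eig k := Finset.sum_nonneg fun i _ => by positivity

theorem coord_mul_pd_sub_pd_pd_hermiteOn (k : Fin N → ℕ) (i : Fin N) (x : Sp N) :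
    x i * pd i (hermiteOn k) x - pd i (pd i (hermiteOn k)) x = k i * hermiteOn k x := by
  have h : pd i (hermiteOn k) = fun x => _ := funext fun x => pd_hermiteOn k i x
  have h2 : pd i (pd i (hermiteOn k)) x =
      (Real.sqrt (∫ x, hermiteProd k x * hermiteProd k x ∂(gauss N)))⁻¹ *
        pd i (pd i (hermiteProd k)) x := by
    rw [h, pd, fderiv_const_mul (differentiable_of_mem_polyFn
      (pd_mem_polyFn i (hermiteProd_mem_polyFn k)) x)]
    rfl
  rw [h2, pd_hermiteOn, hermiteOn]
  linear_combination (Real.sqrt (∫ x, hermiteProd k x * hermiteProd k x ∂(gauss N)))⁻¹ *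
    coord_mul_pd_sub_pd_pd_hermiteProd k i x

theorem integral_hermiteOn_mul (k l : Fin N → ℕ) :
    ∫ x, hermiteOn k x * hermiteOn l x ∂(gauss N) = if k = l then 1 else 0 := by
  have h : ∀ x, hermiteOn k x * hermiteOn l x =
      ((Real.sqrt (∫ x, hermiteProd k x * hermiteProd k x ∂(gauss N)))⁻¹ *
      (Real.sqrt (∫ x, hermiteProd l x * hermiteProd l x ∂(gauss N)))⁻¹) *
      (hermiteProd k x * hermiteProd l x) := fun x => by simp only [hermiteOn]; ring
  simp_rw [h, integral_const_mul]
  split_ifs with hkl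
  · subst hkl
    have := integral_hermiteProd_sq_pos k
    rw [← mul_inv, Real.mul_self_sqrt this.le, inv_mul_cancel₀ this.ne']
  · rw [integral_hermiteProd_mul_of_ne hkl, mul_zero]

/-- Gradients of the basis are again orthogonal; divided by the square root of the eigenvalue they
form the system used for Bessel's inequality on the x-gradient. -/
theorem integral_pd_hermiteOn_mul (k l : Fin N → ℕ) :
    ∫ x, ∑ i, pd i (hermiteOn k) x * pd i (hermiteOn l) x ∂(gauss N) =
      if k = l then eig k else 0 := by
  have hk := hermiteOn_mem_polyFn k
  have hl := hermiteOn_mem_polyFn l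
  rw [integral_finsetSum (f := fun i x => pd i (hermiteOn k) x * pd i (hermiteOn l) x) _
    fun i _ => integrable_of_mem_polyFn (mul_mem (pd_mem_polyFn i hk) (pd_mem_polyFn i hl))]
  simp_rw [fun i => integral_pd_mul_pd i hk hl]
  have h : ∀ i, ∫ x, hermiteOn k x * (x i * pd i (hermiteOn l) x -
      pd i (pd i (hermiteOn l)) x) ∂(gauss N) = l i * if k = l then 1 else 0 := fun i => by
    rw [← integral_hermiteOn_mul, ← integral_const_mul]
    congr 1; ext x
    rw [coord_mul_pd_sub_pd_pd_hermiteOn]; ring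
  simp_rw [h, ← Finset.sum_mul]
  split_ifs with hkl
  · rw [hkl, mul_one, eig]
  · rw [mul_zero]

end Hermite

/-! ### Completeness of the Hermite products and Parseval's identity. -/

section Completeness

variable {N : ℕ}

/-- Fernique's theorem gives some integrable exp(C‖x‖²), and completing the square bounds a‖x‖ by
C‖x‖² + a²/(4C). -/
theorem integrable_exp_mul_norm (a : ℝ) :
    Integrable (fun x : Sp N => Real.exp (a * ‖x‖)) (gauss N) := by
  obtain ⟨C, hC, h⟩ := ProbabilityTheory.IsGaussian.exists_integrable_exp_sq (gauss N)
  refine (h.const_mul (Real.exp (a ^ 2 / (4 * C)))).mono'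
    (by fun_prop) (ae_of_all _ fun x => ?_)
  rw [Real.norm_of_nonneg (Real.exp_pos _).le, ← Real.exp_add]
  apply Real.exp_le_exp.2
  have : a ^ 2 / (4 * C) + C * ‖x‖ ^ 2 - a * ‖x‖ = (2 * C * ‖x‖ - a) ^ 2 / (4 * C) := by
    field_simp; ring
  have h2 : 0 ≤ (2 * C * ‖x‖ - a) ^ 2 / (4 * C) := by positivity
  linarith

theorem memLp_exp_mul_norm (a : ℝ) :
    MemLp (fun x : Sp N => Real.exp (a * ‖x‖)) 2 (gauss N) := by
  rw [memLp_two_iff_integrable_sq (by fun_prop)]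
  refine (integrable_exp_mul_norm (2 * a)).congr (ae_of_all _ fun x => ?_)
  simp only [sq, ← Real.exp_add]
  congr 1; ring

/-- By the three-term relation the span is stable under multiplication by coordinates. These powers
are the terms of the series of the characters exp(i⟨x, t⟩). -/
theorem inner_pow_mem_span_hermiteProd (t : Sp N) (n : ℕ) :
    (fun x : Sp N => inner ℝ x t ^ n) ∈ Submodule.span ℝ (range (hermiteProd (N := N))) := by
  have hmul : ∀ (i : Fin N) (q : Sp N → ℝ), q ∈ Submodule.span ℝ (range (hermiteProd (N := N))) →
      (fun x => x i * q x) ∈ Submodule.span ℝ (range (hermiteProd (N := N))) := by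
    intro i q hq
    induction hq using Submodule.span_induction with
    | mem q hq =>
      obtain ⟨k, rfl⟩ := hq
      have : (fun x => x i * hermiteProd k x) = hermiteProd (Function.update k i (k i + 1)) +
          (k i : ℝ) • hermiteProd (Function.update k i (k i - 1)) :=
        funext fun x => hermiteProd_mul_coord k i x
      rw [this]
      exact add_mem (Submodule.subset_span ⟨_, rfl⟩)
        (Submodule.smul_mem _ _ (Submodule.subset_span ⟨_, rfl⟩))
    | zero =>
      simp only [Pi.zero_apply, mul_zero]
      exact zero_mem _
    | add f g _ _ hf hg =>
      have : (fun x : Sp N => x i * (f + g) x) = (fun x => x i * f x) + fun x => x i * g x := by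
        ext x; simp [mul_add]
      rw [this]; exact add_mem hf hg
    | smul a f _ hf =>
      have : (fun x : Sp N => x i * (a • f) x) = a • fun x => x i * f x := by
        ext x; simp; ring
      rw [this]; exact Submodule.smul_mem _ _ hf
  induction n with
  | zero =>
    refine Submodule.subset_span ⟨0, ?_⟩
    rw [hermiteProd_zero]; ext x; simp
  | succ n ih =>
    have : (fun x : Sp N => inner ℝ x t ^ (n + 1)) =
        ∑ i, t i • fun x : Sp N => x i * inner ℝ x t ^ n := by
      ext x
      rw [pow_succ', Finset.sum_apply]
      set a := inner ℝ x t ^ n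
      rw [PiLp.inner_apply, Finset.sum_mul]
      refine Finset.sum_congr rfl fun i _ => ?_
      simp only [Pi.smul_apply, smul_eq_mul, RCLike.inner_apply, conj_trivial]; ring
    rw [this]
    exact sum_mem fun i _ => Submodule.smul_mem _ _ (hmul i _ ih)

/-- The Hermite products are complete in `L²_γ`. -/
theorem ae_eq_zero_of_integral_hermiteProd_eq_zero {f : Sp N → ℝ} (hf : MemLp f 2 (gauss N))
    (h : ∀ k, ∫ x, hermiteProd k x * f x ∂(gauss N) = 0) : f =ᵐ[gauss N] 0 := by
  have hpow : ∀ (t : Sp N) (n : ℕ), ∫ x, inner ℝ x t ^ n * f x ∂(gauss N) = 0 := by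
    intro t n
    have hs : ∀ q ∈ Submodule.span ℝ (range (hermiteProd (N := N))),
        MemLp q 2 (gauss N) ∧ ∫ x, q x * f x ∂(gauss N) = 0 := by
      intro q hq
      induction hq using Submodule.span_induction with
      | mem q hq =>
        obtain ⟨k, rfl⟩ := hq
        exact ⟨memLp_two_of_mem_polyFn (hermiteProd_mem_polyFn k), h k⟩
      | zero => exact ⟨MemLp.zero', by simp⟩
      | add p q _ _ hp hq =>
        refine ⟨hp.1.add hq.1, ?_⟩
        simp only [Pi.add_apply, add_mul]
        rw [integral_add (f := fun x => p x * f x) (g := fun x => q x * f x) (hp.1.integrable_mul hf) (hq.1.integrable_mul hf), hp.2, hq.2, add_zero]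
      | smul a q _ hq =>
        refine ⟨hq.1.const_smul a, ?_⟩
        simp only [Pi.smul_apply, smul_eq_mul, mul_assoc]
        rw [integral_const_mul, hq.2, mul_zero]
    exact (hs _ (inner_pow_mem_span_hermiteProd t n)).2
  have hfi : Integrable f (gauss N) := hf.integrable one_le_two
  -- The exponential series may be integrated termwise, since its partial sums are dominated by |f|
  -- exp(‖t‖‖x‖), integrable by Fernique; every term vanishes.
  have hexp : ∀ t : Sp N,
      ∫ x, (f x : ℂ) * Complex.exp ((inner ℝ x t : ℝ) * Complex.I) ∂(gauss N) = 0 := by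
    intro t
    have hbound : ∀ x : Sp N, HasSum (fun n : ℕ => |f x| * ((‖t‖ * ‖x‖) ^ n / n.factorial))
        (|f x| * Real.exp (‖t‖ * ‖x‖)) := fun x => by
      rw [Real.exp_eq_exp_ℝ]
      exact (NormedSpace.expSeries_div_hasSum_exp (𝔸 := ℝ) (‖t‖ * ‖x‖)).mul_left _
    have H := hasSum_integral_of_dominated_convergence (μ := gauss N)
      (F := fun (n : ℕ) x => (f x : ℂ) * (((inner ℝ x t : ℝ) * Complex.I) ^ n / n.factorial))
      (f := fun x => (f x : ℂ) * Complex.exp ((inner ℝ x t : ℝ) * Complex.I))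
      (fun n x => |f x| * ((‖t‖ * ‖x‖) ^ n / n.factorial))
      (fun n => (Complex.continuous_ofReal.comp_aestronglyMeasurable hf.1).mul
        (by fun_prop))
      (fun n => ae_of_all _ fun x => by
        rw [norm_mul, norm_div, norm_pow, norm_mul, Complex.norm_I, mul_one, Complex.norm_real,
          Complex.norm_real, Complex.norm_natCast, Real.norm_eq_abs]
        gcongr
        rw [mul_comm]
        exact norm_inner_le_norm x t)
      (ae_of_all _ fun x => (hbound x).summable)
      (by
        simp_rw [fun x => (hbound x).tsum_eq]
        exact hf.abs.integrable_mul (memLp_exp_mul_norm _))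
      (ae_of_all _ fun x => by
        rw [Complex.exp_eq_exp_ℂ]
        exact (NormedSpace.expSeries_div_hasSum_exp (𝔸 := ℂ) _).mul_left _)
    refine H.unique ?_
    have hz : (fun n : ℕ => ∫ x, (f x : ℂ) * (((inner ℝ x t : ℝ) * Complex.I) ^ n / n.factorial)
        ∂(gauss N)) = fun _ => 0 := by
      ext n
      have e : ∀ x : Sp N, (f x : ℂ) * (((inner ℝ x t : ℝ) * Complex.I) ^ n / n.factorial) =
          (Complex.I ^ n / n.factorial) * ((inner ℝ x t ^ n * f x : ℝ) : ℂ) := fun x => by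
        push_cast; rw [mul_pow]; ring
      simp_rw [e]
      rw [integral_const_mul, integral_complex_ofReal, hpow t n]
      simp
    rw [hz]
    exact hasSum_zero
  have hmeas : AEMeasurable f (gauss N) := hfi.aemeasurable
  have hmeas' : AEMeasurable (fun x => -f x) (gauss N) := hmeas.neg
  have hfin1 : IsFiniteMeasure ((gauss N).withDensity fun x => ENNReal.ofReal (f x)) :=
    isFiniteMeasure_withDensity_ofReal hfi.2
  have hfin2 : IsFiniteMeasure ((gauss N).withDensity fun x => ENNReal.ofReal (-f x)) :=
    isFiniteMeasure_withDensity_ofReal hfi.neg.2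
  -- The positive and negative parts of f define finite measures with equal characteristic
  -- functions, hence equal measures.
  have hchar : charFun ((gauss N).withDensity fun x => ENNReal.ofReal (f x)) =
      charFun ((gauss N).withDensity fun x => ENNReal.ofReal (-f x)) := by
    ext t
    rw [charFun_apply, charFun_apply,
      integral_withDensity_eq_integral_toReal_smul₀ hmeas.ennreal_ofReal
        (ae_of_all _ fun x => ENNReal.ofReal_lt_top),
      integral_withDensity_eq_integral_toReal_smul₀ hmeas'.ennreal_ofReal
        (ae_of_all _ fun x => ENNReal.ofReal_lt_top), ← sub_eq_zero]
    have hb : ∀ g : Sp N → ℝ, Integrable g (gauss N) → Integrable (fun x =>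
        (ENNReal.ofReal (g x)).toReal • Complex.exp ((inner ℝ x t : ℝ) * Complex.I)) (gauss N) := by
      intro g hg
      refine hg.norm.mono' (((hg.aemeasurable.ennreal_ofReal.ennreal_toReal).aestronglyMeasurable).smul
        (by fun_prop)) (ae_of_all _ fun x => ?_)
      rw [norm_smul, Complex.norm_exp_ofReal_mul_I, mul_one, ENNReal.toReal_ofReal',
        Real.norm_eq_abs, Real.norm_eq_abs, abs_of_nonneg (le_max_right _ _)]
      exact max_le (le_abs_self _) (abs_nonneg _)
    rw [← integral_sub (hb f hfi) (hb (fun x => -f x) hfi.neg), ← hexp t]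
    congr 1; ext x
    rw [← sub_smul, ENNReal.toReal_ofReal', ENNReal.toReal_ofReal', Complex.real_smul]
    congr 2
    rcases le_total 0 (f x) with hx | hx
    · rw [max_eq_left hx, max_eq_right (by linarith)]; ring
    · rw [max_eq_right hx, max_eq_left (by linarith)]; ring
  have heq := Measure.ext_of_charFun hchar
  rw [withDensity_eq_iff hmeas.ennreal_ofReal hmeas'.ennreal_ofReal
    (by have := hfi.lintegral_lt_top; exact this.ne)] at heq
  filter_upwards [heq] with x hx
  rcases le_total 0 (f x) with h0 | h0
  · rw [ENNReal.ofReal_of_nonpos (p := -f x) (by linarith), ENNReal.ofReal_eq_zero] at hx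
    exact le_antisymm hx h0
  · rw [ENNReal.ofReal_of_nonpos h0, eq_comm, ENNReal.ofReal_eq_zero] at hx
    exact le_antisymm h0 (neg_nonpos.1 hx)

/-- Parseval's identity for the normalized Hermite products. -/
theorem hasSum_integral_hermiteOn {f g : Sp N → ℝ} (hf : MemLp f 2 (gauss N))
    (hg : MemLp g 2 (gauss N)) :
    HasSum (fun k : Fin N → ℕ => (∫ x, f x * hermiteOn k x ∂(gauss N)) *
      ∫ x, g x * hermiteOn k x ∂(gauss N)) (∫ x, f x * g x ∂(gauss N)) := by
  have hin : ∀ {u w : Sp N → ℝ} (hu : MemLp u 2 (gauss N)) (hw : MemLp w 2 (gauss N)),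
      inner ℝ (hu.toLp u) (hw.toLp w) = ∫ x, u x * w x ∂(gauss N) := by
    intro u w hu hw
    rw [L2.inner_def]
    apply integral_congr_ae
    filter_upwards [hu.coeFn_toLp, hw.coeFn_toLp] with x h1 h2
    rw [h1, h2]
    simp [mul_comm]
  let hm := fun k : Fin N → ℕ => memLp_two_of_mem_polyFn (hermiteOn_mem_polyFn k)
  let e : (Fin N → ℕ) → Lp ℝ 2 (gauss N) := fun k => (hm k).toLp _
  have ho : Orthonormal ℝ e := by
    rw [orthonormal_iff_ite]
    intro k l
    rw [hin (hm k) (hm l), integral_hermiteOn_mul]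
  have hbot : (Submodule.span ℝ (range e))ᗮ = ⊥ := by
    rw [Submodule.eq_bot_iff]
    intro u hu
    have hu2 := Lp.memLp u
    have hz := ae_eq_zero_of_integral_hermiteProd_eq_zero hu2 fun k => by
      have h1 : inner ℝ (e k) u = 0 := hu _ (Submodule.subset_span ⟨k, rfl⟩)
      rw [← Lp.toLp_coeFn u hu2, hin (hm k) hu2] at h1
      simp only [hermiteOn, mul_assoc] at h1
      rw [integral_const_mul] at h1
      refine (mul_eq_zero.1 h1).resolve_left ?_
      exact inv_ne_zero (Real.sqrt_ne_zero'.2 (integral_hermiteProd_sq_pos k))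
    exact (Lp.eq_zero_iff_ae_eq_zero).2 hz
  have H := (HilbertBasis.mkOfOrthogonalEqBot ho hbot).hasSum_inner_mul_inner
    (hf.toLp f) (hg.toLp g)
  rw [hin hf hg] at H
  refine H.congr_fun fun k => ?_
  have hb : HilbertBasis.mkOfOrthogonalEqBot ho hbot k = (hm k).toLp _ := by
    rw [HilbertBasis.coe_mkOfOrthogonalEqBot]
  rw [hb, hin hf (hm k), hin (hm k) hg]
  simp only [mul_comm]

end Completeness

/-! ### Hilbert-space inequalities in terms of integrals. -/

section SquareIntegrable

variable {N : ℕ}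

/-- Cauchy-Schwarz for real square-integrable functions. -/
theorem sq_integral_mul_le {Ω : Type*} [MeasurableSpace Ω] {μ : Measure Ω} {f g : Ω → ℝ}
    (hf : MemLp f 2 μ) (hg : MemLp g 2 μ) :
    (∫ x, f x * g x ∂μ) ^ 2 ≤ (∫ x, f x ^ 2 ∂μ) * ∫ x, g x ^ 2 ∂μ := by
  have hin : ∀ {u w : Ω → ℝ} (hu : MemLp u 2 μ) (hw : MemLp w 2 μ),
      inner ℝ (hu.toLp u) (hw.toLp w) = ∫ x, u x * w x ∂μ := by
    intro u w hu hw
    rw [L2.inner_def]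
    apply integral_congr_ae
    filter_upwards [hu.coeFn_toLp, hw.coeFn_toLp] with x h1 h2
    rw [h1, h2]
    simp [mul_comm]
  have h := real_inner_mul_inner_self_le (hf.toLp f) (hg.toLp g)
  rw [hin hf hg, hin hf hf, hin hg hg] at h
  simpa only [sq] using h

/-- Bessel's inequality for vector-valued functions. -/
theorem sum_sq_integral_inner_le {Ω E ι : Type*} [MeasurableSpace Ω] {μ : Measure Ω}
    [NormedAddCommGroup E] [InnerProductSpace ℝ E] [DecidableEq ι] {e : ι → Ω → E} {g : Ω → E}
    (he : ∀ i, MemLp (e i) 2 μ) (hg : MemLp g 2 μ)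
    (ho : ∀ i j, ∫ x, inner ℝ (e i x) (e j x) ∂μ = if i = j then 1 else 0) (s : Finset ι) :
    ∑ i ∈ s, (∫ x, inner ℝ (e i x) (g x) ∂μ) ^ 2 ≤ ∫ x, ‖g x‖ ^ 2 ∂μ := by
  have hin : ∀ {u w : Ω → E} (hu : MemLp u 2 μ) (hw : MemLp w 2 μ),
      inner ℝ (hu.toLp u) (hw.toLp w) = ∫ x, inner ℝ (u x) (w x) ∂μ := by
    intro u w hu hw
    rw [L2.inner_def]
    apply integral_congr_ae
    filter_upwards [hu.coeFn_toLp, hw.coeFn_toLp] with x h1 h2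
    rw [h1, h2]
  have horth : Orthonormal ℝ fun i => (he i).toLp (e i) := by
    rw [orthonormal_iff_ite]
    intro i j
    rw [hin, ho]
  have h := horth.sum_inner_products_le (hg.toLp g) (s := s)
  simp only [hin (he _) hg, Real.norm_eq_abs, sq_abs] at h
  refine h.trans (le_of_eq ?_)
  rw [← real_inner_self_eq_norm_sq, hin hg hg]
  simp only [real_inner_self_eq_norm_sq]

/-- Square integrability is asked only eventually along l, because near the trace it is known only
for almost every height. -/
theorem tendsto_integral_mul_of_tendsto_eLpNorm {Ω ι : Type*} [MeasurableSpace Ω] {μ : Measure Ω}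
    {l : Filter ι} {F : ι → Ω → ℝ} {f ψ : Ω → ℝ} (hψ : MemLp ψ 2 μ) (hf : MemLp f 2 μ)
    (hF : ∀ᶠ i in l, MemLp (F i) 2 μ)
    (h : Tendsto (fun i => eLpNorm (fun x => F i x - f x) 2 μ) l (𝓝 0)) :
    Tendsto (fun i => ∫ x, F i x * ψ x ∂μ) l (𝓝 (∫ x, f x * ψ x ∂μ)) := by
  rw [tendsto_iff_edist_tendsto_0]
  have h2 : Tendsto (fun i => eLpNorm (fun x => F i x - f x) 2 μ * eLpNorm ψ 2 μ) l (𝓝 0) := by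
    have := ENNReal.Tendsto.mul_const (b := eLpNorm ψ 2 μ) h (Or.inr hψ.2.ne)
    rwa [zero_mul] at this
  refine tendsto_of_tendsto_of_tendsto_of_le_of_le' tendsto_const_nhds h2
    (Eventually.of_forall fun _ => zero_le) ?_
  filter_upwards [hF] with i hi
  have hd : MemLp (fun x => F i x - f x) 2 μ := hi.sub hf
  rw [edist_eq_enorm_sub, ← integral_sub (f := fun x => F i x * ψ x) (g := fun x => f x * ψ x) (hi.integrable_mul hψ) (hf.integrable_mul hψ)]
  refine (enorm_integral_le_lintegral_enorm _).trans ?_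
  have := eLpNorm_smul_le_mul_eLpNorm (r := 1) hψ.1 hd.1 (p := 2) (q := 2)
  rw [eLpNorm_one_eq_lintegral_enorm] at this
  refine le_trans (le_of_eq ?_) this
  congr 1; ext x
  simp [sub_mul]

end SquareIntegrable

/-! ### Cutoffs in x. -/

section Cutoff

variable {N : ℕ}

/-- A fixed smooth bump function on `ℝ^N`. -/
noncomputable def bump (N : ℕ) : ContDiffBump (0 : Sp N) := ⟨1, 2, one_pos, one_lt_two⟩

/-- Smooth cutoff functions exhausting `ℝ^N`. -/
noncomputable def cutoff (N n : ℕ) (x : Sp N) : ℝ := bump N (((n : ℝ) + 1)⁻¹ • x)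

theorem contDiff_cutoff (n : ℕ) : ContDiff ℝ ∞ (cutoff N n) :=
  (bump N).contDiff.comp (contDiff_const_smul _)

theorem hasCompactSupport_cutoff (n : ℕ) : HasCompactSupport (cutoff N n) :=
  (bump N).hasCompactSupport.comp_smul (by positivity)

theorem abs_cutoff_le (n : ℕ) (x : Sp N) : |cutoff N n x| ≤ 1 := by
  rw [cutoff, abs_of_nonneg (bump N).nonneg]
  exact (bump N).le_one

theorem eventually_norm_lt (x : Sp N) : ∀ᶠ n : ℕ in atTop, ‖((n : ℝ) + 1)⁻¹ • x‖ < 1 := by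
  have h : Tendsto (fun n : ℕ => ‖((n : ℝ) + 1)⁻¹ • x‖) atTop (𝓝 0) := by
    have h1 : Tendsto (fun n : ℕ => ((n : ℝ) + 1)⁻¹) atTop (𝓝 0) := by
      simpa using tendsto_one_div_add_atTop_nhds_zero_nat (𝕜 := ℝ)
    simpa using (h1.smul_const x).norm
  exact h.eventually_lt_const one_pos

/-- Equality near x, not just at x, gives the limits of the values and of the derivatives together.
-/
theorem eventually_cutoff_eventuallyEq (x : Sp N) :
    ∀ᶠ n in atTop, cutoff N n =ᶠ[𝓝 x] fun _ => 1 := by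
  filter_upwards [eventually_norm_lt x] with n hn
  have hc : ContinuousAt (fun y : Sp N => ‖((n : ℝ) + 1)⁻¹ • y‖) x := by fun_prop
  filter_upwards [hc.eventually_lt_const hn] with y hy
  exact (bump N).one_of_mem_closedBall (by simpa [bump] using hy.le)

theorem tendsto_cutoff (x : Sp N) : Tendsto (fun n => cutoff N n x) atTop (𝓝 1) := by
  refine tendsto_const_nhds.congr' ?_
  filter_upwards [eventually_cutoff_eventuallyEq x] with n hn using hn.eq_of_nhds.symm

theorem tendsto_pd_cutoff (i : Fin N) (x : Sp N) :
    Tendsto (fun n => pd i (cutoff N n) x) atTop (𝓝 0) := by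
  refine tendsto_const_nhds.congr' ?_
  filter_upwards [eventually_cutoff_eventuallyEq x] with n hn
  rw [pd, hn.fderiv_eq]
  simp

/-- Dilation by n + 1 ≥ 1 can only shrink the derivative of the fixed bump, so its bound serves
every n. -/
theorem exists_bound_pd_cutoff (i : Fin N) :
    ∃ C, 0 ≤ C ∧ ∀ n x, |pd i (cutoff N n) x| ≤ C := by
  have hB : ContDiff ℝ ∞ (bump N) := (bump N).contDiff
  have hcont : Continuous (fderiv ℝ (bump N)) := hB.continuous_fderiv (by simp)
  obtain ⟨C, hC⟩ := (((bump N).hasCompactSupport).fderiv (𝕜 := ℝ)).exists_bound_of_continuous hcont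
  have hC0 : 0 ≤ C := (norm_nonneg _).trans (hC 0)
  refine ⟨C, hC0, fun n x => ?_⟩
  have h : HasFDerivAt (cutoff N n) _ x :=
    ((hB.differentiable (by simp)) (((n : ℝ) + 1)⁻¹ • x)).hasFDerivAt.comp x
      ((hasFDerivAt_id x).const_smul ((n : ℝ) + 1)⁻¹)
  rw [pd, h.fderiv]
  simp only [ContinuousLinearMap.comp_apply, _root_.smul_apply,
    ContinuousLinearMap.id_apply, map_smul, smul_eq_mul, abs_mul]
  have h1 : |((n : ℝ) + 1)⁻¹| ≤ 1 := by
    rw [abs_of_nonneg (by positivity)]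
    exact inv_le_one_of_one_le₀ (by linarith [(Nat.cast_nonneg n : (0:ℝ) ≤ n)])
  have h2 : |fderiv ℝ (bump N) (((n : ℝ) + 1)⁻¹ • x) (EuclideanSpace.single i 1)| ≤ C := by
    have := (fderiv ℝ (bump N) (((n : ℝ) + 1)⁻¹ • x)).le_opNorm (EuclideanSpace.single i (1:ℝ))
    have h1 : ‖(EuclideanSpace.single i (1:ℝ) : Sp N)‖ = 1 := by simp
    rw [h1, mul_one, Real.norm_eq_abs] at this
    exact this.trans (hC _)
  calc _ ≤ 1 * C := mul_le_mul h1 h2 (abs_nonneg _) zero_le_one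
    _ = C := one_mul C

end Cutoff

/-! ### Measures on the half-space and pairings on slices. -/

section HalfSpace

variable {N : ℕ}

/-- Lebesgue measure on the upper half-space as a product. -/
theorem restrict_upperHalf (N : ℕ) :
    (volume : Measure (Sp N × ℝ)).restrict (upperHalf N) =
      (volume : Measure (Sp N)).prod (volume.restrict (Ioi 0)) := by
  have h : upperHalf N = univ ×ˢ Ioi (0:ℝ) := by ext p; simp [upperHalf]
  rw [h, Measure.volume_eq_prod, ← Measure.prod_restrict, Measure.restrict_univ]

theorem gaussHalf_eq_withDensity (N : ℕ) :
    gaussHalf N = ((volume : Measure (Sp N × ℝ)).restrict (upperHalf N)).withDensity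
      (fun p => ENNReal.ofReal (rho N p.1)) := by
  rw [gaussHalf, gauss_eq_withDensity, prod_withDensity_left
    (by have := measurable_rho (N := N); fun_prop), restrict_upperHalf]

theorem gaussHalf_absolutelyContinuous (N : ℕ) :
    gaussHalf N ≪ (volume : Measure (Sp N × ℝ)).restrict (upperHalf N) := by
  rw [gaussHalf_eq_withDensity]
  exact withDensity_absolutelyContinuous _ _

theorem measurable_rho_fst : Measurable fun p : Sp N × ℝ => ENNReal.ofReal (rho N p.1) := by
  have := measurable_rho (N := N); fun_prop

theorem setIntegral_upperHalf_mul_rho (F : Sp N × ℝ → ℝ) :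
    ∫ p in upperHalf N, F p * rho N p.1 = ∫ p, F p ∂(gaussHalf N) := by
  rw [gaussHalf_eq_withDensity, integral_withDensity_eq_integral_toReal_smul measurable_rho_fst
    (ae_of_all _ fun x => ENNReal.ofReal_lt_top)]
  congr 1; ext p
  rw [ENNReal.toReal_ofReal (rho_pos p.1).le, smul_eq_mul, mul_comm]

theorem integrable_gaussHalf_iff (F : Sp N × ℝ → ℝ) :
    Integrable F (gaussHalf N) ↔ IntegrableOn (fun p => F p * rho N p.1) (upperHalf N) := by
  rw [gaussHalf_eq_withDensity, integrable_withDensity_iff_integrable_smul' measurable_rho_fst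
    (ae_of_all _ fun x => ENNReal.ofReal_lt_top)]
  apply integrable_congr (ae_of_all _ fun p => ?_)
  rw [ENNReal.toReal_ofReal (rho_pos p.1).le, smul_eq_mul, mul_comm]

theorem integral_gaussHalf {F : Sp N × ℝ → ℝ} (hF : Integrable F (gaussHalf N)) :
    ∫ p, F p ∂(gaussHalf N) = ∫ z in Ioi 0, ∫ x, F (x, z) ∂(gauss N) :=
  integral_prod_symm _ hF

theorem aestronglyMeasurable_of_forall_compact {E : Type*} [NormedAddCommGroup E]
    {k : Sp N × ℝ → E} (hk : ∀ K : Set (Sp N × ℝ), IsCompact K → K ⊆ upperHalf N →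
      MemLp k 2 (volume.restrict K)) :
    AEStronglyMeasurable k (volume.restrict (upperHalf N)) := by
  -- Measurability passes through a countable compact exhaustion.
  have hU : upperHalf N = ⋃ n : ℕ, Metric.closedBall (0 : Sp N) n ×ˢ Icc ((n : ℝ) + 1)⁻¹ n := by
    ext p
    simp only [upperHalf, mem_ofPred_eq, mem_iUnion, mem_prod, Metric.mem_closedBall, dist_zero_right,
      mem_Icc]
    constructor
    · intro hp
      obtain ⟨n, hn⟩ := exists_nat_ge (max ‖p.1‖ (max p.2 p.2⁻¹))
      simp only [max_le_iff] at hn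
      refine ⟨n, hn.1, ?_, hn.2.1⟩
      rw [inv_le_comm₀ (by positivity) hp]
      linarith [hn.2.2]
    · rintro ⟨n, -, h, -⟩
      exact lt_of_lt_of_le (by positivity) h
  rw [hU]
  refine AEStronglyMeasurable.iUnion fun n => (hk _ ?_ ?_).1
  · exact (isCompact_closedBall _ _).prod isCompact_Icc
  · rw [hU]; exact subset_iUnion (fun n : ℕ =>
      Metric.closedBall (0 : Sp N) n ×ˢ Icc ((n : ℝ) + 1)⁻¹ (n : ℝ)) n

/-- Local square integrability makes products with compactly supported tensors integrable. -/
theorem integrable_mul_tensor {k : Sp N × ℝ → ℝ}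
    (hk : ∀ K : Set (Sp N × ℝ), IsCompact K → K ⊆ upperHalf N → MemLp k 2 (volume.restrict K))
    {ψ : Sp N → ℝ} {a : ℝ → ℝ} (hψ : Continuous ψ) (hψc : HasCompactSupport ψ)
    (ha : Continuous a) (hac : HasCompactSupport a) (has : tsupport a ⊆ Ioi 0) :
    Integrable (fun p : Sp N × ℝ => a p.2 * (k p * ψ p.1)) (gaussHalf N) := by
  rw [integrable_gaussHalf_iff]
  set K := tsupport ψ ×ˢ tsupport a with hK
  have hKc : IsCompact K := hψc.isCompact.prod hac.isCompact
  have hKU : K ⊆ upperHalf N := fun p hp => has hp.2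
  have hKf : IsFiniteMeasure ((volume : Measure (Sp N × ℝ)).restrict K) :=
    isFiniteMeasure_restrict.2 hKc.measure_lt_top.ne
  have h1 : IntegrableOn k K := (hk K hKc hKU).integrable one_le_two
  have hrc : Continuous (rho N) := contDiff_rho.continuous
  have h2 : IntegrableOn (fun p => (a p.2 * ψ p.1 * rho N p.1) * k p) K :=
    h1.continuousOn_mul (by fun_prop) hKc
  have h3 : Integrable (fun p => (a p.2 * ψ p.1 * rho N p.1) * k p) := by
    rw [← integrableOn_iff_integrable_of_support_subset (s := K)]
    · exact h2
    · intro p hp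
      have : a p.2 ≠ 0 ∧ ψ p.1 ≠ 0 := by
        constructor <;> · intro h0; apply hp; simp [h0]
      exact ⟨subset_tsupport _ this.2, subset_tsupport _ this.1⟩
  refine h3.integrableOn.congr (ae_of_all _ fun p => ?_)
  simp only; ring

/-- Local integrability of the slice pairings `z ↦ ∫ k(x, z) ψ(x) dγ(x)`. -/
theorem locallyIntegrableOn_pairing {k : Sp N × ℝ → ℝ}
    (hk : ∀ K : Set (Sp N × ℝ), IsCompact K → K ⊆ upperHalf N → MemLp k 2 (volume.restrict K))
    {ψ : Sp N → ℝ} (hψ : Continuous ψ) (hψc : HasCompactSupport ψ) :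
    LocallyIntegrableOn (fun z => ∫ x, k (x, z) * ψ x ∂(gauss N)) (Ioi 0) := by
  intro z₀ hz₀
  have hz₀ : 0 < z₀ := hz₀
  -- The bump localizes in z for Fubini and equals 1 near z₀, where it can be removed again.
  let B : ContDiffBump z₀ := ⟨z₀ / 4, z₀ / 2, by positivity, by linarith⟩
  have hBs : tsupport B ⊆ Ioi 0 := by
    rw [B.tsupport_eq, Real.closedBall_eq_Icc]
    intro x hx
    have : z₀ - z₀ / 2 ≤ x := hx.1
    exact lt_of_lt_of_le (by linarith) this
  have h1 := (integrable_mul_tensor hk hψ hψc B.continuous B.hasCompactSupport hBs)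
  have h2 : IntegrableOn (fun z => ∫ x, B z * (k (x, z) * ψ x) ∂(gauss N)) (Ioi 0) :=
    Integrable.integral_prod_right h1
  refine ⟨Metric.closedBall z₀ (z₀ / 4), mem_nhdsWithin_of_mem_nhds
    (Metric.closedBall_mem_nhds _ (by positivity)), ?_⟩
  have hsub : Metric.closedBall z₀ (z₀ / 4) ⊆ Ioi 0 := by
    rw [Real.closedBall_eq_Icc]
    intro x hx
    exact lt_of_lt_of_le (by linarith) hx.1
  refine (h2.mono_set hsub).congr_fun (fun z hz => ?_) measurableSet_closedBall
  simp only
  rw [integral_const_mul, B.one_of_mem_closedBall hz, one_mul]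

end HalfSpace

/-! ### Functions of finite weighted energy. -/

section Weighted

variable {N : ℕ}

/-- Square-integrability on the half-space with the weight `z^{1-2σ}`. -/
structure WeightedL2 (N : ℕ) (σ : ℝ) (k : Sp N × ℝ → ℝ) : Prop where
  meas : AEStronglyMeasurable k (gaussHalf N)
  sq : Integrable (fun p => p.2 ^ (1 - 2 * σ) * k p ^ 2) (gaussHalf N)

namespace WeightedL2

variable {σ : ℝ} {k : Sp N × ℝ → ℝ} {Φ : Sp N → ℝ}

theorem ae_memLp (h : WeightedL2 N σ k) :
    ∀ᵐ z, z ∈ Ioi (0:ℝ) → MemLp (fun x => k (x, z)) 2 (gauss N) := by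
  rw [← ae_restrict_iff' measurableSet_Ioi]
  filter_upwards [h.meas.prodMk_right, Integrable.prod_left_ae h.sq,
    ae_restrict_mem measurableSet_Ioi] with z h1 h2 hz
  rw [memLp_two_iff_integrable_sq h1]
  have hw : z ^ (1 - 2 * σ) ≠ 0 := (Real.rpow_pos_of_pos hz _).ne'
  refine (h2.const_mul (z ^ (1 - 2 * σ))⁻¹).congr (ae_of_all _ fun x => ?_)
  simp only
  field_simp

theorem aestronglyMeasurable_pairing (h : WeightedL2 N σ k)
    (hΦ : AEStronglyMeasurable Φ (gauss N)) :
    AEStronglyMeasurable (fun z => ∫ x, k (x, z) * Φ x ∂(gauss N)) (volume.restrict (Ioi 0)) := by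
  have h1 : AEStronglyMeasurable (fun p : Sp N × ℝ => k p * Φ p.1) (gaussHalf N) :=
    h.meas.mul hΦ.comp_fst
  exact h1.prod_swap.integral_prod_right'

theorem integrableOn_weight_integral_sq (h : WeightedL2 N σ k) :
    IntegrableOn (fun z => z ^ (1 - 2 * σ) * ∫ x, k (x, z) ^ 2 ∂(gauss N)) (Ioi 0) := by
  have h2 := Integrable.integral_prod_right h.sq
  simp only [integral_const_mul] at h2
  exact h2

theorem integrableOn_pairing_sq (h : WeightedL2 N σ k) (hΦ : MemLp Φ 2 (gauss N)) :
    IntegrableOn (fun z => z ^ (1 - 2 * σ) * (∫ x, k (x, z) * Φ x ∂(gauss N)) ^ 2) (Ioi 0) := by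
  refine (h.integrableOn_weight_integral_sq.mul_const (∫ x, Φ x ^ 2 ∂(gauss N))).mono'
    (((by fun_prop : Measurable fun t : ℝ => t ^ (1 - 2 * σ)).aestronglyMeasurable).mul
      ((h.aestronglyMeasurable_pairing hΦ.1).pow 2)) ?_
  filter_upwards [ae_restrict_mem measurableSet_Ioi, ae_restrict_of_ae h.ae_memLp] with z hz hm
  have hw : 0 < z ^ (1 - 2 * σ) := Real.rpow_pos_of_pos hz _
  rw [Real.norm_of_nonneg (by positivity), mul_assoc]
  gcongr
  exact sq_integral_mul_le (hm hz) hΦ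

/-- Products with tensors `a(z) Φ(x)`, `a` compactly supported in `(0, ∞)` and `Φ ∈ L²_γ`. -/
theorem integrable_tensor (h : WeightedL2 N σ k) (hΦ : MemLp Φ 2 (gauss N)) {a : ℝ → ℝ}
    (ha : Continuous a) (hac : HasCompactSupport a) (has : tsupport a ⊆ Ioi 0) :
    Integrable (fun p => p.2 ^ (1 - 2 * σ) * (a p.2 * (k p * Φ p.1))) (gaussHalf N) := by
  have hi : IntegrableOn (fun z : ℝ => z ^ (1 - 2 * σ) * a z ^ 2) (Ioi 0) := by
    have hc : ContinuousOn (fun z : ℝ => z ^ (1 - 2 * σ) * a z ^ 2) (tsupport a) :=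
      ContinuousOn.mul (fun z hz => (Real.continuousAt_rpow_const _ _
        (Or.inl (ne_of_gt (has hz)))).continuousWithinAt) (by fun_prop)
    refine (((integrableOn_iff_integrable_of_support_subset ?_).1
      (hc.integrableOn_compact hac)).integrableOn)
    intro z hz
    refine subset_tsupport _ fun h0 => hz ?_
    simp [h0]
  have h2 : Integrable (fun p : Sp N × ℝ => Φ p.1 ^ 2 * (p.2 ^ (1 - 2 * σ) * a p.2 ^ 2))
      (gaussHalf N) := Integrable.mul_prod hΦ.integrable_sq hi
  refine (h.sq.add h2).mono' ?_ ?_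
  · refine AEStronglyMeasurable.mul
      (by fun_prop : Measurable fun p : Sp N × ℝ => p.2 ^ (1 - 2 * σ)).aestronglyMeasurable
      (AEStronglyMeasurable.mul (by fun_prop : Continuous
        fun p : Sp N × ℝ => a p.2).aestronglyMeasurable (h.meas.mul hΦ.1.comp_fst))
  · have hpos : ∀ᵐ p ∂(gaussHalf N), 0 < p.2 := by
      have := (ae_restrict_mem (μ := (volume : Measure ℝ)) (measurableSet_Ioi (a := (0:ℝ))))
      exact Measure.quasiMeasurePreserving_snd.ae this
    filter_upwards [hpos] with p hp
    have hw : 0 < p.2 ^ (1 - 2 * σ) := Real.rpow_pos_of_pos hp _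
    simp only [Pi.add_apply]
    rw [Real.norm_eq_abs, abs_mul, abs_of_pos hw]
    have e : p.2 ^ (1 - 2 * σ) * k p ^ 2 + Φ p.1 ^ 2 * (p.2 ^ (1 - 2 * σ) * a p.2 ^ 2) =
        p.2 ^ (1 - 2 * σ) * (k p ^ 2 + (a p.2 * Φ p.1) ^ 2) := by ring
    rw [e]
    gcongr
    rw [abs_le]
    constructor <;> nlinarith [sq_nonneg (k p - a p.2 * Φ p.1), sq_nonneg (k p + a p.2 * Φ p.1),
      sq_nonneg (k p), sq_nonneg (a p.2 * Φ p.1)]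

theorem integral_tensor (h : WeightedL2 N σ k) (hΦ : MemLp Φ 2 (gauss N)) {a : ℝ → ℝ}
    (ha : Continuous a) (hac : HasCompactSupport a) (has : tsupport a ⊆ Ioi 0) :
    ∫ p, p.2 ^ (1 - 2 * σ) * (a p.2 * (k p * Φ p.1)) ∂(gaussHalf N) =
      ∫ z in Ioi 0, z ^ (1 - 2 * σ) * (a z * ∫ x, k (x, z) * Φ x ∂(gauss N)) := by
  rw [integral_gaussHalf (h.integrable_tensor hΦ ha hac has)]
  simp only [integral_const_mul]

end WeightedL2

end Weighted

/-! ### Testing the weak gradient against tensor products. -/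

section WeakForm

variable {N : ℕ}

theorem fderiv_tensor {θ : ℝ → ℝ} {ψ : Sp N → ℝ} (hθ : Differentiable ℝ θ)
    (hψ : Differentiable ℝ ψ) (p q : Sp N × ℝ) :
    fderiv ℝ (fun p : Sp N × ℝ => θ p.2 * ψ p.1) p q =
      deriv θ p.2 * q.2 * ψ p.1 + θ p.2 * fderiv ℝ ψ p.1 q.1 := by
  have h1 : HasFDerivAt (fun p : Sp N × ℝ => θ p.2) _ p :=
    HasDerivAt.comp_hasFDerivAt (h₂ := θ) (f := Prod.snd) p (hθ p.2).hasDerivAt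
      (ContinuousLinearMap.snd ℝ (Sp N) ℝ).hasFDerivAt
  have h2 : HasFDerivAt (fun p : Sp N × ℝ => ψ p.1) _ p :=
    (hψ p.1).hasFDerivAt.comp p hasFDerivAt_fst
  have h3 : HasFDerivAt (fun p : Sp N × ℝ => θ p.2 * ψ p.1) _ p := h1.mul h2
  rw [h3.fderiv]
  simp
  ring

theorem isTestFunction_tensor {θ : ℝ → ℝ} {ψ : Sp N → ℝ} (hθ : ContDiff ℝ ∞ θ)
    (hθc : HasCompactSupport θ) (hθs : tsupport θ ⊆ Ioi 0) (hψ : ContDiff ℝ ∞ ψ)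
    (hψc : HasCompactSupport ψ) : IsTestFunction N (fun p : Sp N × ℝ => θ p.2 * ψ p.1) := by
  have hsub : tsupport (fun p : Sp N × ℝ => θ p.2 * ψ p.1) ⊆ tsupport ψ ×ˢ tsupport θ := by
    refine closure_minimal (fun p hp => ?_) ((isClosed_tsupport _).prod (isClosed_tsupport _))
    have : θ p.2 ≠ 0 ∧ ψ p.1 ≠ 0 := mul_ne_zero_iff.1 hp
    exact ⟨subset_tsupport _ this.2, subset_tsupport _ this.1⟩
  exact ⟨(hθ.comp contDiff_snd).mul (hψ.comp contDiff_fst),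
    (hψc.isCompact.prod hθc.isCompact).of_isClosed_subset (isClosed_tsupport _) hsub,
    fun p hp => hθs (hsub hp).2⟩

variable {v : Sp N × ℝ → ℝ} {G : Sp N × ℝ → Sp N × ℝ}

theorem HasWeakGradient.memLp_snd_loc (h : HasWeakGradient N v G) (K : Set (Sp N × ℝ))
    (hK : IsCompact K) (hKU : K ⊆ upperHalf N) :
    MemLp (fun p => (G p).2) 2 (volume.restrict K) :=
  (h.memLp_grad_loc K hK hKU).snd

theorem HasWeakGradient.memLp_coord_loc (h : HasWeakGradient N v G) (i : Fin N)
    (K : Set (Sp N × ℝ)) (hK : IsCompact K) (hKU : K ⊆ upperHalf N) :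
    MemLp (fun p => (G p).1 i) 2 (volume.restrict K) :=
  (EuclideanSpace.proj (𝕜 := ℝ) i).comp_memLp' (h.memLp_grad_loc K hK hKU).fst

/-- The `z`-derivative of a slice pairing, in weak form. -/
theorem HasWeakGradient.integral_pairing_mul_deriv (h : HasWeakGradient N v G) {ψ : Sp N → ℝ}
    (hψ : ContDiff ℝ ∞ ψ) (hψc : HasCompactSupport ψ) {θ : ℝ → ℝ} (hθ : ContDiff ℝ ∞ θ)
    (hθc : HasCompactSupport θ) (hθs : tsupport θ ⊆ Ioi 0) :
    ∫ z in Ioi 0, (∫ x, v (x, z) * ψ x ∂(gauss N)) * deriv θ z =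
      - ∫ z in Ioi 0, (∫ x, (G (x, z)).2 * ψ x ∂(gauss N)) * θ z := by
  -- The weak gradient refers to Lebesgue measure; putting the density into the test function
  -- converts it to Gaussian pairings.
  have hψρ : ContDiff ℝ ∞ (fun x => ψ x * rho N x) := hψ.mul contDiff_rho
  have hd := hψρ.differentiable (by simp)
  have hW := h.weak _ (isTestFunction_tensor hθ hθc hθs hψρ hψc.mul_right) 0 1
  have hθ'c : Continuous (deriv θ) := hθ.continuous_deriv (by simp)
  have i1 := integrable_mul_tensor h.memLp_loc hψ.continuous hψc hθ'c hθc.deriv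
    ((tsupport_deriv_subset (𝕜 := ℝ)).trans hθs)
  have i2 := integrable_mul_tensor h.memLp_snd_loc hψ.continuous hψc hθ.continuous hθc hθs
  have e1 := integral_gaussHalf i1
  have e2 := integral_gaussHalf i2
  rw [← setIntegral_upperHalf_mul_rho] at e1 e2
  simp only [integral_const_mul] at e1 e2
  simp only [mul_comm _ (deriv θ _), mul_comm _ (θ _)]
  rw [← e1, ← e2]
  convert hW using 2
  · ext p
    rw [fderiv_tensor (hθ.differentiable (by simp)) hd]
    simp; ring
  · congr 1; ext p
    simp; ring

/-- The `x`-derivative of a slice pairing, in weak form. -/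
theorem HasWeakGradient.integral_mul_pairing_pd (h : HasWeakGradient N v G) (i : Fin N)
    {ψ : Sp N → ℝ} (hψ : ContDiff ℝ ∞ ψ) (hψc : HasCompactSupport ψ) {θ : ℝ → ℝ}
    (hθ : ContDiff ℝ ∞ θ) (hθc : HasCompactSupport θ) (hθs : tsupport θ ⊆ Ioi 0) :
    ∫ z in Ioi 0, θ z * (∫ x, v (x, z) * (pd i ψ x - x i * ψ x) ∂(gauss N)) =
      - ∫ z in Ioi 0, θ z * (∫ x, (G (x, z)).1 i * ψ x ∂(gauss N)) := by
  -- Differentiating the density produces the drift: ∂_i(ψ ρ) = (∂_i ψ - x_i ψ) ρ.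
  have hψρ : ContDiff ℝ ∞ (fun x => ψ x * rho N x) := hψ.mul contDiff_rho
  have hd := hψρ.differentiable (by simp)
  have hW := h.weak _ (isTestFunction_tensor hθ hθc hθs hψρ hψc.mul_right)
    (EuclideanSpace.single i 1) 0
  have hpd : Continuous (fun x => pd i ψ x - x i * ψ x) := by
    have : Continuous (pd i ψ) := (hψ.continuous_fderiv (by simp)).clm_apply continuous_const
    have := hψ.continuous
    fun_prop
  have hpdc : HasCompactSupport (fun x => pd i ψ x - x i * ψ x) :=
    (hψc.fderiv_apply (𝕜 := ℝ) _).sub hψc.mul_left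
  have i1 := integrable_mul_tensor h.memLp_loc hpd hpdc hθ.continuous hθc hθs
  have i2 := integrable_mul_tensor (h.memLp_coord_loc i) hψ.continuous hψc hθ.continuous hθc hθs
  have e1 := integral_gaussHalf i1
  have e2 := integral_gaussHalf i2
  rw [← setIntegral_upperHalf_mul_rho] at e1 e2
  simp only [integral_const_mul] at e1 e2
  rw [← e1, ← e2]
  convert hW using 2
  · ext p
    rw [fderiv_tensor (hθ.differentiable (by simp)) hd]
    simp only [mul_zero, zero_mul, zero_add]
    rw [fderiv_fun_mul (hψ.differentiable (by simp) _) (contDiff_rho.differentiable (by simp) _)]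
    simp only [_root_.add_apply, _root_.smul_apply, smul_eq_mul, fderiv_rho, pd,
      EuclideanSpace.inner_single_right]
    simp
    ring
  · congr 1; ext p
    simp [EuclideanSpace.inner_single_right]; ring

theorem HasWeakGradient.exists_pairing_eq (h : HasWeakGradient N v G) {ψ : Sp N → ℝ}
    (hψ : ContDiff ℝ ∞ ψ) (hψc : HasCompactSupport ψ) :
    ∃ c : ℝ, ∀ᵐ z, z ∈ Ioi (0:ℝ) → ∫ x, v (x, z) * ψ x ∂(gauss N) =
      c + ∫ t in (1:ℝ)..z, ∫ x, (G (x, t)).2 * ψ x ∂(gauss N) :=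
  ae_eq_primitive_of_weak_deriv (locallyIntegrableOn_pairing h.memLp_loc hψ.continuous hψc)
    (locallyIntegrableOn_pairing h.memLp_snd_loc hψ.continuous hψc)
    fun _ h1 h2 h3 => h.integral_pairing_mul_deriv hψ hψc h1 h2 h3

/-- Because θ(z) is arbitrary, the fundamental lemma localizes the integration by parts to almost
every slice. -/
theorem HasWeakGradient.ae_pairing_pd (h : HasWeakGradient N v G) (i : Fin N) {ψ : Sp N → ℝ}
    (hψ : ContDiff ℝ ∞ ψ) (hψc : HasCompactSupport ψ) :
    ∀ᵐ z, z ∈ Ioi (0:ℝ) → ∫ x, v (x, z) * (pd i ψ x - x i * ψ x) ∂(gauss N) =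
      - ∫ x, (G (x, z)).1 i * ψ x ∂(gauss N) := by
  have hpd : Continuous (fun x => pd i ψ x - x i * ψ x) := by
    have : Continuous (pd i ψ) := (hψ.continuous_fderiv (by simp)).clm_apply continuous_const
    have := hψ.continuous
    fun_prop
  have hpdc : HasCompactSupport (fun x => pd i ψ x - x i * ψ x) :=
    (hψc.fderiv_apply (𝕜 := ℝ) _).sub hψc.mul_left
  have l1 := locallyIntegrableOn_pairing h.memLp_loc hpd hpdc
  have l2 := locallyIntegrableOn_pairing (h.memLp_coord_loc i) hψ.continuous hψc
  have key := isOpen_Ioi.ae_eq_zero_of_integral_contDiff_smul_eq_zero (l1.add l2) ?_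
  · filter_upwards [key] with z hz hz'
    exact eq_neg_of_add_eq_zero_left (hz hz')
  intro θ hθ hθc hθs
  have hsupp : ∀ x, x ∉ Ioi (0:ℝ) → θ x = 0 := fun x hx =>
    image_eq_zero_of_notMem_tsupport fun h' => hx (hθs h')
  rw [← setIntegral_eq_integral_of_forall_compl_eq_zero (s := Ioi 0)
    (fun x hx => by rw [hsupp x hx, zero_smul])]
  have i1 := Integrable.integral_prod_right
    (integrable_mul_tensor h.memLp_loc hpd hpdc hθ.continuous hθc hθs)
  have i2 := Integrable.integral_prod_right
    (integrable_mul_tensor (h.memLp_coord_loc i) hψ.continuous hψc hθ.continuous hθc hθs)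
  simp only [integral_const_mul] at i1 i2
  simp only [Pi.add_apply, smul_eq_mul, mul_add]
  rw [integral_add i1 i2, h.integral_mul_pairing_pd i hψ hψc hθ hθc hθs, neg_add_cancel]

end WeakForm

/-! ### Finite energy and the identification of boundary values. -/

section FiniteEnergy

variable {N : ℕ} {σ : ℝ} {v : Sp N × ℝ → ℝ} {G : Sp N × ℝ → Sp N × ℝ}

theorem ae_gaussHalf_pos : ∀ᵐ p ∂(gaussHalf N), 0 < p.2 :=
  Measure.quasiMeasurePreserving_snd.ae
    (ae_restrict_mem (μ := (volume : Measure ℝ)) (measurableSet_Ioi (a := (0:ℝ))))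

theorem HasWeakGradient.aestronglyMeasurable (h : HasWeakGradient N v G) :
    AEStronglyMeasurable v (gaussHalf N) :=
  (aestronglyMeasurable_of_forall_compact h.memLp_loc).mono_ac (gaussHalf_absolutelyContinuous N)

theorem HasWeakGradient.aestronglyMeasurable_grad (h : HasWeakGradient N v G) :
    AEStronglyMeasurable G (gaussHalf N) :=
  (aestronglyMeasurable_of_forall_compact h.memLp_grad_loc).mono_ac
    (gaussHalf_absolutelyContinuous N)

theorem HasWeakGradient.integrable_energy (h : HasWeakGradient N v G) (hE : energy N σ G < ⊤) :
    Integrable (fun p => (‖(G p).1‖ ^ 2 + (G p).2 ^ 2) * p.2 ^ (1 - 2 * σ)) (gaussHalf N) := by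
  have hG := h.aestronglyMeasurable_grad
  have hm : AEStronglyMeasurable
      (fun p => (‖(G p).1‖ ^ 2 + (G p).2 ^ 2) * p.2 ^ (1 - 2 * σ)) (gaussHalf N) :=
    ((hG.fst.norm.pow 2).add (hG.snd.pow 2)).mul
      (by fun_prop : Measurable fun p : Sp N × ℝ => p.2 ^ (1 - 2 * σ)).aestronglyMeasurable
  refine ⟨hm, ?_⟩
  rw [hasFiniteIntegral_iff_ofReal]
  · exact hE
  · filter_upwards [ae_gaussHalf_pos] with p hp
    have : 0 < p.2 ^ (1 - 2 * σ) := Real.rpow_pos_of_pos hp _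
    exact mul_nonneg (by positivity) this.le

theorem HasWeakGradient.energy_eq (h : HasWeakGradient N v G) (hE : energy N σ G < ⊤) :
    energy N σ G = ENNReal.ofReal
      (∫ z in Ioi 0, z ^ (1 - 2 * σ) * ∫ x, (‖(G (x, z)).1‖ ^ 2 + (G (x, z)).2 ^ 2) ∂(gauss N)) := by
  have hi := h.integrable_energy hE
  rw [energy, ← ofReal_integral_eq_lintegral_ofReal hi, integral_gaussHalf hi]
  · simp only [integral_mul_const]
    simp only [mul_comm]
  · filter_upwards [ae_gaussHalf_pos] with p hp
    have : 0 < p.2 ^ (1 - 2 * σ) := Real.rpow_pos_of_pos hp _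
    exact mul_nonneg (by positivity) this.le

theorem HasWeakGradient.weightedL2_snd (h : HasWeakGradient N v G) (hE : energy N σ G < ⊤) :
    WeightedL2 N σ (fun p => (G p).2) := by
  have hG := h.aestronglyMeasurable_grad
  refine ⟨hG.snd, (h.integrable_energy hE).mono'
    ((by fun_prop : Measurable fun p : Sp N × ℝ => p.2 ^ (1 - 2 * σ)).aestronglyMeasurable.mul
      (hG.snd.pow 2)) ?_⟩
  filter_upwards [ae_gaussHalf_pos] with p hp
  have : 0 < p.2 ^ (1 - 2 * σ) := Real.rpow_pos_of_pos hp _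
  rw [Real.norm_of_nonneg (by positivity), mul_comm]
  gcongr
  exact le_add_of_nonneg_left (by positivity)

theorem HasWeakGradient.weightedL2_coord (h : HasWeakGradient N v G) (hE : energy N σ G < ⊤)
    (i : Fin N) : WeightedL2 N σ (fun p => (G p).1 i) := by
  have hG := h.aestronglyMeasurable_grad
  have hGi : AEStronglyMeasurable (fun p => (G p).1 i) (gaussHalf N) :=
    (EuclideanSpace.proj (𝕜 := ℝ) i).continuous.comp_aestronglyMeasurable hG.fst
  refine ⟨hGi, (h.integrable_energy hE).mono'
    ((by fun_prop : Measurable fun p : Sp N × ℝ => p.2 ^ (1 - 2 * σ)).aestronglyMeasurable.mul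
      (hGi.pow 2)) ?_⟩
  filter_upwards [ae_gaussHalf_pos] with p hp
  have : 0 < p.2 ^ (1 - 2 * σ) := Real.rpow_pos_of_pos hp _
  rw [Real.norm_of_nonneg (by positivity), mul_comm]
  gcongr
  have h1 := PiLp.norm_apply_le (G p).1 i
  rw [Real.norm_eq_abs] at h1
  have h2 := pow_le_pow_left₀ (abs_nonneg _) h1 2
  rw [sq_abs] at h2
  nlinarith [sq_nonneg (G p).2]

/-- Right neighbourhoods of 0 have positive measure. Nontriviality makes limits along the trace
filter unique. -/
theorem neBot_nhdsGT_inf_ae : (𝓝[>] (0:ℝ) ⊓ ae volume).NeBot := by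
  rw [inf_neBot_iff]
  intro s hs t ht
  obtain ⟨u, hu, hus⟩ := mem_nhdsGT_iff_exists_Ioo_subset.1 hs
  by_contra hne
  rw [not_nonempty_iff_eq_empty] at hne
  have h1 : Ioo 0 u ⊆ tᶜ := fun x hx hxt => by
    have : x ∈ s ∩ t := ⟨hus hx, hxt⟩
    simp [hne] at this
  have h2 : volume (Ioo (0:ℝ) u) = 0 := measure_mono_null h1 ht
  simp only [Real.volume_Ioo, sub_zero, ENNReal.ofReal_eq_zero] at h2
  exact absurd h2 (not_le.2 hu)

theorem eventually_of_ae_Ioi {P : ℝ → Prop} (h : ∀ᵐ z, z ∈ Ioi (0:ℝ) → P z) :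
    ∀ᶠ z in 𝓝[>] (0:ℝ) ⊓ ae volume, P z := by
  have h1 : ∀ᶠ z in 𝓝[>] (0:ℝ) ⊓ ae volume, z ∈ Ioi (0:ℝ) :=
    Filter.Eventually.filter_mono inf_le_left self_mem_nhdsWithin
  have h2 := Filter.Eventually.filter_mono (inf_le_right : 𝓝[>] (0:ℝ) ⊓ ae volume ≤ ae volume) h
  filter_upwards [h1, h2] with z hz hz' using hz' hz

/-- Slice pairings with a dominated sequence of test functions converge to a primitive. -/
theorem HasWeakGradient.tendsto_pairing (h : HasWeakGradient N v G) (hσ : 0 < σ)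
    (hE : energy N σ G < ⊤) {u : Sp N → ℝ} (hu : MemLp u 2 (gauss N)) (htr : HasTrace N v u)
    {ψ : ℕ → Sp N → ℝ} {ψ' Ψ : Sp N → ℝ} (hψ : ∀ n, ContDiff ℝ ∞ (ψ n))
    (hψc : ∀ n, HasCompactSupport (ψ n)) (hΨ : MemLp Ψ 2 (gauss N))
    (hle : ∀ n x, |ψ n x| ≤ Ψ x) (hlim : ∀ x, Tendsto (fun n => ψ n x) atTop (𝓝 (ψ' x))) :
    ∀ᵐ z, z ∈ Ioi (0:ℝ) → Tendsto (fun n => ∫ x, v (x, z) * ψ n x ∂(gauss N)) atTop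
      (𝓝 ((∫ x, u x * ψ' x ∂(gauss N)) +
        ∫ t in 0..z, ∫ x, (G (x, t)).2 * ψ' x ∂(gauss N))) := by
  have hψm : ∀ n, AEStronglyMeasurable (ψ n) (gauss N) := fun n =>
    (hψ n).continuous.aestronglyMeasurable
  have hψL : ∀ n, MemLp (ψ n) 2 (gauss N) := fun n => hΨ.mono (hψm n) (ae_of_all _ fun x => by
    rw [Real.norm_eq_abs, Real.norm_eq_abs]; exact (hle n x).trans (le_abs_self _))
  have hψ'm : AEStronglyMeasurable ψ' (gauss N) :=
    aestronglyMeasurable_of_tendsto_ae atTop hψm (ae_of_all _ hlim)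
  have hle' : ∀ x, |ψ' x| ≤ Ψ x := fun x =>
    le_of_tendsto (hlim x).abs (Eventually.of_forall fun n => hle n x)
  have hψ'L : MemLp ψ' 2 (gauss N) := hΨ.mono hψ'm (ae_of_all _ fun x => by
    rw [Real.norm_eq_abs, Real.norm_eq_abs]; exact (hle' x).trans (le_abs_self _))
  have hk := h.weightedL2_snd hE
  have hkabs : WeightedL2 N σ (fun p => |(G p).2|) := ⟨hk.meas.norm, by simpa using hk.sq⟩
  -- dominated convergence on slices
  have hDCT : ∀ w : Sp N → ℝ, MemLp w 2 (gauss N) →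
      Tendsto (fun n => ∫ x, w x * ψ n x ∂(gauss N)) atTop (𝓝 (∫ x, w x * ψ' x ∂(gauss N))) := by
    intro w hw
    refine tendsto_integral_of_dominated_convergence (fun x => |w x| * Ψ x)
      (fun n => hw.1.mul (hψm n)) (hw.abs.integrable_mul hΨ)
      (fun n => ae_of_all _ fun x => ?_) (ae_of_all _ fun x => (hlim x).const_mul _)
    rw [Real.norm_eq_abs, abs_mul]
    exact mul_le_mul_of_nonneg_left (hle n x) (abs_nonneg _)
  have hgi : ∀ (Φ : Sp N → ℝ), MemLp Φ 2 (gauss N) → ∀ z, 0 ≤ z →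
      IntervalIntegrable (fun t => ∫ x, (G (x, t)).2 * Φ x ∂(gauss N)) volume 0 z :=
    fun Φ hΦ z hz => intervalIntegrable_zero_of_weighted hσ
      (hk.aestronglyMeasurable_pairing hΦ.1) (hk.integrableOn_pairing_sq hΦ) hz
  have hgabs : ∀ z, 0 ≤ z →
      IntervalIntegrable (fun t => ∫ x, |(G (x, t)).2| * Ψ x ∂(gauss N)) volume 0 z :=
    fun z hz => intervalIntegrable_zero_of_weighted hσ
      (hkabs.aestronglyMeasurable_pairing hΨ.1) (hkabs.integrableOn_pairing_sq hΨ) hz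
  have hprim : ∀ z, 0 ≤ z → Tendsto
      (fun n => ∫ t in 0..z, ∫ x, (G (x, t)).2 * ψ n x ∂(gauss N)) atTop
      (𝓝 (∫ t in 0..z, ∫ x, (G (x, t)).2 * ψ' x ∂(gauss N))) := by
    intro z hz
    refine intervalIntegral.tendsto_integral_filter_of_dominated_convergence
      (fun t => ∫ x, |(G (x, t)).2| * Ψ x ∂(gauss N)) (Eventually.of_forall fun n => ?_)
      (Eventually.of_forall fun n => ?_) (hgabs z hz) ?_
    · exact (intervalIntegrable_iff.1 (hgi _ (hψL n) z hz)).1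
    · filter_upwards [hk.ae_memLp] with t ht ht'
      rw [uIoc_of_le hz] at ht'
      have hm := ht ht'.1
      refine (norm_integral_le_integral_norm _).trans (integral_mono_of_nonneg
        (ae_of_all _ fun x => norm_nonneg _) (hm.abs.integrable_mul hΨ) (ae_of_all _ fun x => ?_))
      simp only [norm_mul, Real.norm_eq_abs]
      exact mul_le_mul_of_nonneg_left (hle n x) (abs_nonneg _)
    · filter_upwards [hk.ae_memLp] with t ht ht'
      rw [uIoc_of_le hz] at ht'
      exact hDCT _ (ht ht'.1)
  choose a ha using fun n => h.exists_pairing_eq (hψ n) (hψc n)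
  -- The base point moves from 1 to 0, which finite energy permits; b n is then the boundary value
  -- of the n-th pairing.
  set b : ℕ → ℝ := fun n => a n - ∫ t in 0..1, ∫ x, (G (x, t)).2 * ψ n x ∂(gauss N) with hb
  have hfb : ∀ᵐ z, z ∈ Ioi (0:ℝ) → ∀ n, ∫ x, v (x, z) * ψ n x ∂(gauss N) =
      b n + ∫ t in 0..z, ∫ x, (G (x, t)).2 * ψ n x ∂(gauss N) := by
    filter_upwards [ae_all_iff.2 ha] with z hz hz' n
    have hz'' : 0 < z := hz'
    rw [hz n hz', hb]
    have := intervalIntegral.integral_add_adjacent_intervals (hgi _ (hψL n) 1 zero_le_one)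
      ((hgi _ (hψL n) 1 zero_le_one).symm.trans (hgi _ (hψL n) z hz''.le))
    simp only
    linarith
  set L := 𝓝[>] (0:ℝ) ⊓ ae volume with hL
  have hLne : L.NeBot := neBot_nhdsGT_inf_ae
  have hvm : ∀ᵐ z, z ∈ Ioi (0:ℝ) → AEStronglyMeasurable (fun x => v (x, z)) (gauss N) := by
    rw [← ae_restrict_iff' measurableSet_Ioi]
    exact h.aestronglyMeasurable.prodMk_right
  -- Near the boundary, slices differ from u by less than 1 in norm. At larger heights global square
  -- integrability is not available, hence the limit over ψ n.
  have hvL : ∀ᶠ z in L, MemLp (fun x => v (x, z)) 2 (gauss N) := by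
    have h1 : ∀ᶠ z in L, eLpNorm (fun x => v (x, z) - u x) 2 (gauss N) < 1 :=
      htr.eventually_lt_const one_pos
    filter_upwards [h1, eventually_of_ae_Ioi hvm] with z hz hm
    have hd : MemLp (fun x => v (x, z) - u x) 2 (gauss N) :=
      ⟨hm.sub hu.1, hz.trans ENNReal.one_lt_top⟩
    exact (hd.add hu).congr_norm hm (ae_of_all _ fun x => by simp)
  have hpos : ∀ᶠ z in L, z ∈ Ioi (0:ℝ) :=
    Filter.Eventually.filter_mono inf_le_left self_mem_nhdsWithin
  -- The sequence b does not depend on z, so this limit is the same at all such heights; letting z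
  -- tend to 0 evaluates it by the trace.
  have hblim : ∀ᶠ z in L, Tendsto b atTop (𝓝 ((∫ x, v (x, z) * ψ' x ∂(gauss N)) -
      ∫ t in 0..z, ∫ x, (G (x, t)).2 * ψ' x ∂(gauss N))) := by
    filter_upwards [hvL, eventually_of_ae_Ioi hfb, hpos] with z h1 h2 h3
    have h4 := (hDCT _ h1).sub (hprim z (le_of_lt h3))
    refine h4.congr fun n => ?_
    rw [h2 n]; ring
  obtain ⟨z₁, hz₁⟩ := hblim.exists
  have hvlim : Tendsto (fun z => ∫ x, v (x, z) * ψ' x ∂(gauss N)) L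
      (𝓝 (∫ x, u x * ψ' x ∂(gauss N))) :=
    tendsto_integral_mul_of_tendsto_eLpNorm hψ'L hu hvL htr
  have hprim0 : Tendsto (fun z => ∫ t in 0..z, ∫ x, (G (x, t)).2 * ψ' x ∂(gauss N)) L (𝓝 0) := by
    have hc := intervalIntegral.continuousOn_primitive_interval' (hgi _ hψ'L 1 zero_le_one)
      left_mem_uIcc 0 left_mem_uIcc
    rw [ContinuousWithinAt, intervalIntegral.integral_same, uIcc_of_le zero_le_one] at hc
    refine hc.mono_left (inf_le_left.trans ?_)
    rw [← nhdsWithin_Ioc_eq_nhdsGT zero_lt_one]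
    exact nhdsWithin_mono _ Ioc_subset_Icc_self
  have hb0 : Tendsto b atTop (𝓝 (∫ x, u x * ψ' x ∂(gauss N))) := by
    have h1 := hvlim.sub hprim0
    rw [sub_zero] at h1
    have h2 : Tendsto (fun z => (∫ x, v (x, z) * ψ' x ∂(gauss N)) -
        ∫ t in 0..z, ∫ x, (G (x, t)).2 * ψ' x ∂(gauss N)) L
        (𝓝 ((∫ x, v (x, z₁) * ψ' x ∂(gauss N)) -
        ∫ t in 0..z₁, ∫ x, (G (x, t)).2 * ψ' x ∂(gauss N))) := by
      refine tendsto_const_nhds.congr' ?_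
      filter_upwards [hblim] with z hz
      exact tendsto_nhds_unique hz₁ hz
    rwa [tendsto_nhds_unique h2 h1] at hz₁
  filter_upwards [hfb] with z hz hz'
  exact (hb0.add (hprim z (le_of_lt hz'))).congr fun n => (hz hz' n).symm

end FiniteEnergy

/-! ### Hermite coefficients and their differential equation. -/

section Modes

variable {N : ℕ} {σ : ℝ} {v : Sp N × ℝ → ℝ} {G : Sp N × ℝ → Sp N × ℝ} {u : Sp N → ℝ}

theorem contDiff_pd {f : Sp N → ℝ} (i : Fin N) (hf : ContDiff ℝ ∞ f) : ContDiff ℝ ∞ (pd i f) :=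
  (hf.fderiv_right (m := ∞) (by simp)).clm_apply contDiff_const

/-- The derivative of the Hermite coefficient of index `k`. -/
noncomputable def coefDeriv (G : Sp N × ℝ → Sp N × ℝ) (k : Fin N → ℕ) (z : ℝ) : ℝ :=
  ∫ x, (G (x, z)).2 * hermiteOn k x ∂(gauss N)

/-- The Hermite coefficient of index `k` of a function with trace `u` and gradient `G`. -/
noncomputable def coef (u : Sp N → ℝ) (G : Sp N × ℝ → Sp N × ℝ) (k : Fin N → ℕ) (z : ℝ) : ℝ :=
  (∫ x, u x * hermiteOn k x ∂(gauss N)) + ∫ t in 0..z, coefDeriv G k t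

theorem memLp_hermiteOn (k : Fin N → ℕ) : MemLp (hermiteOn k) 2 (gauss N) :=
  memLp_two_of_mem_polyFn (hermiteOn_mem_polyFn k)

theorem memLp_pd_hermiteOn (k : Fin N → ℕ) (i : Fin N) :
    MemLp (pd i (hermiteOn k)) 2 (gauss N) :=
  memLp_two_of_mem_polyFn (pd_mem_polyFn i (hermiteOn_mem_polyFn k))

theorem contDiff_hermiteOn (k : Fin N → ℕ) : ContDiff ℝ ∞ (hermiteOn k) :=
  contDiff_of_mem_polyFn (hermiteOn_mem_polyFn k)

theorem tendsto_integral_cutoff_mul {w Φ : Sp N → ℝ} (hw : MemLp w 2 (gauss N))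
    (hΦ : MemLp Φ 2 (gauss N)) :
    Tendsto (fun n => ∫ x, w x * (cutoff N n x * Φ x) ∂(gauss N)) atTop
      (𝓝 (∫ x, w x * Φ x ∂(gauss N))) := by
  refine tendsto_integral_of_dominated_convergence (fun x => |w x| * |Φ x|)
    (fun n => hw.1.mul ((contDiff_cutoff n).continuous.aestronglyMeasurable.mul hΦ.1))
    (hw.abs.integrable_mul hΦ.abs) (fun n => ae_of_all _ fun x => ?_)
    (ae_of_all _ fun x => ?_)
  · rw [Real.norm_eq_abs, abs_mul, abs_mul]
    have := abs_cutoff_le n x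
    have h2 := abs_nonneg (Φ x)
    gcongr
    nlinarith
  · simpa using ((tendsto_cutoff x).mul_const (Φ x)).const_mul (w x)

theorem HasWeakGradient.tendsto_pairing_cutoff_hermiteOn (h : HasWeakGradient N v G) (hσ : 0 < σ)
    (hE : energy N σ G < ⊤) (hu : MemLp u 2 (gauss N)) (htr : HasTrace N v u) (k : Fin N → ℕ) :
    ∀ᵐ z, z ∈ Ioi (0:ℝ) →
      Tendsto (fun n => ∫ x, v (x, z) * (cutoff N n x * hermiteOn k x) ∂(gauss N)) atTop
        (𝓝 (coef u G k z)) := by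
  refine h.tendsto_pairing hσ hE hu htr (ψ := fun n x => cutoff N n x * hermiteOn k x)
    (fun n => (contDiff_cutoff n).mul (contDiff_hermiteOn k))
    (fun n => (hasCompactSupport_cutoff n).mul_right) (memLp_hermiteOn k).abs (fun n x => ?_)
    (fun x => ?_)
  · change _ ≤ |hermiteOn k x|
    rw [abs_mul]
    nlinarith [abs_cutoff_le n x, abs_nonneg (hermiteOn k x)]
  · simpa using (tendsto_cutoff x).mul_const (hermiteOn k x)

/-- The `x`-gradient in the direction of a Hermite mode is determined by the coefficient. -/
theorem HasWeakGradient.ae_integral_coord_mul_pd (h : HasWeakGradient N v G) (hσ : 0 < σ)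
    (hE : energy N σ G < ⊤) (hu : MemLp u 2 (gauss N)) (htr : HasTrace N v u) (k : Fin N → ℕ)
    (i : Fin N) :
    ∀ᵐ z, z ∈ Ioi (0:ℝ) →
      ∫ x, (G (x, z)).1 i * pd i (hermiteOn k) x ∂(gauss N) = k i * coef u G k z := by
  set D := pd i (hermiteOn k) with hD
  have hDc : ContDiff ℝ ∞ D := contDiff_pd i (contDiff_hermiteOn k)
  obtain ⟨C, hC, hCb⟩ := exists_bound_pd_cutoff i
  set ψ : ℕ → Sp N → ℝ := fun n x => cutoff N n x * D x with hψ
  have hψs : ∀ n, ContDiff ℝ ∞ (ψ n) := fun n => (contDiff_cutoff n).mul hDc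
  have hψc : ∀ n, HasCompactSupport (ψ n) := fun n => (hasCompactSupport_cutoff n).mul_right
  -- The eigenvalue identity gives the main term; the derivative of the cutoff is an error that is
  -- bounded and tends to 0 pointwise.
  have hform : ∀ n x, pd i (ψ n) x - x i * ψ n x =
      cutoff N n x * (-(k i * hermiteOn k x)) + D x * pd i (cutoff N n) x := by
    intro n x
    rw [hψ, pd_mul i ((contDiff_cutoff n).differentiable (by simp))
      (hDc.differentiable (by simp)), ← coord_mul_pd_sub_pd_pd_hermiteOn]
    ring
  have hΨ : MemLp (fun x => k i * |hermiteOn k x| + C * |D x|) 2 (gauss N) :=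
    ((memLp_hermiteOn k).abs.const_mul _).add ((memLp_pd_hermiteOn k i).abs.const_mul C)
  have hlim := h.tendsto_pairing hσ hE hu htr (ψ := fun n x => pd i (ψ n) x - x i * ψ n x)
    (ψ' := fun x => -(k i * hermiteOn k x)) (Ψ := fun x => k i * |hermiteOn k x| + C * |D x|)
    (fun n => (contDiff_pd i (hψs n)).sub
      ((EuclideanSpace.proj (𝕜 := ℝ) i).contDiff.mul (hψs n)))
    (fun n => ((hψc n).fderiv_apply (𝕜 := ℝ) _).sub (hψc n).mul_left) hΨ
    (fun n x => by
      rw [hform]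
      refine (abs_add_le _ _).trans ?_
      rw [abs_mul, abs_mul, abs_neg, abs_mul, Nat.abs_cast]
      have h1 := abs_cutoff_le n x
      have h2 := hCb n x
      have h3 : 0 ≤ (k i : ℝ) * |hermiteOn k x| := by positivity
      have h4 := abs_nonneg (D x)
      nlinarith)
    (fun x => by
      simp only [hform]
      simpa using ((tendsto_cutoff x).mul_const (-(k i * hermiteOn k x))).add
        ((tendsto_pd_cutoff i x).const_mul (D x)))
  have hae : ∀ᵐ z, ∀ n, z ∈ Ioi (0:ℝ) →
      ∫ x, v (x, z) * (pd i (ψ n) x - x i * ψ n x) ∂(gauss N) =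
      - ∫ x, (G (x, z)).1 i * ψ n x ∂(gauss N) :=
    ae_all_iff.2 fun n => h.ae_pairing_pd i (hψs n) (hψc n)
  filter_upwards [hlim, hae, (h.weightedL2_coord hE i).ae_memLp] with z h1 h2 h3 hz
  have h4 := (tendsto_integral_cutoff_mul (h3 hz) (memLp_pd_hermiteOn k i)).neg
  have h5 := tendsto_nhds_unique ((h1 hz).congr fun n => h2 n hz) h4
  have e1 : ∀ w : Sp N → ℝ, ∫ x, w x * -(k i * hermiteOn k x) ∂(gauss N) =
      -(k i) * ∫ x, w x * hermiteOn k x ∂(gauss N) := fun w => by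
    rw [← integral_const_mul]; congr 1; ext x; ring
  simp only [e1, intervalIntegral.integral_const_mul] at h5
  simp only [coef, coefDeriv, hD]
  linarith

theorem HasWeakGradient.intervalIntegrable_coefDeriv (h : HasWeakGradient N v G) (hσ : 0 < σ)
    (hE : energy N σ G < ⊤) (k : Fin N → ℕ) (z : ℝ) (hz : 0 ≤ z) :
    IntervalIntegrable (coefDeriv G k) volume 0 z :=
  intervalIntegrable_zero_of_weighted hσ
    ((h.weightedL2_snd hE).aestronglyMeasurable_pairing (memLp_hermiteOn k).1)
    ((h.weightedL2_snd hE).integrableOn_pairing_sq (memLp_hermiteOn k)) hz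

theorem HasWeakGradient.continuousOn_coef (h : HasWeakGradient N v G) (hσ : 0 < σ)
    (hE : energy N σ G < ⊤) (k : Fin N → ℕ) : ContinuousOn (coef u G k) (Ioi 0) :=
  continuousOn_Ioi_of_primitive (h.intervalIntegrable_coefDeriv hσ hE k) fun _ _ => rfl

/-- For k_i ≠ 0 the coefficient is k_i⁻¹ times a pairing of the x-gradient, so the energy controls
it. For the constant mode there is no such control. -/
theorem HasWeakGradient.integrableOn_coef_sq (h : HasWeakGradient N v G) (hσ : 0 < σ)
    (hE : energy N σ G < ⊤) (hu : MemLp u 2 (gauss N)) (htr : HasTrace N v u) {k : Fin N → ℕ}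
    (hk : eig k ≠ 0) : IntegrableOn (fun t => t ^ (1 - 2 * σ) * coef u G k t ^ 2) (Ioi 0) := by
  obtain ⟨i, hi⟩ : ∃ i, (k i : ℝ) ≠ 0 := by
    by_contra! hne
    exact hk (Finset.sum_eq_zero fun i _ => hne i)
  have h1 := (h.weightedL2_coord hE i).integrableOn_pairing_sq (memLp_pd_hermiteOn k i)
  refine (h1.const_mul ((k i : ℝ) ^ 2)⁻¹).congr ?_
  filter_upwards [ae_restrict_of_ae (h.ae_integral_coord_mul_pd hσ hE hu htr k i),
    ae_restrict_mem measurableSet_Ioi] with t ht ht'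
  rw [ht ht']
  field_simp

theorem fderiv_eq_sum_pd (f : Sp N → ℝ) (x w : Sp N) :
    fderiv ℝ f x w = ∑ i, w i * pd i f x := by
  conv_lhs => rw [← (EuclideanSpace.basisFun (Fin N) ℝ).sum_repr w]
  simp [pd]

theorem WeightedL2.tendsto_integral_tensor {κ : Sp N × ℝ → ℝ} (h : WeightedL2 N σ κ)
    {Φ : ℕ → Sp N → ℝ} {Φ' Ψ : Sp N → ℝ} (hΦ : ∀ n, AEStronglyMeasurable (Φ n) (gauss N))
    (hΨ : MemLp Ψ 2 (gauss N)) (hle : ∀ n x, |Φ n x| ≤ |Ψ x|)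
    (hlim : ∀ x, Tendsto (fun n => Φ n x) atTop (𝓝 (Φ' x)))
    {a : ℝ → ℝ} (ha : Continuous a) (hac : HasCompactSupport a) (has : tsupport a ⊆ Ioi 0) :
    Tendsto (fun n => ∫ p, p.2 ^ (1 - 2 * σ) * (a p.2 * (κ p * Φ n p.1)) ∂(gaussHalf N)) atTop
      (𝓝 (∫ p, p.2 ^ (1 - 2 * σ) * (a p.2 * (κ p * Φ' p.1)) ∂(gaussHalf N))) := by
  have hΦL : ∀ n, MemLp (Φ n) 2 (gauss N) := fun n => hΨ.mono (hΦ n) (ae_of_all _ (hle n))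
  refine tendsto_integral_of_dominated_convergence _
    (fun n => (h.integrable_tensor (hΦL n) ha hac has).1)
    (h.integrable_tensor hΨ ha hac has).norm (fun n => ae_of_all _ fun p => ?_)
    (ae_of_all _ fun p => ?_)
  · simp only [norm_mul]
    gcongr
    exact hle n p.1
  · exact ((((hlim p.1).const_mul (κ p)).const_mul (a p.2)).const_mul _)

/-- The Hermite coefficients of an extension solve the mode equation weakly. -/
theorem HasWeakGradient.integral_coef_weak (h : HasWeakGradient N v G) (hσ : 0 < σ)
    (hE : energy N σ G < ⊤) (hu : MemLp u 2 (gauss N)) (htr : HasTrace N v u)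
    (hsol : ∀ η : Sp N × ℝ → ℝ, IsTestFunction N η →
      ∫ p, p.2 ^ (1 - 2 * σ) * fderiv ℝ η p (G p) ∂(gaussHalf N) = 0) (k : Fin N → ℕ)
    {θ : ℝ → ℝ} (hθ : ContDiff ℝ ∞ θ) (hθc : HasCompactSupport θ) (hθs : tsupport θ ⊆ Ioi 0) :
    ∫ z in Ioi 0, (z ^ (1 - 2 * σ) * coefDeriv G k z) * deriv θ z =
      - ∫ z in Ioi 0, (eig k * (z ^ (1 - 2 * σ) * coef u G k z)) * θ z := by
  set H := hermiteOn k with hH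
  have hHs : ContDiff ℝ ∞ H := contDiff_hermiteOn k
  have hθ'c : Continuous (deriv θ) := hθ.continuous_deriv (by simp)
  have hθ's : tsupport (deriv θ) ⊆ Ioi 0 := (tsupport_deriv_subset (𝕜 := ℝ)).trans hθs
  choose C hC hCb using fun i : Fin N => exists_bound_pd_cutoff i
  have hψs : ∀ n, ContDiff ℝ ∞ (fun x => cutoff N n x * H x) := fun n =>
    (contDiff_cutoff n).mul hHs
  have hψc : ∀ n, HasCompactSupport (fun x => cutoff N n x * H x) := fun n =>
    (hasCompactSupport_cutoff n).mul_right
  have hk2 := h.weightedL2_snd hE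
  have hk1 := h.weightedL2_coord hE
  have hle1 : ∀ n x, |cutoff N n x * H x| ≤ |H x| := fun n x => by
    rw [abs_mul]
    nlinarith [abs_cutoff_le n x, abs_nonneg (H x)]
  have hΨ : ∀ i, MemLp (fun x => |pd i H x| + C i * |H x|) 2 (gauss N) := fun i =>
    (memLp_pd_hermiteOn k i).abs.add ((memLp_hermiteOn k).abs.const_mul (C i))
  have hle2 : ∀ i n x, |pd i (fun x => cutoff N n x * H x) x| ≤ |(|pd i H x| + C i * |H x|)| := by
    intro i n x
    rw [pd_mul i ((contDiff_cutoff n).differentiable (by simp)) (hHs.differentiable (by simp)),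
      abs_of_nonneg (a := |pd i H x| + C i * |H x|)
        (add_nonneg (abs_nonneg _) (mul_nonneg (hC i) (abs_nonneg _)))]
    refine (abs_add_le _ _).trans ?_
    rw [abs_mul, abs_mul]
    nlinarith [abs_cutoff_le n x, abs_nonneg (H x), hCb i n x, abs_nonneg (pd i H x)]
  have hm1 : ∀ n, AEStronglyMeasurable (fun x => cutoff N n x * H x) (gauss N) := fun n =>
    (hψs n).continuous.aestronglyMeasurable
  have hm2 : ∀ i n, AEStronglyMeasurable (pd i (fun x => cutoff N n x * H x)) (gauss N) :=
    fun i n => (contDiff_pd i (hψs n)).continuous.aestronglyMeasurable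
  have hL1 : ∀ n, MemLp (fun x => cutoff N n x * H x) 2 (gauss N) := fun n =>
    (memLp_hermiteOn k).mono (hm1 n) (ae_of_all _ (hle1 n))
  have hL2 : ∀ i n, MemLp (pd i (fun x => cutoff N n x * H x)) 2 (gauss N) := fun i n =>
    (hΨ i).mono (hm2 i n) (ae_of_all _ (hle2 i n))
  -- The equation is tested with θ(z) times the cut-off Hermite function, and the cutoff is then
  -- removed by dominated convergence.
  have hzero : ∀ n, (∫ p, p.2 ^ (1 - 2 * σ) *
        (deriv θ p.2 * ((G p).2 * (cutoff N n p.1 * H p.1))) ∂(gaussHalf N)) +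
      ∑ i, ∫ p, p.2 ^ (1 - 2 * σ) *
        (θ p.2 * ((G p).1 i * pd i (fun x => cutoff N n x * H x) p.1)) ∂(gaussHalf N) = 0 := by
    intro n
    have h1 := hsol _ (isTestFunction_tensor hθ hθc hθs (hψs n) (hψc n))
    rw [← integral_finsetSum _ fun i _ =>
      (hk1 i).integrable_tensor (hL2 i n) hθ.continuous hθc hθs, ← integral_add
      (hk2.integrable_tensor (hL1 n) hθ'c hθc.deriv hθ's)
      (integrable_finsetSum _ fun i _ =>
        (hk1 i).integrable_tensor (hL2 i n) hθ.continuous hθc hθs), ← h1]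
    congr 1; ext p
    rw [fderiv_tensor (hθ.differentiable (by simp)) ((hψs n).differentiable (by simp)),
      fderiv_eq_sum_pd, mul_add, Finset.mul_sum, Finset.mul_sum]
    congr 1
    ring
  have hlim : Tendsto (fun n => (∫ p, p.2 ^ (1 - 2 * σ) *
        (deriv θ p.2 * ((G p).2 * (cutoff N n p.1 * H p.1))) ∂(gaussHalf N)) +
      ∑ i, ∫ p, p.2 ^ (1 - 2 * σ) *
        (θ p.2 * ((G p).1 i * pd i (fun x => cutoff N n x * H x) p.1)) ∂(gaussHalf N)) atTop
      (𝓝 ((∫ p, p.2 ^ (1 - 2 * σ) * (deriv θ p.2 * ((G p).2 * H p.1)) ∂(gaussHalf N)) +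
      ∑ i, ∫ p, p.2 ^ (1 - 2 * σ) * (θ p.2 * ((G p).1 i * pd i H p.1)) ∂(gaussHalf N))) := by
    refine (hk2.tendsto_integral_tensor hm1 (memLp_hermiteOn k) hle1 (fun x => ?_) hθ'c
      hθc.deriv hθ's).add (tendsto_finsetSum _ fun i _ =>
      (hk1 i).tendsto_integral_tensor (hm2 i) (hΨ i) (hle2 i) (fun x => ?_) hθ.continuous
        hθc hθs)
    · simpa using (tendsto_cutoff x).mul_const (H x)
    · have e : ∀ n, pd i (fun x => cutoff N n x * H x) x =
          cutoff N n x * pd i H x + H x * pd i (cutoff N n) x := fun n =>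
        pd_mul i ((contDiff_cutoff n).differentiable (by simp)) (hHs.differentiable (by simp)) x
      simp only [e]
      simpa using ((tendsto_cutoff x).mul_const (pd i H x)).add
        ((tendsto_pd_cutoff i x).const_mul (H x))
  simp only [hzero] at hlim
  have h0 := tendsto_nhds_unique hlim tendsto_const_nhds
  rw [hk2.integral_tensor (memLp_hermiteOn k) hθ'c hθc.deriv hθ's] at h0
  -- Direction i contributes the factor k i; summing over i produces the eigenvalue.
  have e1 : ∀ i, ∫ p, p.2 ^ (1 - 2 * σ) * (θ p.2 * ((G p).1 i * pd i H p.1)) ∂(gaussHalf N) =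
      k i * ∫ z in Ioi 0, (z ^ (1 - 2 * σ) * coef u G k z) * θ z := by
    intro i
    rw [(hk1 i).integral_tensor (memLp_pd_hermiteOn k i) hθ.continuous hθc hθs,
      ← integral_const_mul]
    refine setIntegral_congr_ae measurableSet_Ioi ?_
    filter_upwards [h.ae_integral_coord_mul_pd hσ hE hu htr k i] with z hz hz'
    rw [hz hz']; ring
  simp only [e1] at h0
  rw [← Finset.sum_mul] at h0
  have e2 : ∫ z in Ioi 0, (eig k * (z ^ (1 - 2 * σ) * coef u G k z)) * θ z =
      eig k * ∫ z in Ioi 0, (z ^ (1 - 2 * σ) * coef u G k z) * θ z := by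
    rw [← integral_const_mul]; congr 1; ext z; ring
  have e3 : ∫ z in Ioi 0, (z ^ (1 - 2 * σ) * coefDeriv G k z) * deriv θ z =
      ∫ z in Ioi 0, z ^ (1 - 2 * σ) * (deriv θ z * ∫ x, (G (x, z)).2 * H x ∂(gauss N)) := by
    congr 1; ext z; simp only [coefDeriv, ← hH]; ring
  rw [e2, e3, eig]
  linarith

/-- The flux of a Hermite coefficient of an extension. -/
theorem HasWeakGradient.exists_flux (h : HasWeakGradient N v G) (hσ : 0 < σ) (hσ1 : σ < 1)
    (hE : energy N σ G < ⊤) (hu : MemLp u 2 (gauss N)) (htr : HasTrace N v u)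
    (hsol : ∀ η : Sp N × ℝ → ℝ, IsTestFunction N η →
      ∫ p, p.2 ^ (1 - 2 * σ) * fderiv ℝ η p (G p) ∂(gaussHalf N) = 0) (k : Fin N → ℕ) :
    ∃ p0 : ℝ, ∀ᵐ z, z ∈ Ioi (0:ℝ) → z ^ (1 - 2 * σ) * coefDeriv G k z =
      p0 + ∫ t in 0..z, eig k * (t ^ (1 - 2 * σ) * coef u G k t) := by
  have hgi := h.intervalIntegrable_coefDeriv hσ hE k
  have hwc : ContinuousOn (fun t : ℝ => t ^ (1 - 2 * σ)) (Ioi 0) := fun z hz =>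
    (Real.continuousAt_rpow_const _ _ (Or.inl (ne_of_gt hz))).continuousWithinAt
  have hl1 : LocallyIntegrableOn (fun z => z ^ (1 - 2 * σ) * coefDeriv G k z) (Ioi 0) := by
    intro z hz
    have hz : 0 < z := hz
    refine ⟨Icc (z / 2) (z + 1), mem_nhdsWithin_of_mem_nhds
      (Icc_mem_nhds (by linarith) (by linarith)), ?_⟩
    have hg : IntegrableOn (coefDeriv G k) (Icc (z / 2) (z + 1)) := by
      have h1 := (hgi (z + 1) (by linarith)).1
      exact h1.mono_set fun x hx => ⟨lt_of_lt_of_le (by linarith) hx.1, hx.2⟩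
    exact hg.continuousOn_mul (hwc.mono fun x hx => lt_of_lt_of_le (by positivity) hx.1)
      isCompact_Icc
  have hcont := h.continuousOn_coef (u := u) hσ hE k
  have hl2 : LocallyIntegrableOn (fun z => eig k * (z ^ (1 - 2 * σ) * coef u G k z)) (Ioi 0) :=
    (continuousOn_const.mul (hwc.mul hcont)).locallyIntegrableOn measurableSet_Ioi
  obtain ⟨A, hA⟩ := ae_eq_primitive_of_weak_deriv hl1 hl2 fun θ h1 h2 h3 =>
    h.integral_coef_weak hσ hE hu htr hsol k h1 h2 h3
  have hi : ∀ z, 0 ≤ z →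
      IntervalIntegrable (fun t => eig k * (t ^ (1 - 2 * σ) * coef u G k t)) volume 0 z :=
    fun z hz => intervalIntegrable_weight_mul hσ1 hz
      (continuousOn_Ici_of_primitive hgi (fun _ _ => rfl) z hz) _
  -- Again the base point moves from 1 to 0; the weight is integrable there because σ < 1.
  refine ⟨A - ∫ t in 0..1, eig k * (t ^ (1 - 2 * σ) * coef u G k t), ?_⟩
  filter_upwards [hA] with z hz hz'
  rw [hz hz']
  have := intervalIntegral.integral_add_adjacent_intervals (hi 1 zero_le_one)
    ((hi 1 zero_le_one).symm.trans (hi z (le_of_lt hz')))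
  linarith

/-- Both sides agree for almost every z and are continuous in z, the left one because the slices of
U are; hence they agree at every height. -/
theorem IsExtension.coef_eq {φ : Sp N → ℝ} {U : Sp N × ℝ → ℝ} (hU : IsExtension N σ φ U)
    (hσ : 0 < σ) (hφ : MemLp φ 2 (gauss N)) (h : HasWeakGradient N U G) (hE : energy N σ G < ⊤)
    (k : Fin N → ℕ) {z : ℝ} (hz : 0 < z) :
    ∫ x, U (x, z) * hermiteOn k x ∂(gauss N) = coef φ G k z := by
  have hc : ContinuousOn (fun z => ∫ x, U (x, z) * hermiteOn k x ∂(gauss N)) (Ioi 0) := by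
    intro z₀ hz₀
    refine ContinuousAt.continuousWithinAt ?_
    refine tendsto_integral_mul_of_tendsto_eLpNorm (memLp_hermiteOn k) (hU.slice_memLp z₀ hz₀) ?_
      (hU.slice_continuous z₀ hz₀)
    filter_upwards [Ioi_mem_nhds hz₀] with t ht using hU.slice_memLp t ht
  refine Measure.eqOn_open_of_ae_eq (μ := volume) ?_ isOpen_Ioi hc
    (h.continuousOn_coef hσ hE k) hz
  filter_upwards [ae_restrict_mem measurableSet_Ioi, ae_restrict_of_ae
    (h.tendsto_pairing_cutoff_hermiteOn hσ hE hφ hU.boundary k)] with t ht ht'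
  exact tendsto_nhds_unique
    (tendsto_integral_cutoff_mul (hU.slice_memLp t ht) (memLp_hermiteOn k)) (ht' ht)

/-- The bound for a single Hermite mode. -/
theorem HasWeakGradient.mode_bound {U : Sp N × ℝ → ℝ} {G' : Sp N × ℝ → Sp N × ℝ}
    (hσ : 0 < σ) (hσ1 : σ < 1) (hu : MemLp u 2 (gauss N))
    (h : HasWeakGradient N U G) (hE : energy N σ G < ⊤) (htr : HasTrace N U u)
    (hsol : ∀ η : Sp N × ℝ → ℝ, IsTestFunction N η →
      ∫ p, p.2 ^ (1 - 2 * σ) * fderiv ℝ η p (G p) ∂(gaussHalf N) = 0)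
    (h' : HasWeakGradient N v G') (hE' : energy N σ G' < ⊤) (htr' : HasTrace N v u)
    (k : Fin N → ℕ) {z : ℝ} (hz : 0 ≤ z) :
    (∫ x, u x * hermiteOn k x ∂(gauss N)) *
      ((∫ x, u x * hermiteOn k x ∂(gauss N)) - coef u G k z) ≤
    z ^ (2 * σ) / (2 * σ) * ∫ t in Ioi 0, t ^ (1 - 2 * σ) *
      (coefDeriv G' k t ^ 2 + eig k * coef u G' k t ^ 2) := by
  obtain ⟨p0, hp0⟩ := h.exists_flux hσ hσ1 hE hu htr hsol k
  have hk2 := h.weightedL2_snd hE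
  have hk2' := h'.weightedL2_snd hE'
  -- At eigenvalue 0 the coefficient is constant, so the left side is 0; otherwise the general mode
  -- estimate applies.
  by_cases hk : eig k = 0
  · have hc := primitive_eq_const_of_flux_const (p0 := p0) hσ
      (g := coefDeriv G k) (hk2.integrableOn_pairing_sq (memLp_hermiteOn k)) (c := coef u G k)
      (fun _ _ => rfl) (by simpa [hk] using hp0) hz
    rw [hc, sub_self, mul_zero]
    refine mul_nonneg (by positivity) (setIntegral_nonneg measurableSet_Ioi fun t ht => ?_)
    have : 0 < t ^ (1 - 2 * σ) := Real.rpow_pos_of_pos ht _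
    have := eig_nonneg k
    positivity
  · have hM : IsModeSolution σ (eig k) (∫ x, u x * hermiteOn k x ∂(gauss N)) p0 (coef u G k)
        (coefDeriv G k) (fun z => p0 + ∫ t in 0..z, eig k * (t ^ (1 - 2 * σ) * coef u G k t)) :=
      ⟨hk2.aestronglyMeasurable_pairing (memLp_hermiteOn k).1,
        hk2.integrableOn_pairing_sq (memLp_hermiteOn k), h.integrableOn_coef_sq hσ hE hu htr hk,
        fun _ _ => rfl, fun _ _ => rfl, hp0⟩
    exact hM.bound hσ hσ1 (eig_nonneg k)
      (hk2'.aestronglyMeasurable_pairing (memLp_hermiteOn k).1)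
      (hk2'.integrableOn_pairing_sq (memLp_hermiteOn k))
      (h'.integrableOn_coef_sq hσ hE' hu htr' hk) (fun _ _ => rfl) hz

end Modes

/-! ### Summation over modes and the constant β. -/

section Conclusion

variable {N : ℕ} {σ : ℝ} {v : Sp N × ℝ → ℝ} {G : Sp N × ℝ → Sp N × ℝ} {u : Sp N → ℝ}

/-- The gradient of a Hermite function. -/
noncomputable def gradHermiteOn (k : Fin N → ℕ) (x : Sp N) : Sp N :=
  WithLp.toLp 2 fun i => pd i (hermiteOn k) x

theorem inner_gradHermiteOn (k : Fin N → ℕ) (x w : Sp N) :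
    inner ℝ (gradHermiteOn k x) w = ∑ i, w i * pd i (hermiteOn k) x := by
  simp [gradHermiteOn, PiLp.inner_apply]

theorem memLp_gradHermiteOn (k : Fin N → ℕ) : MemLp (gradHermiteOn k) 2 (gauss N) :=
  MemLp.of_eval_piLp fun i => memLp_pd_hermiteOn k i

theorem integral_inner_gradHermiteOn (k l : Fin N → ℕ) :
    ∫ x, inner ℝ (gradHermiteOn k x) (gradHermiteOn l x) ∂(gauss N) =
      if k = l then eig k else 0 := by
  rw [← integral_pd_hermiteOn_mul]
  congr 1; ext x
  rw [inner_gradHermiteOn]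
  exact Finset.sum_congr rfl fun i _ => mul_comm _ _

/-- Bessel's inequality for the normalized gradients of the Hermite functions. -/
theorem sum_sq_integral_inner_gradHermiteOn_le {g : Sp N → Sp N} (hg : MemLp g 2 (gauss N))
    (s : Finset (Fin N → ℕ)) :
    ∑ k ∈ s with eig k ≠ 0,
      (∫ x, inner ℝ (gradHermiteOn k x) (g x) ∂(gauss N)) ^ 2 / eig k ≤
      ∫ x, ‖g x‖ ^ 2 ∂(gauss N) := by
  have h := sum_sq_integral_inner_le (ι := {k : Fin N → ℕ // eig k ≠ 0}) (μ := gauss N)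
    (e := fun k x => (Real.sqrt (eig k.1))⁻¹ • gradHermiteOn k.1 x) (g := g)
    (fun k => (memLp_gradHermiteOn k.1).const_smul (Real.sqrt (eig k.1))⁻¹) hg (fun k l => ?_)
    (s.subtype fun k => eig k ≠ 0)
  · refine le_trans (le_of_eq ?_) h
    rw [← Finset.sum_subtype_eq_sum_filter]
    refine Finset.sum_congr rfl fun k _ => ?_
    simp only [real_inner_smul_left, integral_const_mul]
    rw [mul_pow, inv_pow, Real.sq_sqrt (eig_nonneg _)]
    field_simp
  · simp only [real_inner_smul_left, real_inner_smul_right, integral_const_mul,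
      integral_inner_gradHermiteOn]
    by_cases hkl : k = l
    · subst hkl
      have h0 : 0 < eig k.1 := lt_of_le_of_ne (eig_nonneg _) (Ne.symm k.2)
      have h1 := Real.sqrt_pos.2 h0
      have h2 := Real.sq_sqrt h0.le
      simp only [if_true]
      field_simp
      linarith
    · simp [hkl, Subtype.val_inj]

/-- Bessel's inequality for the slices of the gradient. -/
theorem HasWeakGradient.ae_sum_modes_le (h : HasWeakGradient N v G) (hσ : 0 < σ)
    (hE : energy N σ G < ⊤) (hu : MemLp u 2 (gauss N)) (htr : HasTrace N v u)
    (s : Finset (Fin N → ℕ)) :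
    ∀ᵐ z, z ∈ Ioi (0:ℝ) → ∑ k ∈ s, (coefDeriv G k z ^ 2 + eig k * coef u G k z ^ 2) ≤
      ∫ x, (‖(G (x, z)).1‖ ^ 2 + (G (x, z)).2 ^ 2) ∂(gauss N) := by
  have hae : ∀ᵐ z, ∀ k i, z ∈ Ioi (0:ℝ) →
      ∫ x, (G (x, z)).1 i * pd i (hermiteOn k) x ∂(gauss N) = k i * coef u G k z :=
    ae_all_iff.2 fun k => ae_all_iff.2 fun i => h.ae_integral_coord_mul_pd hσ hE hu htr k i
  have hco : ∀ᵐ z, ∀ i, z ∈ Ioi (0:ℝ) → MemLp (fun x => (G (x, z)).1 i) 2 (gauss N) :=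
    ae_all_iff.2 fun i => (h.weightedL2_coord hE i).ae_memLp
  filter_upwards [hae, hco, (h.weightedL2_snd hE).ae_memLp] with z h1 h2 h3 hz
  have hm1 : MemLp (fun x => (G (x, z)).1) 2 (gauss N) := MemLp.of_eval_piLp fun i => h2 i hz
  have hm2 := h3 hz
  rw [integral_add hm1.integrable_norm_pow' hm2.integrable_sq, Finset.sum_add_distrib, add_comm]
  refine add_le_add ?_ ?_
  · refine le_trans (le_of_eq ?_) (sum_sq_integral_inner_gradHermiteOn_le hm1 s)
    rw [Finset.sum_filter]
    refine Finset.sum_congr rfl fun k _ => ?_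
    split_ifs with hk
    -- The square of this pairing divided by the eigenvalue is the x-part `eig k` · `coef`² of the
    -- mode energy.
    · have e : ∫ x, inner ℝ (gradHermiteOn k x) (G (x, z)).1 ∂(gauss N) =
          eig k * coef u G k z := by
        simp only [inner_gradHermiteOn]
        rw [integral_finsetSum (f := fun i x => (G (x, z)).1 i * pd i (hermiteOn k) x) _
          fun i _ => (h2 i hz).integrable_mul (memLp_pd_hermiteOn k i)]
        rw [Finset.sum_congr rfl fun i _ => h1 k i hz, eig, Finset.sum_mul]
      rw [e]
      field_simp
    · simp [not_not.1 hk]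
  · have h4 := sum_sq_integral_inner_le (e := fun k : Fin N → ℕ => hermiteOn k)
      (fun k => memLp_hermiteOn k) hm2 (fun k l => by
        rw [← integral_hermiteOn_mul]
        congr 1; ext x; simp [mul_comm]) s
    simp only [Real.norm_eq_abs, sq_abs] at h4
    exact h4

/-- The energy dominates any finite sum of energies of modes. -/
theorem HasWeakGradient.sum_mode_energy_le (h : HasWeakGradient N v G) (hσ : 0 < σ)
    (hE : energy N σ G < ⊤) (hu : MemLp u 2 (gauss N)) (htr : HasTrace N v u)
    (s : Finset (Fin N → ℕ)) :
    ∑ k ∈ s, ∫ t in Ioi 0, t ^ (1 - 2 * σ) *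
        (coefDeriv G k t ^ 2 + eig k * coef u G k t ^ 2) ≤
      ∫ z in Ioi 0, z ^ (1 - 2 * σ) *
        ∫ x, (‖(G (x, z)).1‖ ^ 2 + (G (x, z)).2 ^ 2) ∂(gauss N) := by
  have hi : ∀ k, IntegrableOn (fun t => t ^ (1 - 2 * σ) *
      (coefDeriv G k t ^ 2 + eig k * coef u G k t ^ 2)) (Ioi 0) := by
    intro k
    have h1 : IntegrableOn (fun t => t ^ (1 - 2 * σ) * coefDeriv G k t ^ 2) (Ioi 0) :=
      (h.weightedL2_snd hE).integrableOn_pairing_sq (memLp_hermiteOn k)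
    by_cases hk : eig k = 0
    · simpa [hk] using h1
    · refine (h1.add ((h.integrableOn_coef_sq hσ hE hu htr hk).const_mul (eig k))).congr
        (ae_of_all _ fun t => ?_)
      simp only [Pi.add_apply]
      ring
  have hI : IntegrableOn (fun z => z ^ (1 - 2 * σ) *
      ∫ x, (‖(G (x, z)).1‖ ^ 2 + (G (x, z)).2 ^ 2) ∂(gauss N)) (Ioi 0) := by
    have h2 := Integrable.integral_prod_right (h.integrable_energy hE)
    simp only [integral_mul_const] at h2
    exact h2.congr (ae_of_all _ fun z => mul_comm _ _)
  rw [← integral_finsetSum _ fun k _ => hi k]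
  refine setIntegral_mono_on_ae (integrable_finsetSum _ fun k _ => hi k) hI measurableSet_Ioi ?_
  filter_upwards [h.ae_sum_modes_le hσ hE hu htr s] with z hz hz'
  rw [← Finset.mul_sum]
  exact mul_le_mul_of_nonneg_left (hz hz') (Real.rpow_nonneg (le_of_lt hz') _)

theorem IsExtension.integrable_mul_sub {φ : Sp N → ℝ} {U : Sp N × ℝ → ℝ}
    (hU : IsExtension N σ φ U) (hφ : MemLp φ 2 (gauss N)) {z : ℝ} (hz : 0 < z) :
    Integrable (fun x => φ x * (φ x - U (x, z))) (gauss N) :=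
  hφ.integrable_mul (hφ.sub (hU.slice_memLp z hz))

/-- The loss of mass of the extension at height `z` is controlled by the energy of any
competitor. -/
theorem IsExtension.ofReal_integral_mul_sub_le_energy {φ : Sp N → ℝ} {U : Sp N × ℝ → ℝ}
    (hU : IsExtension N σ φ U) (hσ : 0 < σ) (hσ1 : σ < 1) (hφ : MemLp φ 2 (gauss N))
    (h : HasWeakGradient N v G) (htr : HasTrace N v φ) {z : ℝ} (hz : 0 < z) :
    ENNReal.ofReal (∫ x, φ x * (φ x - U (x, z)) ∂(gauss N)) ≤
      ENNReal.ofReal (z ^ (2 * σ) / (2 * σ)) * energy N σ G := by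
  have hc : 0 < z ^ (2 * σ) / (2 * σ) := by have := Real.rpow_pos_of_pos hz (2 * σ); positivity
  by_cases hE : energy N σ G < ⊤
  swap
  · rw [not_lt_top_iff.1 hE, ENNReal.mul_top (ENNReal.ofReal_pos.2 hc).ne']
    exact le_top
  rw [h.energy_eq hE, ← ENNReal.ofReal_mul hc.le]
  apply ENNReal.ofReal_le_ofReal
  obtain ⟨GU, hGU, hEU, hsol⟩ := hU.weak_solution
  have hsum := (hasSum_integral_hermiteOn hφ hφ).sub
    (hasSum_integral_hermiteOn hφ (hU.slice_memLp z hz))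
  rw [← integral_sub (f := fun x => φ x * φ x) (g := fun x => φ x * U (x, z))
    (hφ.integrable_mul hφ) (hφ.integrable_mul (hU.slice_memLp z hz))] at hsum
  simp only [← mul_sub] at hsum
  -- Bounding finite partial sums suffices, so the estimate is made mode by mode and the mode
  -- energies are never summed as a series.
  refine hasSum_le_of_sum_le hsum fun s => ?_
  refine le_trans ?_ (mul_le_mul_of_nonneg_left (h.sum_mode_energy_le hσ hE hφ htr s) hc.le)
  rw [Finset.mul_sum]
  refine Finset.sum_le_sum fun k _ => ?_
  rw [hU.coef_eq hσ hφ hGU hEU k hz]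
  exact hGU.mode_bound hσ hσ1 hφ hEU hU.boundary hsol h hE htr k hz.le

theorem IsExtension.ofReal_integral_mul_sub_le {φ : Sp N → ℝ} {U : Sp N × ℝ → ℝ}
    (hU : IsExtension N σ φ U) (hσ : 0 < σ) (hσ1 : σ < 1) (hφ : MemLp φ 2 (gauss N))
    {z : ℝ} (hz : 0 < z) :
    ENNReal.ofReal (∫ x, φ x * (φ x - U (x, z)) ∂(gauss N)) ≤
      ENNReal.ofReal (z ^ (2 * σ) / (2 * σ)) * seminormSq N σ φ := by
  have hc : 0 < z ^ (2 * σ) / (2 * σ) := by have := Real.rpow_pos_of_pos hz (2 * σ); positivity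
  rw [← ENNReal.div_le_iff' (ENNReal.ofReal_pos.2 hc).ne' ENNReal.ofReal_ne_top]
  refine le_iInf fun w => le_iInf fun D => le_iInf fun hw => le_iInf fun ht => ?_
  rw [ENNReal.div_le_iff' (ENNReal.ofReal_pos.2 hc).ne' ENNReal.ofReal_ne_top]
  exact hU.ofReal_integral_mul_sub_le_energy hσ hσ1 hφ hw ht hz

/-- The functional equation of Γ, at r/2 and at -r/2, cancels every Gamma factor. The absolute value
is resolved by Γ(-r/2) < 0, valid as 0 < r/2 < 1. -/
theorem constBeta_eq {r : ℝ} (hr0 : 0 < r) (hr2 : r < 2) : constBeta r = 1 / r := by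
  have h1 : 0 < Real.Gamma (1 - r / 2) := Real.Gamma_pos_of_pos (by linarith)
  have h2 : 0 < Real.Gamma (r / 2) := Real.Gamma_pos_of_pos (by linarith)
  have h3 : Real.Gamma (1 + r / 2) = r / 2 * Real.Gamma (r / 2) := by
    rw [add_comm, Real.Gamma_add_one (by positivity)]
  have h4 : Real.Gamma (1 - r / 2) = -(r / 2) * Real.Gamma (-(r / 2)) := by
    rw [← Real.Gamma_add_one (by linarith)]
    congr 1; ring
  have h5 : |Real.Gamma (-(r / 2))| = Real.Gamma (1 - r / 2) / (r / 2) := by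
    rw [abs_of_neg, h4]
    · field_simp
    · rw [h4] at h1
      by_contra! hge
      nlinarith
  have h6 : (0:ℝ) < 4 ^ (r / 2) := by positivity
  rw [constBeta, constK, h5, h3]
  have := h1.ne'
  generalize Real.Gamma (1 - r / 2) = c at *
  field_simp

theorem memLp_chi {E : Set (Sp N)} (hE : MeasurableSet E) : MemLp (chi N E) 2 (gauss N) :=
  memLp_indicator_const 2 hE 1 (Or.inr (measure_ne_top _ _))

end Conclusion

end GaussFrac

theorem mainTheorem3 (N : ℕ) (hN : 1 ≤ N) (s : ℝ) (hs0 : 0 < s) (hs1 : s < 1) :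
    (∀ φ ∈ GaussFrac.fracOUDomain N s, ∀ U : GaussFrac.Sp N × ℝ → ℝ,
      GaussFrac.IsExtension N s φ U → ∀ z : ℝ, 0 < z →
        Integrable (fun x => φ x * (φ x - U (x, z))) (GaussFrac.gauss N) ∧
        ENNReal.ofReal (∫ x, φ x * (φ x - U (x, z)) ∂(GaussFrac.gauss N)) ≤
          ENNReal.ofReal (GaussFrac.constBeta (2 * s) * z ^ (2 * s)) *
            GaussFrac.seminormSq N s φ) ∧
    (∀ E : Set (GaussFrac.Sp N), MeasurableSet E → ∀ U : GaussFrac.Sp N × ℝ → ℝ,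
      GaussFrac.IsExtension N (s / 2) (GaussFrac.chi N E) U → ∀ z : ℝ, 0 < z →
        IntegrableOn (fun x => 1 - U (x, z)) E (GaussFrac.gauss N) ∧
        ENNReal.ofReal (∫ x in E, (1 - U (x, z)) ∂(GaussFrac.gauss N)) ≤
          ENNReal.ofReal (2 * GaussFrac.constBeta s * z ^ s) *
            GaussFrac.fracPerimeter N s E) := by
  refine ⟨fun φ hφ U hU z hz => ?_, fun E hE U hU z hz => ?_⟩
  · obtain ⟨f, hf⟩ := hφ
    refine ⟨hU.integrable_mul_sub hf.memLp hz, ?_⟩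
    rw [GaussFrac.constBeta_eq (by linarith) (by linarith), one_div_mul_eq_div]
    exact hU.ofReal_integral_mul_sub_le hs0 hs1 hf.memLp hz
  · have hφ := GaussFrac.memLp_chi hE
    have hone := (integrable_const (1:ℝ)).sub
      ((hU.slice_memLp z hz).integrable (by norm_num))
    refine ⟨hone.integrableOn, ?_⟩
    -- Since χ_E² = χ_E, the set version is the general estimate for φ = χ_E with σ = s/2; the
    -- factor 2 undoes the one half in the perimeter.
    have hmul : ∫ x in E, (1 - U (x, z)) ∂(GaussFrac.gauss N) =
        ∫ x, GaussFrac.chi N E x * (GaussFrac.chi N E x - U (x, z)) ∂(GaussFrac.gauss N) := by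
      rw [← integral_indicator hE]
      congr 1; ext x
      by_cases hx : x ∈ E <;> simp [GaussFrac.chi, hx]
    have hb := hU.ofReal_integral_mul_sub_le (by linarith) (by linarith) hφ hz
    rw [hmul]
    refine hb.trans (le_of_eq ?_)
    have e1 : z ^ (2 * (s / 2)) / (2 * (s / 2)) = GaussFrac.constBeta s * z ^ s := by
      rw [GaussFrac.constBeta_eq hs0 (by linarith), one_div_mul_eq_div, mul_div_cancel₀ s two_ne_zero]
    rw [GaussFrac.fracPerimeter, mul_assoc, ENNReal.ofReal_mul zero_le_two, e1]
    rw [ENNReal.ofReal_ofNat, mul_comm (2:ℝ≥0∞), mul_assoc, ENNReal.mul_div_cancel (by simp) (by simp)]
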